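/- **Conventions.** A manifold with corners is a Hausdorff paracompact smooth manifold locally modeled on open subsets of $\mathbb{R}_{\ge 0}^k\times\mathbb{R}^{d-k}$; a submanifold is a closed subset locally given, in such coordinates, by the vanishing of some of the coordinates. A *smooth normal crossings variety* $\Sigma$ in a manifold $M$ is a finite union of codimension one submanifolds such that each $p\in M$ has local coordinates centered at $p$ in which $\Sigma=\{x_1\cdots x_c=0\}$ for some $c\ge 0$. $C^\infty(M,\Sigma)$ is the space of smooth functions $f$ on $M\setminus\Sigma$ whose restriction to each connected component of $M\setminus\Sigma$ extends to a smooth function on $M$. A *piecewise smooth regularized space* $(N,M,\Sigma)$ consists of a manifold with corners $N$, a closed codimension one submanifold $M\subset\partial N$ (a union of boundary components) and a smooth normal crossings variety $\Sigma$ in $M$. $C^\infty(N,M,\Sigma)$ is the space of smooth functions on $N\setminus\Sigma$ (up to the boundary) whose restriction to $M\setminus\Sigma$ belongs to $C^\infty(M,\Sigma)$; so $C^\infty(N,M,\emptyset)=C^\infty(N)$. For an open $U\subset N$ we write $C^\infty(U,M,\Sigma)$ for $C^\infty(U,M\cap U,\Sigma\cap U)$. The *blowing-up* of $(N,M,\Sigma)$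 with center a submanifold $C\subset N$ of codimension $\ge 1$ is $\varphi:(\tilde N,\tilde M,\tilde\Sigma)\to(N,M,\Sigma)$, where $\varphi:\tilde N\to N$ is the spherical (polar) blowing-up of $N$ along $C$ and $\tilde M=\overline{\varphi^{-1}(M\setminus C)}$, $\tilde\Sigma=\overline{\varphi^{-1}(\Sigma\setminus C)}$ are the strict transforms. A *mollifier* is a smooth compactly supported $m:\mathbb{R}^n\to\mathbb{R}_{\ge 0}$ with $\int m=1$; put $m_\varepsilon(x)=\varepsilon^{-n}m(x/\varepsilon)$. For $M\subset\mathbb{R}^n$ open and $f\in C^\infty(M,\Sigma)$ let $f^{\mathrm{reg}}(x,\varepsilon)=(m_\varepsilon*f)(x)=\int f(x-y)\,m_\varepsilon(y)\,dy$ for $\varepsilon>0$ and $f^{\mathrm{reg}}(x,0)=f(x)$. It is defined, outside $\Sigma\times\{0\}$, on $$\Omega_m=\{(x,\varepsilon)\in M\times\mathbb{R}_{\ge 0} : x-\varepsilon t\in M \text{ for all } t\in\operatorname{supp} m\},$$ an open neighborhood of $M\times\{0\}$ in $M\times\mathbb{R}_{\ge 0}$, equal to $M\times\mathbb{R}_{\ge0}$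 if $M=\mathbb{R}^n$. **Theorem.** Let $M\subset\mathbb{R}^n$ be open, let $\Sigma\subset M$ be a smooth normal crossings variety in $M$, and let $N_0=M\times\mathbb{R}_{\ge 0}$, $M_0=M\times\{0\}$, $\Sigma_0=\Sigma\times\{0\}$. There is a finite sequence of blowings-up $$(N_0,M_0,\Sigma_0)\xleftarrow{\varphi_1}(N_1,M_1,\Sigma_1)\leftarrow\cdots\xleftarrow{\varphi_r}(N_r,M_r,\Sigma_r)$$ of piecewise smooth regularized spaces (that is, each $(N_k,M_k,\Sigma_k)$, $0\le k\le r$, is one) such that, with $\Phi_k=\varphi_1\circ\cdots\circ\varphi_k$: 1. for $0\le k<r$ the center $C_k\subset N_k$ of $\varphi_{k+1}$ is contained in $\Sigma_k$; 2. for every $0\le k\le r$ and every mollifier $m$ there is a linear operator $T:C^\infty(M,\Sigma)\to C^\infty(\Phi_k^{-1}(\Omega_m),M_k,\Sigma_k)$ such that, for every $f$, $Tf=f^{\mathrm{reg}}\circ\Phi_k$ at all points of $\Phi_k^{-1}(\Omega_m\setminus\Sigma_0)$; 3. $\Sigma_r=\emptyset$. In particular, for all $f\in C^\infty(M,\Sigma)$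 and all mollifiers $m$, $f^{\mathrm{reg}}\circ\Phi_r$ extends from $\Phi_r^{-1}(\Omega_m\setminus\Sigma_0)$ to a smooth function on the open subset $\Phi_r^{-1}(\Omega_m)$ of $N_r$ (which is all of $N_r$ if $M=\mathbb{R}^n$). -/

import Mathlib

open Set Topology MeasureTheory
open scoped Manifold ContDiff Convolution

noncomputable section

namespace Smoothing

/-- Euclidean space `ℝᵈ`. -/
abbrev E (d : ℕ) : Type := EuclideanSpace ℝ (Fin d)

/-- The model `ℝ_{≥0}ᵈ` for `d`-dimensional manifolds with corners.  An open subset of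
`ℝ_{≥0}ᵏ × ℝᵈ⁻ᵏ` is locally diffeomorphic to an open subset of `ℝ_{≥0}ᵈ` (translate the last `d-k`
coordinates), so this is the usual notion of manifold with corners. -/
abbrev Corner (d : ℕ) : ModelWithCorners ℝ (E d) (EuclideanQuadrant d) :=
  modelWithCornersEuclideanQuadrant d

/-! ### Piecewise smooth functions on an open subset of Euclidean space -/

section Euclidean

variable {n : ℕ}

/-- `e` is a smooth local coordinate system of `M ⊆ ℝⁿ` centered at `p`. -/
def IsChartAt (M : Set (E n)) (p : E n) (e : OpenPartialHomeomorph (E n) (E n)) : Prop :=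
  e.source ⊆ M ∧ p ∈ e.source ∧ e p = 0 ∧
    ContDiffOn ℝ ∞ e e.source ∧ ContDiffOn ℝ ∞ e.symm e.target

/-- `S` is a (closed, embedded) smooth submanifold of codimension one of the open set `M`. -/
def IsHypersurface (M S : Set (E n)) : Prop :=
  S ⊆ M ∧ (∃ F, IsClosed F ∧ S = M ∩ F) ∧
    ∀ p ∈ S, ∃ e, IsChartAt M p e ∧ ∃ i : Fin n, S ∩ e.source = {x ∈ e.source | e x i = 0}

/-- `Sig` is a smooth normal crossings variety in the open set `M`: a finite union of smooth
hypersurfaces which, near each point, is `{x₁ ⋯ x_c = 0}` in centered local coordinates. -/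
def IsNormalCrossings (M Sig : Set (E n)) : Prop :=
  (∃ (c : ℕ) (S : Fin c → Set (E n)), (∀ j, IsHypersurface M (S j)) ∧ Sig = ⋃ j, S j) ∧
    ∀ p ∈ M, ∃ e, IsChartAt M p e ∧
      ∃ J : Finset (Fin n), Sig ∩ e.source = {x ∈ e.source | ∏ i ∈ J, e x i = 0}

/-- The space `C^∞(M, Sig)`: functions which are smooth on `M \ Sig` and whose restriction to each
connected component of `M \ Sig` extends to a smooth function on `M`.  The elements are represented
by functions on `ℝⁿ` whose values outside `M \ Sig` are irrelevant. -/
def PiecewiseSmooth (M Sig : Set (E n)) : Submodule ℝ (E n → ℝ) where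
  carrier := {f | ContDiffOn ℝ ∞ f (M \ Sig) ∧ ∀ p ∈ M \ Sig, ∃ h : E n → ℝ,
    ContDiffOn ℝ ∞ h M ∧ EqOn f h (connectedComponentIn (M \ Sig) p)}
  add_mem' := by
    rintro f g ⟨hf, hf'⟩ ⟨hg, hg'⟩
    refine ⟨hf.add hg, fun p hp => ?_⟩
    obtain ⟨a, ha, ha'⟩ := hf' p hp
    obtain ⟨b, hb, hb'⟩ := hg' p hp
    exact ⟨a + b, ha.add hb, fun x hx => by simp [ha' hx, hb' hx]⟩
  zero_mem' := ⟨contDiffOn_const, fun _ _ => ⟨0, contDiffOn_const, fun _ _ => rfl⟩⟩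
  smul_mem' := by
    rintro c f ⟨hf, hf'⟩
    refine ⟨hf.const_smul c, fun p hp => ?_⟩
    obtain ⟨a, ha, ha'⟩ := hf' p hp
    exact ⟨c • a, ha.const_smul c, fun x hx => by simp [ha' hx]⟩

/-- A mollifier in `ℝⁿ`. -/
def IsMollifier (m : E n → ℝ) : Prop :=
  ContDiff ℝ ∞ m ∧ (∀ x, 0 ≤ m x) ∧ ∫ x, m x = 1 ∧ HasCompactSupport m

/-- The rescaled mollifier `m_ε(x) = ε⁻ⁿ m(x / ε)`. -/
def rescale (m : E n → ℝ) (ε : ℝ) : E n → ℝ := fun x => (ε ^ n)⁻¹ * m (ε⁻¹ • x)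

/-- The regularization by convolution: `f^reg(x, ε) = (m_ε ∗ f)(x) = ∫ f(x - y) m_ε(y) dy` for
`ε > 0`, completed by `f^reg(x, 0) = f(x)`. -/
def reg (m f : E n → ℝ) (q : E n × ℝ) : ℝ :=
  if 0 < q.2 then (rescale m q.2 ⋆ f) q.1 else f q.1

/-- The points `(x, ε)` at which `(m_ε ∗ f)(x)` only involves values of `f` on `M`, that is,
`x - ε t ∈ M` for all `t` in the support of `m`.  It is a neighborhood of `M × {0}` in
`M × ℝ_{≥0}`, and everything if `M = ℝⁿ`. -/
def regDomain (M : Set (E n)) (m : E n → ℝ) : Set (E n × ℝ) :=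
  {q | q.1 ∈ M ∧ 0 ≤ q.2 ∧ ∀ t ∈ tsupport m, q.1 - q.2 • t ∈ M}

end Euclidean

/-! ### Manifolds with corners and regularized spaces -/

/-- A `d`-dimensional manifold with corners (`carrier`) with two distinguished subsets: the initial
manifold `M` and the discontinuity locus `Sig`.  The conditions on these subsets are given by
`RegSpace.IsRegularized`. -/
structure RegSpace (d : ℕ) where
  carrier : Type
  [top : TopologicalSpace carrier]
  [t2 : T2Space carrier]
  [paracompact : ParacompactSpace carrier]
  [charted : ChartedSpace (EuclideanQuadrant d) carrier]
  [manifold : IsManifold (Corner d) ∞ carrier]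
  M : Set carrier
  Sig : Set carrier

attribute [instance] RegSpace.top RegSpace.t2 RegSpace.paracompact RegSpace.charted
  RegSpace.manifold

section Corners

variable {d : ℕ}

/-- `e` is a smooth local coordinate system of the manifold with corners `X`, with values in an open
subset of `{y ∈ ℝᵈ | y_i ≥ 0 for i ∈ B} ≅ ℝ_{≥0}ᵏ × ℝᵈ⁻ᵏ`, `k = #B`. -/
def IsCornerChart (X : RegSpace d) (e : PartialEquiv X.carrier (E d)) (B : Finset (Fin d)) : Prop :=
  IsOpen e.source ∧ (∃ O, IsOpen O ∧ e.target = O ∩ {y | ∀ i ∈ B, 0 ≤ y i}) ∧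
    ContMDiffOn (Corner d) 𝓘(ℝ, E d) ∞ e e.source ∧
    ContMDiffOn 𝓘(ℝ, E d) (Corner d) ∞ e.symm e.target

/-- `e` is a local coordinate system centered at `p` in which the initial manifold `X.M` is the
boundary hypersurface `{y_b = 0}`. -/
def IsAdaptedChartAt (X : RegSpace d) (p : X.carrier) (e : PartialEquiv X.carrier (E d))
    (B : Finset (Fin d)) (b : Fin d) : Prop :=
  IsCornerChart X e B ∧ p ∈ e.source ∧ e p = 0 ∧ b ∈ B ∧
    X.M ∩ e.source = {x ∈ e.source | e x b = 0}

/-- `X` is a piecewise smooth regularized space: `X.M` is a closed submanifold of codimension one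
contained in the boundary (a union of boundary components), and `X.Sig` is a smooth normal crossings
variety in `X.M`, i.e. a finite union of codimension one submanifolds of `X.M` which is locally
`{x₁ ⋯ x_c = 0}` in centered local coordinates. -/
def RegSpace.IsRegularized (X : RegSpace d) : Prop :=
  IsClosed X.M ∧
  (∃ (c : ℕ) (S : Fin c → Set X.carrier), X.Sig = ⋃ j, S j ∧
    ∀ j, IsClosed (S j) ∧ S j ⊆ X.M ∧ ∀ p ∈ S j, ∃ e B b, IsAdaptedChartAt X p e B b ∧
      ∃ i, i ≠ b ∧ S j ∩ e.source = {x ∈ e.source | e x b = 0 ∧ e x i = 0}) ∧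
  ∀ p ∈ X.M, ∃ e B b, IsAdaptedChartAt X p e B b ∧
    ∃ J : Finset (Fin d), b ∉ J ∧
      X.Sig ∩ e.source = {x ∈ e.source | e x b = 0 ∧ ∏ i ∈ J, e x i = 0}

/-- The space `C^∞(U, X.M ∩ U, X.Sig ∩ U)` of piecewise smooth functions with discontinuity locus
`X.Sig` on an open set `U` of the regularized space `X`: functions which are smooth on `U \ X.Sig`
(including at the boundary points in `X.M \ X.Sig`) and whose restriction to the initial manifold
is piecewise smooth, i.e. the restriction to each connected component of `(X.M ∩ U) \ X.Sig` extends
to a smooth function on the manifold `X.M ∩ U`.  The elements are represented by functions on `X`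
whose values outside `U \ X.Sig` are irrelevant. -/
def RegSpace.PiecewiseSmooth (X : RegSpace d) (U : Set X.carrier) :
    Submodule ℝ (X.carrier → ℝ) where
  carrier := {g | ContMDiffOn (Corner d) 𝓘(ℝ, ℝ) ∞ g (U \ X.Sig) ∧
    ∀ p ∈ (X.M ∩ U) \ X.Sig, ∃ h : X.carrier → ℝ,
      ContMDiffOn (Corner d) 𝓘(ℝ, ℝ) ∞ h (X.M ∩ U) ∧
      EqOn g h (connectedComponentIn ((X.M ∩ U) \ X.Sig) p)}
  add_mem' := by
    rintro f g ⟨hf, hf'⟩ ⟨hg, hg'⟩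
    refine ⟨hf.add hg, fun p hp => ?_⟩
    obtain ⟨a, ha, ha'⟩ := hf' p hp
    obtain ⟨b, hb, hb'⟩ := hg' p hp
    exact ⟨a + b, ha.add hb, fun x hx => by simp [ha' hx, hb' hx]⟩
  zero_mem' := ⟨contMDiffOn_const, fun _ _ => ⟨0, contMDiffOn_const, fun _ _ => rfl⟩⟩
  smul_mem' := by
    rintro c f ⟨hf, hf'⟩
    refine ⟨(contMDiffOn_const (c := c) (I := Corner d) (I' := 𝓘(ℝ, ℝ))).smul hf, fun p hp => ?_⟩
    obtain ⟨a, ha, ha'⟩ := hf' p hp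
    exact ⟨c • a, (contMDiffOn_const (c := c) (I := Corner d) (I' := 𝓘(ℝ, ℝ))).smul ha, fun x hx => by simp [ha' hx]⟩

/-! ### Blowing-up -/

/-- The map `(r, w) ↦ y` with `y_i = r w_i` for `i ∈ S` and `y_i = w_i` for `i ∉ S`. -/
def polar (S : Finset (Fin d)) (u : ℝ × E d) : E d :=
  WithLp.toLp 2 fun i => if i ∈ S then u.1 * u.2 i else u.2 i

/-- The blown-up space of an open subset `T` of `{y ∈ ℝᵈ | y_i ≥ 0 for i ∈ B}` with center
`{y_i = 0 for i ∈ S}`: the points `(r, (w_i)_{i ∈ S}, (w_i)_{i ∉ S})` with `r ≥ 0` and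
`(w_i)_{i ∈ S}` in the unit sphere (in its part `w_i ≥ 0` for `i ∈ B ∩ S`). The blowing-up map
is `polar S`. -/
def polarModel (B S : Finset (Fin d)) (T : Set (E d)) : Set (ℝ × E d) :=
  {u | 0 ≤ u.1 ∧ ∑ i ∈ S, u.2 i ^ 2 = 1 ∧ (∀ i ∈ B ∩ S, 0 ≤ u.2 i) ∧ polar S u ∈ T}

/-- `φ : Y → X` is the (spherical) blowing-up of the manifold with corners `X` with center `C`.
Here `C` is a closed submanifold of some codimension `c ≥ 1`; over the complement of `C` the map `φ`
is a diffeomorphism, and over a coordinate domain in which `C = {y_i = 0 for i ∈ S}` it is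
diffeomorphic to the standard blowing-up in polar coordinates. -/
def IsBlowup (X Y : RegSpace d) (φ : Y.carrier → X.carrier) (C : Set X.carrier) : Prop :=
  ContMDiff (Corner d) (Corner d) ∞ φ ∧
  IsClosed C ∧
  (∃ ψ : X.carrier → Y.carrier, ContMDiffOn (Corner d) (Corner d) ∞ ψ Cᶜ ∧
    InvOn ψ φ (φ ⁻¹' Cᶜ) Cᶜ) ∧
  ∃ c : ℕ, 1 ≤ c ∧ ∀ p ∈ C, ∃ (e : PartialEquiv X.carrier (E d)) (B S : Finset (Fin d)),
    IsCornerChart X e B ∧ p ∈ e.source ∧ S.card = c ∧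
    C ∩ e.source = {x ∈ e.source | ∀ i ∈ S, e x i = 0} ∧
    ∃ θ : PartialEquiv Y.carrier (ℝ × E d),
      θ.source = φ ⁻¹' e.source ∧ θ.target = polarModel B S e.target ∧
      ContMDiffOn (Corner d) 𝓘(ℝ, ℝ × E d) ∞ θ θ.source ∧
      ContMDiffOn 𝓘(ℝ, ℝ × E d) (Corner d) ∞ θ.symm θ.target ∧
      ∀ q ∈ θ.source, e (φ q) = polar S (θ q)

/-- Blowing-up of regularized spaces: the initial manifold and the discontinuity locus are replaced
by their strict transforms. -/
def IsRegBlowup (X Y : RegSpace d) (φ : Y.carrier → X.carrier) (C : Set X.carrier) : Prop :=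
  IsBlowup X Y φ C ∧ Y.M = closure (φ ⁻¹' (X.M \ C)) ∧ Y.Sig = closure (φ ⁻¹' (X.Sig \ C))

/-- The sequence of spaces `X₀, Y₀, Y₁, Y₂, …`. -/
def stage (X₀ : RegSpace d) (Y : ℕ → RegSpace d) : ℕ → RegSpace d
  | 0 => X₀
  | k + 1 => Y k

/-- A finite sequence of blowings-up `X₀ = N₀ ← N₁ ← ⋯ ← N_r`, the map `φ k : N_{k+1} → N_k` having
center `center k ⊆ N_k` for `k < r` (the data of index beyond `r` are irrelevant). -/
structure BlowupSequence (X₀ : RegSpace d) where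
  r : ℕ
  next : ℕ → RegSpace d
  φ : ∀ k, (stage X₀ next (k + 1)).carrier → (stage X₀ next k).carrier
  center : ∀ k, Set (stage X₀ next k).carrier
  isBlowup : ∀ k < r, IsRegBlowup (stage X₀ next k) (stage X₀ next (k + 1)) (φ k) (center k)

/-- The space `N_k`. -/
abbrev BlowupSequence.space {X₀ : RegSpace d} (b : BlowupSequence X₀) (k : ℕ) : RegSpace d :=
  stage X₀ b.next k

/-- The composition `Φ_k : N_k → N₀` of the first `k` blowings-up. -/
def BlowupSequence.comp {X₀ : RegSpace d} (b : BlowupSequence X₀) :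
    ∀ k, (b.space k).carrier → X₀.carrier
  | 0 => id
  | k + 1 => b.comp k ∘ b.φ k

end Corners

/-! ### The product `M × ℝ_{≥0}` as a manifold with boundary -/

section Initial

variable {n : ℕ}

/-- The diffeomorphism `(x, ε) ↦ (ε, exp x₁, …, exp x_n)` from `ℝⁿ × ℝ` onto `ℝ × ℝ_{>0}ⁿ`. -/
def expChart (n : ℕ) : OpenPartialHomeomorph (E n × ℝ) (E (n + 1)) where
  toFun q := WithLp.toLp 2 (Fin.cons q.2 fun i => Real.exp (q.1 i))
  invFun y := (WithLp.toLp 2 fun i => Real.log (y i.succ), y 0)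
  source := univ
  target := {y | ∀ i : Fin n, 0 < y i.succ}
  map_source' q _ i := by simp [Real.exp_pos]
  map_target' _ _ := mem_univ _
  left_inv' q _ := by ext <;> simp
  right_inv' y hy := by
    ext i
    refine Fin.cases ?_ (fun j => ?_) i
    · simp
    · simpa using Real.exp_log (hy j)
  open_source := isOpen_univ
  open_target := by
    simp only [Set.ofPred_forall]
    exact isOpen_iInter_of_finite fun i => isOpen_lt continuous_const (by fun_prop)
  continuousOn_toFun := by
    refine Continuous.continuousOn ?_
    refine (PiLp.continuous_toLp 2 _).comp (continuous_pi fun i => ?_)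
    refine Fin.cases ?_ (fun j => ?_) i
    · simpa using continuous_snd
    · simp only [Fin.cons_succ]; fun_prop
  continuousOn_invFun := by
    refine ContinuousOn.prodMk ?_ (by fun_prop)
    refine (PiLp.continuous_toLp 2 _).comp_continuousOn (continuousOn_pi.2 fun i => ?_)
    exact ContinuousOn.log (by fun_prop) fun y hy => (hy i).ne'

/-- The set `M × ℝ_{≥0}`. -/
abbrev Cyl (M : Set (E n)) : Type := {q : E n × ℝ // q.1 ∈ M ∧ 0 ≤ q.2}

/-- `(x, ε) ↦ (ε, exp x₁, …, exp x_n)`, the global chart of `M × ℝ_{≥0}` with values in the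
quadrant. -/
def cylChart (M : Set (E n)) (q : Cyl M) : EuclideanQuadrant (n + 1) :=
  ⟨expChart n q.1, fun i => by
    refine Fin.cases ?_ (fun j => ?_) i
    · simpa [expChart] using q.2.2
    · simpa [expChart] using (Real.exp_pos _).le⟩

theorem isOpenEmbedding_cylChart {M : Set (E n)} (hM : IsOpen M) :
    IsOpenEmbedding (cylChart M) := by
  have hF : IsOpenEmbedding (expChart n) := (expChart n).isOpenEmbedding rfl
  have h : IsEmbedding (Subtype.val ∘ cylChart M) :=
    hF.isEmbedding.comp (IsEmbedding.subtypeVal (p := fun q : E n × ℝ => q.1 ∈ M ∧ 0 ≤ q.2))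
  have hval : Continuous (Subtype.val : EuclideanQuadrant (n + 1) → E (n + 1)) :=
    continuous_subtype_val
  have hc : Continuous (cylChart M) := h.continuous.subtype_mk _
  refine ⟨IsEmbedding.of_comp hc hval h, ?_⟩
  have hr : range (cylChart M) = Subtype.val ⁻¹' (expChart n '' (M ×ˢ univ)) := by
    ext y
    constructor
    · rintro ⟨q, rfl⟩
      exact ⟨q.1, ⟨q.2.1, mem_univ _⟩, rfl⟩
    · rintro ⟨q, ⟨hq, -⟩, hy⟩
      have h0 : 0 ≤ q.2 := by
        have := y.2 0
        rw [← hy] at this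
        simpa [expChart] using this
      exact ⟨⟨q, hq, h0⟩, Subtype.ext hy⟩
  rw [hr]
  exact (hF.isOpenMap _ (hM.prod isOpen_univ)).preimage hval

/-- The smooth structure of `M × ℝ_{≥0}`, given by one global chart. -/
@[reducible]
def cylChartedSpace {M : Set (E n)} (hM : IsOpen M) :
    ChartedSpace (EuclideanQuadrant (n + 1)) (Cyl M) where
  atlas := {e | ∃ _ : Nonempty (Cyl M),
    e = (isOpenEmbedding_cylChart hM).toOpenPartialHomeomorph (cylChart M)}
  chartAt q :=
    haveI : Nonempty (Cyl M) := ⟨q⟩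
    (isOpenEmbedding_cylChart hM).toOpenPartialHomeomorph (cylChart M)
  mem_chart_source q := mem_univ q
  chart_mem_atlas q := ⟨⟨q⟩, rfl⟩

theorem isManifold_cyl {M : Set (E n)} (hM : IsOpen M) :
    @IsManifold ℝ _ (E (n + 1)) _ _ _ _ (Corner (n + 1)) ∞ (Cyl M) _ (cylChartedSpace hM) := by
  letI := cylChartedSpace hM
  rcases isEmpty_or_nonempty (Cyl M) with h | h
  · refine @IsManifold.mk' _ _ _ _ _ _ _ _ _ _ _ _ ⟨?_⟩
    rintro e e' ⟨⟨q⟩, -⟩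
    exact (h.false q).elim
  · have := (isOpenEmbedding_cylChart hM).singleton_hasGroupoid (contDiffGroupoid ∞ (Corner (n + 1)))
    refine @IsManifold.mk' _ _ _ _ _ _ _ _ _ _ _ _ ⟨?_⟩
    rintro e e' ⟨_, rfl⟩ ⟨_, rfl⟩
    exact this.compatible (mem_singleton _) (mem_singleton _)

/-- The regularized space `(N, M, Sig)` with `N = M × ℝ_{≥0}`, initial manifold `M × {0}` and
discontinuity locus `Sig × {0}`. -/
def initialSpace (M Sig : Set (E n)) (hM : IsOpen M) : RegSpace (n + 1) :=
  letI := cylChartedSpace hM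
  haveI := isManifold_cyl hM
  { carrier := Cyl M
    M := {q | q.1.2 = 0}
    Sig := {q | q.1.2 = 0 ∧ q.1.1 ∈ Sig} }

/-- The point `(x, ε) ∈ ℝⁿ × ℝ` over which a point of `N_k` lies. -/
def BlowupSequence.proj {M Sig : Set (E n)} {hM : IsOpen M}
    (b : BlowupSequence (initialSpace M Sig hM)) (k : ℕ) (q : (b.space k).carrier) : E n × ℝ :=
  (b.comp k q : Cyl M).1

/-- The open set `Φ_k⁻¹(Ω)` of `N_k`, where `Ω ⊆ M × ℝ_{≥0}` is the domain of the regularization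
with mollifier `m`. -/
def BlowupSequence.domain {M Sig : Set (E n)} {hM : IsOpen M}
    (b : BlowupSequence (initialSpace M Sig hM)) (m : E n → ℝ) (k : ℕ) : Set (b.space k).carrier :=
  {q | b.proj k q ∈ regDomain M m}

end Initial

end Smoothing

end

/-! Local analysis. In coordinates `e` of `M` in which `Sig` is a union of coordinate hyperplanes,
substitute `x' = e.symm z`, `z = e x - ε s` in the convolution integral. The factor `m ((x - x') /
ε)` becomes `m` of an averaged derivative of `e.symm` (`meanDeriv`), which is smooth through `ε =
0`, and `f` is the restriction of a smooth function on each orthant. What remains is how each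
hyperplane meets the support of the kernel, and this is governed by the ratio of the coordinate `e x
i` to `ε`. There are two good regimes. If the ratio `α i` is a smooth function, then `f^reg` is a
finite sum, over sign patterns, of convolutions of the indicator of an orthant with a smooth kernel,
evaluated at `α`; it is smooth in `(x, ε, α)` (`exists_extension_of_ratios`). If `|e x i| > C * ε`,
the kernel does not see the jump across this hyperplane. When this holds for all hyperplanes, `f`
may be replaced by the smooth extension of one of its pieces (`exists_extension_of_signs`); the two
regimes may also be mixed.

Geometry. The blowings-up ensure that every hyperplane is in one of the two regimes. For every
nonempty set `J` of branches, the strict transform of the intersection of these branches, inside the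
initial manifold, is blown up, larger sets `J` first. When the turn of `J` comes, all the sets
`insert j J` have been treated, so no branch outside `J` meets the center. The singletons come last
and make the strict transform of `Sig` empty. Let `b` be an equation of the strict transform of the
initial manifold and `r J` the radii. Then `ε` is the product of `b` and all `r J`, and the equation
of the branch `j` is its strict transform `z j` times the product of the `r J` with `j ∈ J`. So the
ratio is `z j / radOut j`, where `radOut j` is the product of `b` and the `r J` with `j ∉ J`. Where
`radOut j` is nonzero the ratio is smooth. Where it vanishes, `z j` is nonzero outside the
discontinuity locus: if the strict transform of `j` vanished, no `r J` with `j ∉ J` would vanish, so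
`b = 0`, and the point would be in the locus. Then `|z j| > C * radOut j` nearby, which is the
second regime (`IsStage.exists_local_extension`).

Realization. All the blown-up spaces are subsets of one normed space `Amb`, with coordinates `x`,
`b`, the strict transforms `F j` and the radii. The inductive step is `IsStage.blow`, and
`IsStageModel.exists_blowup` translates it into the language of manifolds. A branch need not have a
global scalar equation, so `F j` takes values in a Hilbert space: local equations are patched by a
partition of unity along orthonormal vectors (`exists_vector_equation`). The lines `L j` are
recorded because at `r J = 0` the relation between `F j` and its strict transform says nothing about
the direction of the latter.

Operator. `Tf` is the limit of the regularization from `ε > 0`. Its restriction to the initial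
manifold is piecewise smooth because each component of the initial manifold minus the discontinuity
locus lies, up to a nowhere dense set, over one component of `M \ Sig`, so that a smooth extension
of `f` can be pulled back. -/

open Set Topology MeasureTheory Filter
open scoped Manifold ContDiff Convolution

noncomputable section

namespace Smoothing

set_option linter.unusedSectionVars false

section

/-! ### Subsets of a normed space as manifolds with corners. -/

section SubChart

variable {d : ℕ} {W : Type} [NormedAddCommGroup W] [NormedSpace ℝ W]

/-- The points of `ℝᵈ` whose coordinates of index in `B` are nonnegative. -/
def quad (B : Finset (Fin d)) : Set (E d) := {y | ∀ i ∈ B, 0 ≤ y i}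

/-- `e` is a smooth chart of the subset `A` of `W` with values in an open subset of `quad B`. -/
structure IsSubChart (A : Set W) (e : PartialEquiv W (E d)) (B : Finset (Fin d)) : Prop where
  source_eq : ∃ O, IsOpen O ∧ e.source = A ∩ O
  target_eq : ∃ O, IsOpen O ∧ e.target = O ∩ quad B
  contDiffOn : ContDiffOn ℝ ∞ e e.source
  contDiffOn_symm : ContDiffOn ℝ ∞ e.symm e.target

/-- Exponential of the coordinates of index outside `B`. -/
def expOff (B : Finset (Fin d)) (y : E d) : E d :=
  WithLp.toLp 2 fun i => if i ∈ B then y i else Real.exp (y i)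

/-- Logarithm of the coordinates of index outside `B`. -/
def logOff (B : Finset (Fin d)) (y : E d) : E d :=
  WithLp.toLp 2 fun i => if i ∈ B then y i else Real.log (y i)

theorem contDiff_coord {n : WithTop ℕ∞} (i : Fin d) : ContDiff ℝ n fun y : E d => y i :=
  contDiff_euclidean.1 contDiff_id i

theorem contDiff_expOff (B : Finset (Fin d)) : ContDiff ℝ ∞ (expOff B) := by
  refine contDiff_euclidean.2 fun i => ?_
  by_cases h : i ∈ B
  · simpa [expOff, h] using contDiff_coord i
  · simpa [expOff, h] using (contDiff_coord (n := ∞) i).exp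

theorem contDiffOn_logOff (B : Finset (Fin d)) :
    ContDiffOn ℝ ∞ (logOff B) {y | ∀ i ∉ B, 0 < y i} := by
  refine contDiffOn_euclidean.2 fun i => ?_
  by_cases h : i ∈ B
  · simpa [logOff, h] using (contDiff_coord i).contDiffOn
  · simpa [logOff, h] using (contDiff_coord (n := ∞) i).contDiffOn.log fun y hy => (hy i h).ne'

theorem logOff_expOff (B : Finset (Fin d)) (y : E d) : logOff B (expOff B y) = y := by
  ext i
  by_cases h : i ∈ B <;> simp [logOff, expOff, h]

theorem expOff_logOff {B : Finset (Fin d)} {y : E d} (hy : ∀ i ∉ B, 0 < y i) :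
    expOff B (logOff B y) = y := by
  ext i
  by_cases h : i ∈ B
  · simp [logOff, expOff, h]
  · simp [logOff, expOff, h, Real.exp_log (hy i h)]

theorem expOff_pos (B : Finset (Fin d)) (y : E d) : ∀ i ∉ B, 0 < expOff B y i := by
  intro i h
  simp [expOff, h, Real.exp_pos]

theorem isOpen_pos_off (B : Finset (Fin d)) : IsOpen {y : E d | ∀ i ∉ B, 0 < y i} := by
  have : {y : E d | ∀ i ∉ B, 0 < y i} = ⋂ i : Fin d, {y | i ∉ B → 0 < y i} := by
    ext; simp
  rw [this]
  refine isOpen_iInter_of_finite fun i => ?_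
  by_cases h : i ∈ B
  · simp [h]
  · simpa [h] using isOpen_lt continuous_const (contDiff_coord (n := 0) i).continuous

/-- The nonnegative part of `y` with values in the quadrant. -/
def toQuadrant (y : E d) : EuclideanQuadrant d := ⟨WithLp.toLp 2 fun i => |y i|, fun _ => abs_nonneg _⟩

theorem continuous_toQuadrant : Continuous (toQuadrant (d := d)) := by
  refine Continuous.subtype_mk ?_ _
  refine (PiLp.continuous_toLp 2 _).comp (continuous_pi fun i => ?_)
  exact (contDiff_coord (n := 0) i).continuous.abs

theorem toQuadrant_val {y : E d} (hy : ∀ i, 0 ≤ y i) : (toQuadrant y).1 = y := by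
  ext i
  simp [toQuadrant, abs_of_nonneg (hy i)]

theorem expOff_nonneg {B : Finset (Fin d)} {y : E d} (hy : y ∈ quad B) (i : Fin d) :
    0 ≤ expOff B y i := by
  by_cases h : i ∈ B
  · simpa [expOff, h] using hy i h
  · exact (expOff_pos B y i h).le

theorem logOff_mem_quad {B : Finset (Fin d)} {y : E d} (hy : ∀ i, 0 ≤ y i) :
    logOff B y ∈ quad B := by
  intro i h
  simpa [logOff, h] using hy i

theorem IsSubChart.mem_quad {A : Set W} {e : PartialEquiv W (E d)} {B : Finset (Fin d)}
    (h : IsSubChart A e B) {y : E d} (hy : y ∈ e.target) : y ∈ quad B := by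
  obtain ⟨O, -, hO⟩ := h.target_eq
  rw [hO] at hy
  exact hy.2

theorem IsSubChart.source_subset {A : Set W} {e : PartialEquiv W (E d)} {B : Finset (Fin d)}
    (h : IsSubChart A e B) : e.source ⊆ A := by
  obtain ⟨O, -, hO⟩ := h.source_eq
  rw [hO]
  exact inter_subset_left

open Classical in
/-- The chart of the subspace `A` with values in the quadrant given by a chart of the subset `A`. -/
def IsSubChart.homeo {A : Set W} {e : PartialEquiv W (E d)} {B : Finset (Fin d)}
    (h : IsSubChart A e B) (a₀ : A) : OpenPartialHomeomorph A (EuclideanQuadrant d) where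
  -- Coordinates of index outside `B` have no sign; exponentials move them to the interior of the
  -- quadrant.
  toFun a := toQuadrant (expOff B (e a))
  -- The value `a₀` only makes the inverse total; it is never taken on the target.
  invFun y := if hy : e.symm (logOff B y.1) ∈ A then ⟨_, hy⟩ else a₀
  source := Subtype.val ⁻¹' e.source
  target := {y | (∀ i ∉ B, 0 < y.1 i) ∧ logOff B y.1 ∈ e.target}
  map_source' a ha := by
    have hq := h.mem_quad (e.map_source ha)
    have := toQuadrant_val (expOff_nonneg hq)
    simp only [mem_ofPred_eq, this, logOff_expOff]
    exact ⟨expOff_pos B _, e.map_source ha⟩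
  map_target' y hy := by
    have h1 := e.map_target hy.2
    simp only [mem_preimage, dif_pos (h.source_subset h1)]
    exact h1
  left_inv' a ha := by
    have hq := h.mem_quad (e.map_source ha)
    have := toQuadrant_val (expOff_nonneg hq)
    have h2 : e.symm (logOff B (toQuadrant (expOff B (e a))).1) = a := by
      rw [this, logOff_expOff, e.left_inv ha]
    have h3 : e.symm (logOff B (toQuadrant (expOff B (e a))).1) ∈ A := by rw [h2]; exact a.2
    simp only [dif_pos h3]
    exact Subtype.ext h2
  right_inv' y hy := by
    have h1 := h.source_subset (e.map_target hy.2)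
    simp only [dif_pos h1]
    rw [e.right_inv hy.2, expOff_logOff hy.1]
    exact Subtype.ext (toQuadrant_val y.2)
  open_source := by
    obtain ⟨O, hO, hs⟩ := h.source_eq
    rw [hs]
    have : (Subtype.val ⁻¹' (A ∩ O) : Set A) = Subtype.val ⁻¹' O := by
      ext a
      simp
    rw [this]
    exact hO.preimage continuous_subtype_val
  open_target := by
    obtain ⟨O, hO, ht⟩ := h.target_eq
    have h1 : IsOpen ({y : E d | ∀ i ∉ B, 0 < y i} ∩ logOff B ⁻¹' O) :=
      (contDiffOn_logOff B).continuousOn.isOpen_inter_preimage (isOpen_pos_off B) hO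
    have h2 : {y : EuclideanQuadrant d | (∀ i ∉ B, 0 < y.1 i) ∧ logOff B y.1 ∈ e.target} =
        (Subtype.val : EuclideanQuadrant d → E d) ⁻¹'
          ({y : E d | ∀ i ∉ B, 0 < y i} ∩ logOff B ⁻¹' O) := by
      ext y
      have := logOff_mem_quad (B := B) y.2
      simp only [mem_ofPred_eq, ht, mem_inter_iff, mem_preimage, this, and_true]
    rw [h2]
    exact h1.preimage continuous_subtype_val
  continuousOn_toFun := by
    refine continuous_toQuadrant.comp_continuousOn ((contDiff_expOff B).continuous.comp_continuousOn ?_)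
    exact h.contDiffOn.continuousOn.comp continuous_subtype_val.continuousOn fun a ha => ha
  continuousOn_invFun := by
    rw [Topology.IsInducing.subtypeVal.continuousOn_iff]
    have h1 : ContinuousOn (fun y : EuclideanQuadrant d => e.symm (logOff B y.1))
        {y | (∀ i ∉ B, 0 < y.1 i) ∧ logOff B y.1 ∈ e.target} := by
      refine h.contDiffOn_symm.continuousOn.comp
        (t := e.target) ?_ fun y hy => hy.2
      exact (contDiffOn_logOff B).continuousOn.comp continuous_subtype_val.continuousOn
        fun y hy => hy.1
    refine h1.congr fun y hy => ?_
    simp only [Function.comp, dif_pos (h.source_subset (e.map_target hy.2))]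

variable {A : Set W} {e e' : PartialEquiv W (E d)} {B B' : Finset (Fin d)}

theorem IsSubChart.homeo_val (h : IsSubChart A e B) (a₀ a : A) (ha : (a : W) ∈ e.source) :
    (h.homeo a₀ a).1 = expOff B (e a) :=
  toQuadrant_val (expOff_nonneg (h.mem_quad (e.map_source ha)))

theorem IsSubChart.homeo_symm_val (h : IsSubChart A e B) (a₀ : A) {y : EuclideanQuadrant d}
    (hy : y ∈ (h.homeo a₀).target) : ((h.homeo a₀).symm y : W) = e.symm (logOff B y.1) := by
  have h1 := h.source_subset (e.map_target hy.2)
  simp only [IsSubChart.homeo, OpenPartialHomeomorph.coe_mk_symm, PartialEquiv.coe_symm_mk]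
  rw [dif_pos h1]

/-- The transition map is `expOff B' ∘ e' ∘ e.symm ∘ logOff B`. Smoothness of `e'` on its source, a
relatively open subset of `A`, is enough since `e.symm` takes its values in `A`. -/
theorem IsSubChart.contDiffOn_transition (h : IsSubChart A e B) (h' : IsSubChart A e' B')
    (a₀ a₁ : A) :
    ContDiffOn ℝ ∞ (Corner d ∘ ((h.homeo a₀).symm.trans (h'.homeo a₁)) ∘ (Corner d).symm)
      ((Corner d).symm ⁻¹' ((h.homeo a₀).symm.trans (h'.homeo a₁)).source ∩ range (Corner d)) := by
  set s := (Corner d).symm ⁻¹' ((h.homeo a₀).symm.trans (h'.homeo a₁)).source ∩ range (Corner d)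
  have key : ∀ y ∈ s, ((∀ i ∉ B, 0 < y i) ∧ logOff B y ∈ e.target) ∧
      e.symm (logOff B y) ∈ e'.source ∧
      (Corner d ∘ ((h.homeo a₀).symm.trans (h'.homeo a₁)) ∘ (Corner d).symm) y
        = expOff B' (e' (e.symm (logOff B y))) := by
    rintro _ ⟨hy, q, rfl⟩
    simp only [mem_preimage, ModelWithCorners.left_inv] at hy
    have hq : q ∈ (h.homeo a₀).target := hy.1
    have hv := h.homeo_symm_val a₀ hq
    have hq' : ((h.homeo a₀).symm q : W) ∈ e'.source := hy.2
    refine ⟨hq, hv ▸ hq', ?_⟩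
    have := h'.homeo_val a₁ _ hq'
    rw [hv] at this
    simp only [Function.comp, ModelWithCorners.left_inv]
    exact this
  refine ContDiffOn.congr (f := fun y => expOff B' (e' (e.symm (logOff B y)))) ?_
    fun y hy => (key y hy).2.2
  refine (contDiff_expOff B').comp_contDiffOn ?_
  refine h'.contDiffOn.comp (t := e'.source) ?_ fun y hy => (key y hy).2.1
  refine h.contDiffOn_symm.comp (t := e.target) ?_ fun y hy => (key y hy).1.2
  exact (contDiffOn_logOff B).mono fun y hy => (key y hy).1.1

/-- Every point of `A` has a chart. -/
def IsCornerSet (d : ℕ) (A : Set W) : Prop :=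
  ∀ a ∈ A, ∃ (e : PartialEquiv W (E d)) (B : Finset (Fin d)), IsSubChart A e B ∧ a ∈ e.source

/-- The charted space structure of a subset with charts. -/
@[reducible]
def IsCornerSet.chartedSpace (hA : IsCornerSet d A) : ChartedSpace (EuclideanQuadrant d) A where
  atlas := {c | ∃ (e : PartialEquiv W (E d)) (B : Finset (Fin d)) (h : IsSubChart A e B) (a₀ : A),
    c = h.homeo a₀}
  chartAt a := (hA a a.2).choose_spec.choose_spec.1.homeo a
  mem_chart_source a := (hA _ a.2).choose_spec.choose_spec.2
  chart_mem_atlas _ := ⟨_, _, _, _, rfl⟩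

theorem IsCornerSet.isManifold (hA : IsCornerSet d A) :
    @IsManifold ℝ _ (E d) _ _ _ _ (Corner d) ∞ A _ hA.chartedSpace := by
  let := hA.chartedSpace
  refine isManifold_of_contDiffOn (Corner d) ∞ A ?_
  rintro _ _ ⟨e, B, h, a, rfl⟩ ⟨e', B', h', a', rfl⟩
  exact h.contDiffOn_transition h' a a'

/-- The regularized space with underlying manifold the subset `A` of `W`. -/
def IsCornerSet.space (hA : IsCornerSet d A) (M Sig : Set W) : RegSpace d :=
  let _ := hA.chartedSpace
  have := hA.isManifold
  { carrier := A
    M := Subtype.val ⁻¹' M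
    Sig := Subtype.val ⁻¹' Sig }

/-- The map `ι` identifies the manifold `X` with a subset of `W` as far as smooth functions are
concerned: it is a smooth topological embedding, and the charts of `X` extend locally to smooth
functions on the image of `ι`. -/
structure IsModel (X : RegSpace d) (ι : X.carrier → W) : Prop where
  emb : IsEmbedding ι
  smooth : ContMDiff (Corner d) 𝓘(ℝ, W) ∞ ι
  chart : ∀ p : X.carrier, ∃ O, IsOpen O ∧ ι p ∈ O ∧ ∃ ρ : W → E d,
    ContDiffOn ℝ ∞ ρ (range ι ∩ O) ∧ ∀ q, ι q ∈ O → extChartAt (Corner d) p q = ρ (ι q)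

theorem IsCornerSet.contMDiff_val (hA : IsCornerSet d A) :
    letI := hA.chartedSpace
    ContMDiff (Corner d) 𝓘(ℝ, W) ∞ (Subtype.val : A → W) := by
  let := hA.chartedSpace
  have := hA.isManifold
  · intro a
    rw [contMDiffAt_iff]
    refine ⟨continuous_subtype_val.continuousAt, ?_⟩
    set h := (hA a a.2).choose_spec.choose_spec.1
    set e := (hA a a.2).choose
    set B := (hA a a.2).choose_spec.choose
    have hae : (a : W) ∈ e.source := (hA a a.2).choose_spec.choose_spec.2
    have hc : extChartAt (Corner d) a = (h.homeo a).extend (Corner d) := rfl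
    have hval : extChartAt (Corner d) a a = expOff B (e a) := by
      rw [hc]; exact h.homeo_val a a hae
    simp only [extChartAt_model_space_eq_id, PartialEquiv.refl_coe, Function.id_comp]
    rw [hval]
    set s := {y : E d | (∀ i ∉ B, 0 < y i) ∧ (∀ i, 0 ≤ y i) ∧ logOff B y ∈ e.target} with hs
    have h1 : ContDiffOn ℝ ∞ (fun y => e.symm (logOff B y)) s :=
      h.contDiffOn_symm.comp ((contDiffOn_logOff B).mono fun y hy => hy.1) fun y hy => hy.2.2
    have hmem : expOff B (e a) ∈ s := ⟨expOff_pos _ _,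
      expOff_nonneg (h.mem_quad (e.map_source hae)), by
        rw [logOff_expOff]; exact e.map_source hae⟩
    have h2 : ContDiffOn ℝ ∞ (Subtype.val ∘ (extChartAt (Corner d) a).symm) s := by
      refine h1.congr fun y hy => ?_
      have : (⟨y, hy.2.1⟩ : EuclideanQuadrant d) ∈ (h.homeo a).target := ⟨hy.1, hy.2.2⟩
      have h4 := h.homeo_symm_val a this
      rw [hc]
      simp only [OpenPartialHomeomorph.extend_coe_symm, Function.comp]
      have h5 : (Corner d).symm y = ⟨y, hy.2.1⟩ := by
        have := (Corner d).left_inv (⟨y, hy.2.1⟩ : EuclideanQuadrant d)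
        exact this
      rw [h5, h4]
    refine (h2 _ hmem).mono_of_mem_nhdsWithin ?_
    have h3 : (h.homeo a).target ∈ 𝓝 (h.homeo a a) := (h.homeo a).open_target.mem_nhds
      ((h.homeo a).map_source hae)
    have h4 := (Corner d).image_mem_nhdsWithin h3
    have h5 : (Corner d) (h.homeo a a) = expOff B (e a) := h.homeo_val a a hae
    rw [h5] at h4
    refine mem_of_superset h4 ?_
    rintro _ ⟨q, hq, rfl⟩
    exact ⟨hq.1, q.2, hq.2⟩

theorem IsCornerSet.extChartAt_eq (hA : IsCornerSet d A) (a : A) :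
    letI := hA.chartedSpace
    ∃ O, IsOpen O ∧ a.1 ∈ O ∧ ∃ ρ : W → E d,
      ContDiffOn ℝ ∞ ρ (range (Subtype.val : A → W) ∩ O) ∧
      ∀ q : A, q.1 ∈ O → extChartAt (Corner d) a q = ρ q.1 := by
  let := hA.chartedSpace
  · set h := (hA a.1 a.2).choose_spec.choose_spec.1
    set e := (hA a.1 a.2).choose
    set B := (hA a.1 a.2).choose_spec.choose
    have hae : (a.1 : W) ∈ e.source := (hA a.1 a.2).choose_spec.choose_spec.2
    obtain ⟨O, hO, hs⟩ := h.source_eq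
    refine ⟨O, hO, (hs ▸ hae : a.1 ∈ A ∩ O).2, fun w => expOff B (e w), ?_, fun q hq => ?_⟩
    · rw [Subtype.range_coe, ← hs]
      exact (contDiff_expOff B).comp_contDiffOn h.contDiffOn
    · have : (q.1 : W) ∈ e.source := by rw [hs]; exact ⟨q.2, hq⟩
      exact h.homeo_val a q this

theorem IsCornerSet.isModel (hA : IsCornerSet d A) (M Sig : Set W) :
    IsModel (hA.space M Sig) (Subtype.val : A → W) :=
  ⟨IsEmbedding.subtypeVal, hA.contMDiff_val, hA.extChartAt_eq⟩

end SubChart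

/-! ### Smooth maps tested in the ambient normed space. -/

section Model

variable {d : ℕ} {W : Type} [NormedAddCommGroup W] [NormedSpace ℝ W] {X : RegSpace d}
  {ι : X.carrier → W}

theorem IsModel.contMDiffOn_comp {G : Type*} [NormedAddCommGroup G] [NormedSpace ℝ G]
    (h : IsModel X ι) {g : W → G} {s : Set X.carrier} {t : Set W} (hg : ContDiffOn ℝ ∞ g t)
    (hst : MapsTo ι s t) : ContMDiffOn (Corner d) 𝓘(ℝ, G) ∞ (fun q => g (ι q)) s :=
  hg.contMDiffOn.comp h.smooth.contMDiffOn hst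

/-- Near `f x` the chart of `X` is the restriction of a function `ρ` which is smooth on the image of
`ι`, so it suffices to compose `ι ∘ f` with `ρ`. All maps into the blown-up spaces are shown to be
smooth in this way. -/
theorem IsModel.contMDiffWithinAt_of_comp {H N G : Type*} [TopologicalSpace H] [NormedAddCommGroup G]
    [NormedSpace ℝ G] {I : ModelWithCorners ℝ G H} [TopologicalSpace N] [ChartedSpace H N]
    (h : IsModel X ι) {f : N → X.carrier} {s : Set N} {x : N}
    (hf : ContMDiffWithinAt I 𝓘(ℝ, W) ∞ (fun q => ι (f q)) s x) :
    ContMDiffWithinAt I (Corner d) ∞ f s x := by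
  have hc : ContinuousWithinAt f s x := h.emb.isInducing.continuousWithinAt_iff.2 hf.continuousWithinAt
  rw [contMDiffWithinAt_iff_target]
  refine ⟨hc, ?_⟩
  obtain ⟨O, hO, hp, ρ, hρ, hq⟩ := h.chart (f x)
  have h1 : ∀ᶠ z in 𝓝[s] x, ι (f z) ∈ O := hf.continuousWithinAt.eventually (hO.mem_nhds hp)
  have h2 : ContMDiffWithinAt I 𝓘(ℝ, E d) ∞ (fun z => ρ (ι (f z))) s x := by
    have h3 := (hρ.contMDiffOn (ι (f x)) ⟨mem_range_self _, hp⟩)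
    refine (ContMDiffWithinAt.comp' x h3 hf).mono_of_mem_nhdsWithin ?_
    filter_upwards [h1, self_mem_nhdsWithin] with z hz hz' using ⟨hz', mem_range_self _, hz⟩
  refine h2.congr_of_eventuallyEq ?_ (hq _ hp)
  filter_upwards [h1] with z hz using hq _ hz

theorem IsModel.contMDiffOn_of_comp {H N G : Type*} [TopologicalSpace H] [NormedAddCommGroup G]
    [NormedSpace ℝ G] {I : ModelWithCorners ℝ G H} [TopologicalSpace N] [ChartedSpace H N]
    (h : IsModel X ι) {f : N → X.carrier} {s : Set N}
    (hf : ContMDiffOn I 𝓘(ℝ, W) ∞ (fun q => ι (f q)) s) :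
    ContMDiffOn I (Corner d) ∞ f s := fun x hx => h.contMDiffWithinAt_of_comp (hf x hx)

end Model

end

/-! ### Equations of the branches, the ambient space, and blowing up its subsets. -/

section

/-- Equations for the branches of a normal crossings variety: the branch of index `j` is the zero
set of the vector valued function `F j`, which takes its values in the lines `L j`. -/
structure BranchData {n : ℕ} (M Sig : Set (E n)) (c : ℕ) (V : Type) [NormedAddCommGroup V]
    [InnerProductSpace ℝ V] where
  F : Fin c → E n → V
  L : Fin c → E n → Submodule ℝ V
  smooth : ∀ j, ContDiffOn ℝ ∞ (F j) M
  mem_Sig : ∀ x, x ∈ Sig ↔ x ∈ M ∧ ∃ j, F j x = 0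
  mem_L : ∀ j, ∀ x ∈ M, F j x ∈ L j x
  chart : ∀ p ∈ M, ∃ e, IsChartAt M p e ∧ ∃ ι : Fin c → Fin n, InjOn ι {j | F j p = 0} ∧
    (∀ j, F j p ≠ 0 → ∀ x ∈ e.source, F j x ≠ 0) ∧
    ∀ j, F j p = 0 → ∃ U : E n → V, ContDiffOn ℝ ∞ U e.source ∧ ∀ x ∈ e.source,
      U x ≠ 0 ∧ F j x = e x (ι j) • U x ∧ L j x = Submodule.span ℝ {U x}

/-- The ambient space of the blown-up spaces: the coordinates are the point of `ℝⁿ`, an equation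
of the initial manifold, equations of the branches, and the radii of the blowings-up. -/
abbrev Amb (n c : ℕ) (V : Type) : Type := E n × ℝ × (Fin c → V) × (Finset (Fin c) → ℝ)

variable {n c : ℕ} {V : Type}

namespace Amb

/-- The coordinates of a point of the ambient space. -/
def x (w : Amb n c V) : E n := w.1
/-- A coordinate of the ambient space. -/ def b (w : Amb n c V) : ℝ := w.2.1
/-- A coordinate of the ambient space. -/ def F (w : Amb n c V) : Fin c → V := w.2.2.1
/-- A coordinate of the ambient space. -/ def r (w : Amb n c V) : Finset (Fin c) → ℝ := w.2.2.2

variable (x₀ : E n) (b₀ : ℝ) (F₀ : Fin c → V) (r₀ : Finset (Fin c) → ℝ)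

@[simp] theorem x_mk : Amb.x ((x₀, b₀, F₀, r₀) : Amb n c V) = x₀ := rfl
@[simp] theorem b_mk : Amb.b ((x₀, b₀, F₀, r₀) : Amb n c V) = b₀ := rfl
@[simp] theorem F_mk : Amb.F ((x₀, b₀, F₀, r₀) : Amb n c V) = F₀ := rfl
@[simp] theorem r_mk : Amb.r ((x₀, b₀, F₀, r₀) : Amb n c V) = r₀ := rfl

theorem ext {w w' : Amb n c V} (h1 : w.x = w'.x) (h2 : w.b = w'.b) (h3 : w.F = w'.F)
    (h4 : w.r = w'.r) : w = w' :=
  Prod.ext h1 (Prod.ext h2 (Prod.ext h3 h4))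

/-- The point of `ℝⁿ × ℝ` over which `w` lies. -/
def proj (w : Amb n c V) : E n × ℝ := (w.x, w.b * ∏ J, w.r J)

end Amb

variable [NormedAddCommGroup V] [InnerProductSpace ℝ V] {M Sig : Set (E n)}

section Smooth

variable {k : WithTop ℕ∞}

theorem contDiff_amb_x : ContDiff ℝ k (Amb.x : Amb n c V → E n) := contDiff_fst
theorem contDiff_amb_b : ContDiff ℝ k (Amb.b : Amb n c V → ℝ) := contDiff_fst.comp contDiff_snd
theorem contDiff_amb_F (j : Fin c) : ContDiff ℝ k (fun w : Amb n c V => w.F j) :=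
  contDiff_pi.1 (contDiff_fst.comp (contDiff_snd.comp contDiff_snd)) j
theorem contDiff_amb_r (J : Finset (Fin c)) : ContDiff ℝ k (fun w : Amb n c V => w.r J) :=
  contDiff_pi.1 (contDiff_snd.comp (contDiff_snd.comp contDiff_snd)) J

theorem contDiff_amb_proj : ContDiff ℝ k (Amb.proj : Amb n c V → E n × ℝ) :=
  contDiff_amb_x.prodMk (contDiff_amb_b.mul (contDiff_prod fun J _ => contDiff_amb_r J))

theorem contDiffOn_amb {G : Type*} [NormedAddCommGroup G] [NormedSpace ℝ G] {s : Set G}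
    {x : G → E n} {b : G → ℝ} {F : G → Fin c → V} {r : G → Finset (Fin c) → ℝ}
    (hx : ContDiffOn ℝ k x s) (hb : ContDiffOn ℝ k b s) (hF : ∀ j, ContDiffOn ℝ k (fun g => F g j) s)
    (hr : ∀ J, ContDiffOn ℝ k (fun g => r g J) s) :
    ContDiffOn ℝ k (fun g => ((x g, b g, F g, r g) : Amb n c V)) s :=
  hx.prodMk (hb.prodMk ((contDiffOn_pi.2 hF).prodMk (contDiffOn_pi.2 hr)))

theorem contDiffOn_update {G : Type*} [NormedAddCommGroup G] [NormedSpace ℝ G] {s : Set G}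
    {r : G → Finset (Fin c) → ℝ} {t : G → ℝ} {J : Finset (Fin c)}
    (hr : ∀ J, ContDiffOn ℝ k (fun g => r g J) s) (ht : ContDiffOn ℝ k t s) (J' : Finset (Fin c)) :
    ContDiffOn ℝ k (fun g => Function.update (r g) J (t g) J') s := by
  by_cases h : J' = J
  · subst h; simpa using ht
  · simpa [Function.update_of_ne h] using hr J'

theorem contDiffOn_ite {G H : Type*} [NormedAddCommGroup G] [NormedSpace ℝ G]
    [NormedAddCommGroup H] [NormedSpace ℝ H] {s : Set G} {p : Prop} [Decidable p] {f g : G → H}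
    (hf : p → ContDiffOn ℝ k f s) (hg : ¬ p → ContDiffOn ℝ k g s) :
    ContDiffOn ℝ k (fun x => if p then f x else g x) s := by
  by_cases h : p <;> simp [h, hf, hg]

end Smooth

/-- The data `ib`, `ι`, `v`, `U` express the functions `b` and `F j` (`j ∈ K`) as multiples of
distinct coordinates of the chart `e`. -/
structure IsAdapted (D : BranchData M Sig c V) (e : PartialEquiv (Amb n c V) (E (n + 1)))
    (B : Finset (Fin (n + 1))) (K : Set (Fin c)) (ib : Fin (n + 1)) (v : Amb n c V → ℝ)
    (ι : Fin c → Fin (n + 1)) (U : Fin c → Amb n c V → V) : Prop where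
  ib_mem : ib ∈ B
  smooth_v : ContDiffOn ℝ ∞ v e.source
  v_pos : ∀ w ∈ e.source, 0 < v w
  b_eq : ∀ w ∈ e.source, w.b = e w ib * v w
  ι_notMem : ∀ j ∈ K, ι j ∉ B
  ι_inj : InjOn ι K
  smooth_U : ∀ j ∈ K, ContDiffOn ℝ ∞ (U j) e.source
  U_ne : ∀ j ∈ K, ∀ w ∈ e.source, U j w ≠ 0
  F_eq : ∀ j ∈ K, ∀ w ∈ e.source, w.F j = e w (ι j) • U j w
  L_eq : ∀ j ∈ K, ∀ w ∈ e.source, D.L j w.x = Submodule.span ℝ {U j w}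

/-- The properties of the set `A` obtained from `M × ℝ_{≥0}` by blowing up the strict transforms of
the intersections of the branches of index in `J`, for `J ∈ T`. -/
structure IsStage (D : BranchData M Sig c V) (T : Finset (Finset (Fin c))) (A : Set (Amb n c V)) :
    Prop where
  x_mem : ∀ w ∈ A, w.x ∈ M
  b_nonneg : ∀ w ∈ A, 0 ≤ w.b
  r_nonneg : ∀ w ∈ A, ∀ J, 0 ≤ w.r J
  F_mem : ∀ w ∈ A, ∀ j, w.F j ∈ D.L j w.x
  F_eq : ∀ w ∈ A, ∀ j, D.F j w.x = (∏ J with j ∈ J, w.r J) • w.F j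
  r_eq_one : ∀ w ∈ A, ∀ J ∉ T, w.r J = 1
  separated : ∀ w ∈ A, ∀ J ∈ T, w.b = 0 → ∃ j ∈ J, w.F j ≠ 0
  prod_ne : ∀ w ∈ A, ∀ j, w.F j = 0 → ∏ J with j ∉ J, w.r J ≠ 0
  chart : ∀ w ∈ A, ∃ e B, IsSubChart A e B ∧ w ∈ e.source ∧
    (w.b = 0 → ∃ ib v ι U, IsAdapted D e B {j | w.F j = 0} ib v ι U)
  dense : ∀ w ∈ A, w ∈ closure {w' ∈ A | 0 < w'.b ∧ ∀ J, 0 < w'.r J}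
  dense_init : ∀ w ∈ A, w.b = 0 →
    w ∈ closure {w' ∈ A | w'.b = 0 ∧ (∀ J, 0 < w'.r J) ∧ ∀ j, w'.F j ≠ 0}

section Blow

/-- The blowing-up map with center `{b = 0, F j = 0 for j ∈ J}`. -/
def blowMap (J : Finset (Fin c)) (w : Amb n c V) : Amb n c V :=
  (w.x, w.r J * w.b, fun j => if j ∈ J then w.r J • w.F j else w.F j, Function.update w.r J 1)

/-- The square of the distance to the center of the blowing-up. -/
def radSq (J : Finset (Fin c)) (w : Amb n c V) : ℝ := w.b ^ 2 + ∑ j ∈ J, ‖w.F j‖ ^ 2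

/-- The inverse of the blowing-up map outside the center. -/
def blowInv (J : Finset (Fin c)) (w : Amb n c V) : Amb n c V :=
  (w.x, (√(radSq J w))⁻¹ * w.b, fun j => if j ∈ J then (√(radSq J w))⁻¹ • w.F j else w.F j,
    Function.update w.r J (√(radSq J w)))

/-- The blowing-up of the set `A`. -/
def blow (D : BranchData M Sig c V) (J : Finset (Fin c)) (A : Set (Amb n c V)) :
    Set (Amb n c V) :=
  {w | 0 ≤ w.r J ∧ 0 ≤ w.b ∧ radSq J w = 1 ∧ (∀ j, w.F j ∈ D.L j w.x) ∧ blowMap J w ∈ A}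

variable {D : BranchData M Sig c V} {J : Finset (Fin c)} {A : Set (Amb n c V)} {w : Amb n c V}

theorem radSq_nonneg (J : Finset (Fin c)) (w : Amb n c V) : 0 ≤ radSq J w :=
  add_nonneg (sq_nonneg _) (Finset.sum_nonneg fun _ _ => sq_nonneg _)

theorem radSq_eq_zero : radSq J w = 0 ↔ w.b = 0 ∧ ∀ j ∈ J, w.F j = 0 := by
  rw [radSq, add_eq_zero_iff_of_nonneg (sq_nonneg _) (Finset.sum_nonneg fun _ _ => sq_nonneg _),
    Finset.sum_eq_zero_iff_of_nonneg fun _ _ => sq_nonneg _]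
  simp

/-- The map multiplies `b` and the `F j`, `j ∈ J`, by `r J`. On the blowing-up, where `radSq J w =
1`, the coordinate `r J` is thus the distance of the image to the center. -/
theorem radSq_blowMap (J : Finset (Fin c)) (w : Amb n c V) :
    radSq J (blowMap J w) = w.r J ^ 2 * radSq J w := by
  simp only [radSq, blowMap, mul_add, Finset.mul_sum, mul_pow, Amb.b_mk, Amb.F_mk]
  congr 1
  refine Finset.sum_congr rfl fun j hj => ?_
  simp [hj, norm_smul, mul_pow]

theorem blowMap_blowInv (hw : w.r J = 1) (h : radSq J w ≠ 0) : blowMap J (blowInv J w) = w := by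
  have h0 : √(radSq J w) ≠ 0 := (Real.sqrt_pos.2 ((radSq_nonneg J w).lt_of_ne' h)).ne'
  refine Amb.ext rfl ?_ ?_ ?_
  · simp [blowMap, blowInv, h0]
  · funext j
    by_cases hj : j ∈ J <;> simp [blowMap, blowInv, hj, h0]
  · simp [blowMap, blowInv, ← hw, Function.update_eq_self]

theorem blowInv_blowMap (hw : w ∈ blow D J A) (h : w.r J ≠ 0) : blowInv J (blowMap J w) = w := by
  have h1 : √(radSq J (blowMap J w)) = w.r J := by
    rw [radSq_blowMap, hw.2.2.1, mul_one, Real.sqrt_sq hw.1]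
  rw [blowInv, h1]
  refine Amb.ext rfl ?_ ?_ ?_
  · simp [blowMap, h]
  · funext j
    by_cases hj : j ∈ J <;> simp [blowMap, hj, h]
  · simp [blowMap]

theorem radSq_blowInv (h : radSq J w ≠ 0) : radSq J (blowInv J w) = 1 := by
  have h1 : radSq J (blowInv J w) = (√(radSq J w))⁻¹ ^ 2 * radSq J w := by
    simp only [radSq, blowInv, mul_add, Finset.mul_sum, mul_pow, Amb.b_mk, Amb.F_mk]
    congr 1
    refine Finset.sum_congr rfl fun j hj => ?_
    simp [hj, norm_smul, mul_pow]
  rw [h1, inv_pow, Real.sq_sqrt (radSq_nonneg J w), inv_mul_cancel₀ h]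

/-- Division by a positive radius preserves the sign of `b` and the lines. The coordinate `r J` is 1
before `J` is blown up, so resetting it to 1 in `blowMap` recovers `w` exactly. -/
theorem blowInv_mem (hA : ∀ w ∈ A, 0 ≤ w.b ∧ (∀ j, w.F j ∈ D.L j w.x) ∧ w.r J = 1) (hw : w ∈ A)
    (h : radSq J w ≠ 0) : blowInv J w ∈ blow D J A := by
  obtain ⟨h1, h2, h3⟩ := hA w hw
  refine ⟨by simp [blowInv], mul_nonneg (by positivity) h1, radSq_blowInv h, fun j => ?_, ?_⟩
  · by_cases hj : j ∈ J
    · simpa [blowInv, hj] using Submodule.smul_mem _ _ (h2 j)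
    · simpa [blowInv, hj] using h2 j
  · rwa [blowMap_blowInv h3 h]

theorem contDiff_radSq {k : WithTop ℕ∞} (J : Finset (Fin c)) :
    ContDiff ℝ k (radSq J : Amb n c V → ℝ) :=
  (contDiff_amb_b.pow 2).add (ContDiff.sum fun j _ => (contDiff_amb_F j).norm_sq ℝ)

theorem contDiff_blowMap {k : WithTop ℕ∞} (J : Finset (Fin c)) :
    ContDiff ℝ k (blowMap J : Amb n c V → Amb n c V) := by
  rw [← contDiffOn_univ]
  refine contDiffOn_amb contDiff_amb_x.contDiffOn
    ((contDiff_amb_r J).mul contDiff_amb_b).contDiffOn (fun j => ?_) fun J' => ?_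
  · exact contDiffOn_ite (fun _ => ((contDiff_amb_r J).smul (contDiff_amb_F j)).contDiffOn)
      fun _ => (contDiff_amb_F j).contDiffOn
  · exact contDiffOn_update (fun J => (contDiff_amb_r J).contDiffOn) contDiffOn_const J'

theorem contDiffOn_blowInv {k : WithTop ℕ∞} (J : Finset (Fin c)) :
    ContDiffOn ℝ k (blowInv J : Amb n c V → Amb n c V) {w | radSq J w ≠ 0} := by
  have h1 : ContDiffOn ℝ k (fun w : Amb n c V => √(radSq J w)) {w | radSq J w ≠ 0} :=
    (contDiff_radSq J).contDiffOn.sqrt fun w hw => hw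
  have h2 : ContDiffOn ℝ k (fun w : Amb n c V => (√(radSq J w))⁻¹) {w | radSq J w ≠ 0} :=
    h1.inv fun w hw => (Real.sqrt_pos.2 ((radSq_nonneg J w).lt_of_ne' hw)).ne'
  refine contDiffOn_amb contDiff_amb_x.contDiffOn (h2.mul contDiff_amb_b.contDiffOn)
    (fun j => ?_) fun J' => ?_
  · exact contDiffOn_ite (fun _ => h2.smul (contDiff_amb_F j).contDiffOn)
      fun _ => (contDiff_amb_F j).contDiffOn
  · exact contDiffOn_update (fun J => (contDiff_amb_r J).contDiffOn) h1 J'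

theorem prod_update_mul {ι : Type*} [DecidableEq ι] (s : Finset ι) (r : ι → ℝ) (J : ι) (hJ : J ∈ s) :
    r J * ∏ J' ∈ s, Function.update r J 1 J' = ∏ J' ∈ s, r J' := by
  rw [Finset.prod_update_of_mem hJ, one_mul, Finset.sdiff_singleton_eq_erase,
    Finset.mul_prod_erase s r hJ]

theorem prod_update_of_notMem {ι : Type*} [DecidableEq ι] (s : Finset ι) (r : ι → ℝ) (J : ι) (hJ : J ∉ s)
    (t : ℝ) : ∏ J' ∈ s, Function.update r J t J' = ∏ J' ∈ s, r J' :=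
  Finset.prod_update_of_notMem hJ r t

/-- The factor `r J` gained by `b` is lost by the product of the radii. -/
theorem proj_blowMap (J : Finset (Fin c)) (w : Amb n c V) : (blowMap J w).proj = w.proj := by
  simp only [Amb.proj, blowMap, Amb.x_mk, Amb.b_mk, Amb.r_mk]
  rw [← prod_update_mul Finset.univ w.r J (Finset.mem_univ _)]
  ring_nf

/-- The part outside the exceptional divisor of the chart of the blowing-up given by `e`. -/
def blowChartOff (D : BranchData M Sig c V) (J : Finset (Fin c)) {A : Set (Amb n c V)}
    (hA : ∀ w ∈ A, 0 ≤ w.b ∧ (∀ j, w.F j ∈ D.L j w.x) ∧ w.r J = 1)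
    (e : PartialEquiv (Amb n c V) (E (n + 1))) (he : e.source ⊆ A) :
    PartialEquiv (Amb n c V) (E (n + 1)) where
  toFun w := e (blowMap J w)
  invFun y := blowInv J (e.symm y)
  source := {w ∈ blow D J A | blowMap J w ∈ e.source ∧ w.r J ≠ 0}
  target := {y ∈ e.target | radSq J (e.symm y) ≠ 0}
  map_source' w hw := by
    refine ⟨e.map_source hw.2.1, ?_⟩
    rw [e.left_inv hw.2.1, radSq_blowMap, hw.1.2.2.1, mul_one]
    exact pow_ne_zero _ hw.2.2
  map_target' y hy := by
    have h1 := he (e.map_target hy.1)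
    refine ⟨blowInv_mem hA h1 hy.2, ?_, ?_⟩
    · rw [blowMap_blowInv (hA _ h1).2.2 hy.2]
      exact e.map_target hy.1
    · simp only [blowInv, Amb.r_mk, Function.update_self]
      exact (Real.sqrt_pos.2 ((radSq_nonneg J _).lt_of_ne' hy.2)).ne'
  left_inv' w hw := by
    rw [e.left_inv hw.2.1, blowInv_blowMap hw.1 hw.2.2]
  right_inv' y hy := by
    rw [blowMap_blowInv (hA _ (he (e.map_target hy.1))).2.2 hy.2, e.right_inv hy.1]

theorem inter_preimage_relOpen {W G : Type*} [TopologicalSpace W] [TopologicalSpace G] {A s : Set W}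
    {f : W → G} {t : Set G} (hs : ∃ O, IsOpen O ∧ s = A ∩ O) (hf : ContinuousOn f s)
    (ht : IsOpen t) : ∃ O, IsOpen O ∧ s ∩ f ⁻¹' t = A ∩ O := by
  obtain ⟨O, hO, rfl⟩ := hs
  obtain ⟨u, hu, h⟩ := continuousOn_iff'.1 hf t ht
  refine ⟨O ∩ u, hO.inter hu, ?_⟩
  rw [inter_comm, h, inter_comm, inter_assoc]

theorem isSubChart_blowChartOff
    (hA : ∀ w ∈ A, 0 ≤ w.b ∧ (∀ j, w.F j ∈ D.L j w.x) ∧ w.r J = 1)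
    {e : PartialEquiv (Amb n c V) (E (n + 1))} {B : Finset (Fin (n + 1))} (he : IsSubChart A e B) :
    IsSubChart (blow D J A) (blowChartOff D J hA e he.source_subset) B := by
  refine ⟨?_, ?_, ?_, ?_⟩
  · obtain ⟨O, hO, hs⟩ := he.source_eq
    refine ⟨blowMap J ⁻¹' O ∩ {w | w.r J ≠ 0},
      (hO.preimage (contDiff_blowMap (k := 0) J).continuous).inter
        (isOpen_ne.preimage (contDiff_amb_r (k := 0) J).continuous), ?_⟩
    ext w
    simp only [blowChartOff, hs, mem_ofPred_eq, mem_inter_iff, mem_preimage]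
    constructor
    · rintro ⟨h1, ⟨h2, h3⟩, h4⟩
      exact ⟨h1, h3, h4⟩
    · rintro ⟨h1, h3, h4⟩
      exact ⟨h1, ⟨h1.2.2.2.2, h3⟩, h4⟩
  · obtain ⟨O, hO, ht⟩ := inter_preimage_relOpen (s := e.target) (A := quad B)
      (f := fun y => radSq J (e.symm y)) (t := {0}ᶜ)
      (by obtain ⟨O, hO, ht⟩ := he.target_eq; exact ⟨O, hO, by rw [ht, inter_comm]⟩)
      ((contDiff_radSq (k := 0) J).continuous.comp_continuousOn he.contDiffOn_symm.continuousOn)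
      isOpen_compl_singleton
    refine ⟨O, hO, ?_⟩
    rw [inter_comm, ← ht]
    rfl
  · exact he.contDiffOn.comp (contDiff_blowMap J).contDiffOn fun w hw => hw.2.1
  · exact (contDiffOn_blowInv J).comp (he.contDiffOn_symm.mono fun y hy => hy.1) fun y hy => hy.2

/-- Where `r J` is invertible, strict transforms and pullbacks differ by a unit: the factors `v` and
`U j`, `j ∈ J`, are divided by `r J`, while the coordinates and the lines stay the same. -/
theorem isAdapted_blowChartOff
    (hA : ∀ w ∈ A, 0 ≤ w.b ∧ (∀ j, w.F j ∈ D.L j w.x) ∧ w.r J = 1)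
    {e : PartialEquiv (Amb n c V) (E (n + 1))} {B : Finset (Fin (n + 1))} (he : IsSubChart A e B)
    {K : Set (Fin c)} {ib v ι U} (h : IsAdapted D e B K ib v ι U) :
    IsAdapted D (blowChartOff D J hA e he.source_subset) B K ib
      (fun w => (w.r J)⁻¹ * v (blowMap J w)) ι
      (fun j w => if j ∈ J then (w.r J)⁻¹ • U j (blowMap J w) else U j (blowMap J w)) := by
  have hr : ContDiffOn ℝ ∞ (fun w : Amb n c V => (w.r J)⁻¹)
      (blowChartOff D J hA e he.source_subset).source :=
    (contDiff_amb_r J).contDiffOn.inv fun w hw => hw.2.2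
  have hcomp : ∀ {G : Type} [NormedAddCommGroup G] [NormedSpace ℝ G] {f : Amb n c V → G},
      ContDiffOn ℝ ∞ f e.source → ContDiffOn ℝ ∞ (fun w => f (blowMap J w))
        (blowChartOff D J hA e he.source_subset).source :=
    fun hf => hf.comp (contDiff_blowMap J).contDiffOn fun w hw => hw.2.1
  refine ⟨h.ib_mem, hr.mul (hcomp h.smooth_v), fun w hw => ?_, fun w hw => ?_, h.ι_notMem, h.ι_inj,
    fun j hj => ?_, fun j hj w hw => ?_, fun j hj w hw => ?_, fun j hj w hw => ?_⟩
  · exact mul_pos (inv_pos.2 (hw.1.1.lt_of_ne' hw.2.2)) (h.v_pos _ hw.2.1)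
  · have h1 := h.b_eq _ hw.2.1
    have h2 : (blowMap J w).b = w.r J * w.b := rfl
    have h3 := hw.2.2
    change w.b = e (blowMap J w) ib * _
    rw [h2] at h1
    rw [mul_left_comm, ← h1, inv_mul_cancel_left₀ h3]
  · exact contDiffOn_ite (fun _ => hr.smul (hcomp (h.smooth_U j hj))) fun _ => hcomp (h.smooth_U j hj)
  · have := h.U_ne j hj _ hw.2.1
    by_cases hjJ : j ∈ J <;> simp [hjJ, this, hw.2.2]
  · have h1 := h.F_eq j hj _ hw.2.1
    have h3 := hw.2.2
    change w.F j = e (blowMap J w) (ι j) • _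
    by_cases hjJ : j ∈ J
    · have h2 : (blowMap J w).F j = w.r J • w.F j := by simp [blowMap, hjJ]
      rw [h2] at h1
      rw [if_pos hjJ, smul_comm, ← h1, inv_smul_smul₀ h3]
    · have h2 : (blowMap J w).F j = w.F j := by simp [blowMap, hjJ]
      rw [if_neg hjJ, ← h1, h2]
  · have h1 := h.L_eq j hj _ hw.2.1
    change D.L j w.x = _
    have h2 : (blowMap J w).x = w.x := rfl
    rw [← h2, h1]
    by_cases hjJ : j ∈ J
    · rw [if_pos hjJ]
      exact (Submodule.span_singleton_smul_eq (IsUnit.mk0 _ (inv_ne_zero hw.2.2)) _).symm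
    · rw [if_neg hjJ]

end Blow

end

/-! ### Polar coordinates and the charts of the standard blowing-up. -/

section

section PolarChart

variable {d : ℕ} {B S : Finset (Fin d)} {i₀ : Fin d} {s₀ : ℝ}

/-- The inverse of the chart of the polar model whose coordinates are the radius and the spherical
coordinates of index different from `i₀`, on the side of sign `s₀`. -/
def polarSection (S : Finset (Fin d)) (i₀ : Fin d) (s₀ : ℝ) (y : E d) : ℝ × E d :=
  (y i₀, WithLp.toLp 2 (Function.update y.ofLp i₀ (s₀ * √(1 - ∑ i ∈ S.erase i₀, y i ^ 2))))

theorem contDiff_polar {k : WithTop ℕ∞} (S : Finset (Fin d)) : ContDiff ℝ k (polar S) := by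
  refine contDiff_euclidean.2 fun i => ?_
  have h : ContDiff ℝ k fun u : ℝ × E d => u.2 i := (contDiff_coord i).comp contDiff_snd
  by_cases hi : i ∈ S
  · simpa [polar, hi] using contDiff_fst.mul h
  · simpa [polar, hi] using h

/-- The real square root is continuous also where its argument is negative. This global continuity
is what describes the target of `polarChart` by open sets. -/
theorem continuous_polarSection (S : Finset (Fin d)) (i₀ : Fin d) (s₀ : ℝ) :
    Continuous (polarSection S i₀ s₀) := by
  have h : ∀ i, Continuous fun y : E d => y i := fun i => (contDiff_coord (n := 0) i).continuous
  refine (h i₀).prodMk ((PiLp.continuous_toLp 2 _).comp (Continuous.update ?_ i₀ ?_))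
  · exact continuous_pi h
  · exact continuous_const.mul (Real.continuous_sqrt.comp
      (continuous_const.sub (continuous_finsetSum _ fun i _ => (h i).pow 2)))

theorem contDiffOn_polarSection (S : Finset (Fin d)) (i₀ : Fin d) (s₀ : ℝ) :
    ContDiffOn ℝ ∞ (polarSection S i₀ s₀) {y | ∑ i ∈ S.erase i₀, y i ^ 2 < 1} := by
  refine (contDiff_coord i₀).contDiffOn.prodMk (contDiffOn_euclidean.2 fun i => ?_)
  by_cases hi : i = i₀
  · subst hi
    simp only [Function.update_self]
    refine contDiffOn_const.mul (ContDiffOn.sqrt ?_ fun y hy => (sub_pos.2 hy).ne')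
    exact contDiffOn_const.sub (ContDiffOn.sum fun i _ => (contDiff_coord i).contDiffOn.pow 2)
  · simpa [Function.update_of_ne hi] using (contDiff_coord (n := ∞) i).contDiffOn

theorem sum_sq_polarSection (hi₀ : i₀ ∈ S) (hs₀ : s₀ ^ 2 = 1) {y : E d}
    (hy : ∑ i ∈ S.erase i₀, y i ^ 2 < 1) : ∑ i ∈ S, (polarSection S i₀ s₀ y).2 i ^ 2 = 1 := by
  rw [← Finset.add_sum_erase S _ hi₀]
  have h : ∑ i ∈ S.erase i₀, (polarSection S i₀ s₀ y).2 i ^ 2 = ∑ i ∈ S.erase i₀, y i ^ 2 :=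
    Finset.sum_congr rfl fun i hi => by simp [polarSection, Finset.ne_of_mem_erase hi]
  rw [h]
  simp only [polarSection, Function.update_self, mul_pow, hs₀]
  rw [Real.sq_sqrt (by linarith)]
  ring

theorem sum_erase_lt_one (hi₀ : i₀ ∈ S) {w : E d} (h2 : ∑ i ∈ S, w i ^ 2 = 1)
    (h5 : 0 < s₀ * w i₀) : ∑ i ∈ S.erase i₀, w i ^ 2 < 1 := by
  rw [← Finset.add_sum_erase S _ hi₀] at h2
  have h0 : w i₀ ≠ 0 := fun h => by simp [h] at h5
  have : 0 < w i₀ ^ 2 := by positivity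
  linarith

theorem sum_erase_update (w : E d) (t : ℝ) :
    ∑ i ∈ S.erase i₀, (Function.update w.ofLp i₀ t) i ^ 2 = ∑ i ∈ S.erase i₀, w i ^ 2 :=
  Finset.sum_congr rfl fun i hi => by simp [Finset.ne_of_mem_erase hi]

/-- The equation of the sphere determines the overwritten coordinate up to its sign, and the sign is
`s₀`. -/
theorem polarSection_update (hi₀ : i₀ ∈ S) (hs₀ : s₀ ^ 2 = 1) {u : ℝ × E d}
    (h2 : ∑ i ∈ S, u.2 i ^ 2 = 1) (h5 : 0 < s₀ * u.2 i₀) :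
    polarSection S i₀ s₀ (WithLp.toLp 2 (Function.update u.2.ofLp i₀ u.1)) = u := by
  have hsq : u.2 i₀ ^ 2 = (s₀ * u.2 i₀) ^ 2 := by rw [mul_pow, hs₀, one_mul]
  have h7 : 1 - ∑ i ∈ S.erase i₀, u.2 i ^ 2 = (s₀ * u.2 i₀) ^ 2 := by
    rw [← h2, ← Finset.add_sum_erase S _ hi₀, hsq]; ring
  refine Prod.ext (by simp [polarSection]) ?_
  simp only [polarSection, sum_erase_update, h7, Real.sqrt_sq h5.le, Function.update_idem]
  rw [← mul_assoc, ← sq, hs₀, one_mul, Function.update_eq_self]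

/-- The chart of the polar model whose coordinates are the radius and the spherical coordinates of
index different from `i₀`, on the side of sign `s₀`. -/
def polarChart {B : Finset (Fin d)} {T : Set (E d)} (hT : T ⊆ quad B) (hi₀ : i₀ ∈ S)
    (hs₀ : s₀ ^ 2 = 1) (hB : i₀ ∈ B → s₀ = 1) : PartialEquiv (ℝ × E d) (E d) where
  toFun u := WithLp.toLp 2 (Function.update u.2.ofLp i₀ u.1)
  invFun := polarSection S i₀ s₀
  source := {u ∈ polarModel B S T | 0 < s₀ * u.2 i₀}
  target := {y | y ∈ quad (insert i₀ B) ∧ ∑ i ∈ S.erase i₀, y i ^ 2 < 1 ∧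
    polar S (polarSection S i₀ s₀ y) ∈ T}
  map_source' u hu := by
    obtain ⟨⟨h1, h2, h3, h4⟩, h5⟩ := hu
    refine ⟨fun i hi => ?_, ?_, ?_⟩
    · by_cases hii : i = i₀
      · subst hii; simpa using h1
      · have hiB : i ∈ B := (Finset.mem_insert.1 hi).resolve_left hii
        simp only [Function.update_of_ne hii]
        by_cases hiS : i ∈ S
        · exact h3 i (Finset.mem_inter.2 ⟨hiB, hiS⟩)
        · have := hT h4 i hiB
          simpa [polar, hiS] using this
    · simpa only [sum_erase_update] using sum_erase_lt_one hi₀ h2 h5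
    · rwa [polarSection_update hi₀ hs₀ h2 h5]
  map_target' y hy := by
    obtain ⟨h1, h2, h3⟩ := hy
    have hpos : 0 < √(1 - ∑ i ∈ S.erase i₀, y i ^ 2) := Real.sqrt_pos.2 (by linarith)
    refine ⟨⟨h1 i₀ (Finset.mem_insert_self _ _), sum_sq_polarSection hi₀ hs₀ h2, fun i hi => ?_, h3⟩,
      ?_⟩
    · have hiB := (Finset.mem_inter.1 hi).1
      by_cases hii : i = i₀
      · subst hii
        simp [polarSection, hB hiB]
      · simpa [polarSection, hii] using h1 i (Finset.mem_insert_of_mem hiB)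
    · simp only [polarSection, Function.update_self]
      rwa [← mul_assoc, ← sq, hs₀, one_mul]
  left_inv' u hu := polarSection_update hi₀ hs₀ hu.1.2.1 hu.2
  right_inv' y hy := by
    ext i
    by_cases hi : i = i₀
    · subst hi; simp [polarSection]
    · simp [polarSection, hi]

theorem contDiff_polarChart {B : Finset (Fin d)} {T : Set (E d)} (hT : T ⊆ quad B) (hi₀ : i₀ ∈ S)
    (hs₀ : s₀ ^ 2 = 1) (hB : i₀ ∈ B → s₀ = 1) : ContDiff ℝ ∞ (polarChart hT hi₀ hs₀ hB) := by
  refine contDiff_euclidean.2 fun i => ?_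
  have h : ContDiff ℝ ∞ fun u : ℝ × E d => u.2 i := (contDiff_coord i).comp contDiff_snd
  by_cases hi : i = i₀
  · subst hi
    simpa [polarChart] using contDiff_fst
  · simpa [polarChart, hi] using h

theorem mem_polarChart_target {B : Finset (Fin d)} {T : Set (E d)} (hT : T ⊆ quad B) (hi₀ : i₀ ∈ S)
    (hs₀ : s₀ ^ 2 = 1) (hB : i₀ ∈ B → s₀ = 1) (y : E d) :
    y ∈ (polarChart hT hi₀ hs₀ hB).target ↔ y ∈ quad (insert i₀ B) ∧
      ∑ i ∈ S.erase i₀, y i ^ 2 < 1 ∧ polar S (polarSection S i₀ s₀ y) ∈ T := Iff.rfl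

/-- On `quad (insert i₀ B)` the sign conditions of `quad B` hold automatically for the image point,
whose coordinates are nonnegative or products of nonnegative numbers. So only the open conditions
remain. -/
theorem polarChart_target_eq {B : Finset (Fin d)} {T : Set (E d)} (hT : T ⊆ quad B) (hi₀ : i₀ ∈ S)
    (hs₀ : s₀ ^ 2 = 1) (hB : i₀ ∈ B → s₀ = 1) (hT' : ∃ O, IsOpen O ∧ T = O ∩ quad B) :
    ∃ O, IsOpen O ∧ (polarChart hT hi₀ hs₀ hB).target = O ∩ quad (insert i₀ B) := by
  obtain ⟨O, hO, hTO⟩ := hT'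
  have h : ∀ i, Continuous fun y : E d => y i := fun i => (contDiff_coord (n := 0) i).continuous
  have h1 : Continuous fun y : E d => ∑ i ∈ S.erase i₀, y i ^ 2 :=
    continuous_finsetSum _ fun i _ => (h i).pow 2
  have h2 : Continuous fun y : E d => polar S (polarSection S i₀ s₀ y) :=
    (contDiff_polar (k := 0) S).continuous.comp (continuous_polarSection S i₀ s₀)
  refine ⟨{y | ∑ i ∈ S.erase i₀, y i ^ 2 < 1} ∩ (fun y => polar S (polarSection S i₀ s₀ y)) ⁻¹' O,
    (isOpen_lt h1 continuous_const).inter (hO.preimage h2), ?_⟩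
  clear h1 h2 h
  ext y
  rw [mem_polarChart_target, hTO]
  simp only [mem_inter_iff, mem_preimage, mem_ofPred_eq]
  constructor
  · rintro ⟨h1, h2, h3, -⟩
    exact ⟨⟨h2, h3⟩, h1⟩
  · rintro ⟨⟨h2, h3⟩, h1⟩
    refine ⟨h1, h2, h3, fun i hi => ?_⟩
    have hr : 0 ≤ (polarSection S i₀ s₀ y).1 := h1 i₀ (Finset.mem_insert_self _ _)
    have h4 : 0 ≤ (polarSection S i₀ s₀ y).2 i := by
      by_cases hii : i = i₀
      · subst hii
        simp [polarSection, hB hi]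
      · simpa [polarSection, hii] using h1 i (Finset.mem_insert_of_mem hi)
    by_cases hiS : i ∈ S
    · simpa [polar, hiS] using mul_nonneg hr h4
    · simpa [polar, hiS] using h4

end PolarChart

/-! ### Comparison of the ambient blowing-up with polar coordinates in an adapted chart. -/

section Center

variable {n c : ℕ} {V : Type} [NormedAddCommGroup V] [InnerProductSpace ℝ V] {M Sig : Set (E n)}
  {D : BranchData M Sig c V} {J : Finset (Fin c)} {A : Set (Amb n c V)}
  {e : PartialEquiv (Amb n c V) (E (n + 1))} {B : Finset (Fin (n + 1))} {K : Set (Fin c)}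
  {ib : Fin (n + 1)} {v : Amb n c V → ℝ} {ι : Fin c → Fin (n + 1)} {U : Fin c → Amb n c V → V}

/-- The coordinate indices of the equations of the center. -/
def centerIdx (J : Finset (Fin c)) (ib : Fin (n + 1)) (ι : Fin c → Fin (n + 1)) :
    Finset (Fin (n + 1)) := insert ib (J.image ι)

theorem IsAdapted.ib_ne (h : IsAdapted D e B K ib v ι U) {j : Fin c} (hj : j ∈ K) : ι j ≠ ib :=
  fun h' => h.ι_notMem j hj (h' ▸ h.ib_mem)

theorem IsAdapted.ib_notMem_image (h : IsAdapted D e B K ib v ι U) (hJ : ∀ j ∈ J, j ∈ K) :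
    ib ∉ J.image ι := by
  simp only [Finset.mem_image, not_exists, not_and]
  exact fun j hj => h.ib_ne (hJ j hj)

theorem IsAdapted.sum_centerIdx (h : IsAdapted D e B K ib v ι U) (hJ : ∀ j ∈ J, j ∈ K)
    (f : Fin (n + 1) → ℝ) : ∑ i ∈ centerIdx J ib ι, f i = f ib + ∑ j ∈ J, f (ι j) := by
  rw [centerIdx, Finset.sum_insert (h.ib_notMem_image hJ),
    Finset.sum_image fun x hx y hy => h.ι_inj (hJ x hx) (hJ y hy)]

theorem IsAdapted.card_centerIdx (h : IsAdapted D e B K ib v ι U) (hJ : ∀ j ∈ J, j ∈ K) :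
    (centerIdx J ib ι).card = J.card + 1 := by
  rw [centerIdx, Finset.card_insert_of_notMem (h.ib_notMem_image hJ),
    Finset.card_image_of_injOn fun x hx y hy => h.ι_inj (hJ x hx) (hJ y hy)]

theorem IsAdapted.inter_centerIdx (h : IsAdapted D e B K ib v ι U) (hJ : ∀ j ∈ J, j ∈ K) :
    ∀ i ∈ B ∩ centerIdx J ib ι, i = ib := by
  intro i hi
  obtain ⟨h1, h2⟩ := Finset.mem_inter.1 hi
  rcases Finset.mem_insert.1 h2 with h3 | h3
  · exact h3
  · obtain ⟨j, hj, rfl⟩ := Finset.mem_image.1 h3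
    exact (h.ι_notMem j (hJ j hj) h1).elim

/-- The direction of the blown-up point `w`, in the coordinates `e`. -/
def dirVec (J : Finset (Fin c)) (ib : Fin (n + 1)) (v : Amb n c V → ℝ) (ι : Fin c → Fin (n + 1))
    (U : Fin c → Amb n c V → V) (w : Amb n c V) (i : Fin (n + 1)) : ℝ :=
  (if i = ib then w.b / v (blowMap J w) else 0) +
    ∑ j ∈ J, if i = ι j then
      inner ℝ (U j (blowMap J w)) (w.F j) / ‖U j (blowMap J w)‖ ^ 2 else 0

theorem IsAdapted.dirVec_ib (h : IsAdapted D e B K ib v ι U) (hJ : ∀ j ∈ J, j ∈ K)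
    (w : Amb n c V) : dirVec J ib v ι U w ib = w.b / v (blowMap J w) := by
  rw [dirVec, if_pos rfl, Finset.sum_eq_zero, add_zero]
  exact fun j hj => if_neg (h.ib_ne (hJ j hj)).symm

theorem IsAdapted.dirVec_ι (h : IsAdapted D e B K ib v ι U) (hJ : ∀ j ∈ J, j ∈ K)
    (w : Amb n c V) {j : Fin c} (hj : j ∈ J) : dirVec J ib v ι U w (ι j) =
      inner ℝ (U j (blowMap J w)) (w.F j) / ‖U j (blowMap J w)‖ ^ 2 := by
  rw [dirVec, if_neg (h.ib_ne (hJ j hj)), zero_add, Finset.sum_eq_single j, if_pos rfl]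
  · exact fun i hi hij => if_neg fun h' => hij (h.ι_inj (hJ j hj) (hJ i hi) h').symm
  · exact fun h' => (h' hj).elim

/-- The norm of the direction of a blown-up point. -/
def dirNorm (J : Finset (Fin c)) (ib : Fin (n + 1)) (v : Amb n c V → ℝ) (ι : Fin c → Fin (n + 1))
    (U : Fin c → Amb n c V → V) (w : Amb n c V) : ℝ :=
  √(∑ i ∈ centerIdx J ib ι, dirVec J ib v ι U w i ^ 2)

/-- The polar coordinates of the blown-up point `w`. -/
def toPolar (J : Finset (Fin c)) (e : Amb n c V → E (n + 1)) (ib : Fin (n + 1))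
    (v : Amb n c V → ℝ) (ι : Fin c → Fin (n + 1)) (U : Fin c → Amb n c V → V) (w : Amb n c V) :
    ℝ × E (n + 1) :=
  (w.r J * dirNorm J ib v ι U w, WithLp.toLp 2 fun i =>
    if i ∈ centerIdx J ib ι then dirVec J ib v ι U w i / dirNorm J ib v ι U w
    else e (blowMap J w) i)

/-- The inverse of the norm of the vector of direction `o` in the ambient space. -/
def dirScale (J : Finset (Fin c)) (ib : Fin (n + 1)) (v : Amb n c V → ℝ) (ι : Fin c → Fin (n + 1))
    (U : Fin c → Amb n c V → V) (o : E (n + 1)) (w : Amb n c V) : ℝ :=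
  (√((o ib * v w) ^ 2 + ∑ j ∈ J, (o (ι j)) ^ 2 * ‖U j w‖ ^ 2))⁻¹

/-- The blown-up point with given polar coordinates. -/
def ofPolar (J : Finset (Fin c)) (g : E (n + 1) → Amb n c V) (ib : Fin (n + 1))
    (v : Amb n c V → ℝ) (ι : Fin c → Fin (n + 1)) (U : Fin c → Amb n c V → V)
    (u : ℝ × E (n + 1)) : Amb n c V :=
  let w := g (polar (centerIdx J ib ι) u)
  let l := dirScale J ib v ι U u.2 w
  (w.x, l * (u.2 ib * v w), fun j => if j ∈ J then (l * u.2 (ι j)) • U j w else w.F j,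
    Function.update w.r J (u.1 / l))

/-- The vector `w.F j` lies on the line spanned by `U j`, also at `r J = 0` because this is required
in `blow`. Hence the orthogonal projection to this line, which `dirVec` computes, loses nothing. -/
theorem IsAdapted.F_eq_dirVec (h : IsAdapted D e B K ib v ι U) (hJ : ∀ j ∈ J, j ∈ K)
    {w : Amb n c V} (hw : w ∈ blow D J A) (hs : blowMap J w ∈ e.source) {j : Fin c} (hj : j ∈ J) :
    w.F j = dirVec J ib v ι U w (ι j) • U j (blowMap J w) := by
  have h1 := hw.2.2.2.1 j
  have h2 : D.L j w.x = Submodule.span ℝ {U j (blowMap J w)} := h.L_eq j (hJ j hj) _ hs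
  rw [h2] at h1
  obtain ⟨t, ht⟩ := Submodule.mem_span_singleton.1 h1
  have h3 : ‖U j (blowMap J w)‖ ^ 2 ≠ 0 := pow_ne_zero _ (norm_ne_zero_iff.2 (h.U_ne j (hJ j hj) _ hs))
  rw [h.dirVec_ι hJ w hj, ← ht, inner_smul_right, real_inner_self_eq_norm_sq, mul_div_assoc,
    div_self h3, mul_one]

theorem IsAdapted.b_eq_dirVec (h : IsAdapted D e B K ib v ι U) (hJ : ∀ j ∈ J, j ∈ K)
    {w : Amb n c V} (hs : blowMap J w ∈ e.source) :
    w.b = dirVec J ib v ι U w ib * v (blowMap J w) := by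
  rw [h.dirVec_ib hJ, div_mul_cancel₀ _ (h.v_pos _ hs).ne']

theorem IsAdapted.radSq_eq (h : IsAdapted D e B K ib v ι U) (hJ : ∀ j ∈ J, j ∈ K)
    {w : Amb n c V} (hw : w ∈ blow D J A) (hs : blowMap J w ∈ e.source) :
    (dirVec J ib v ι U w ib * v (blowMap J w)) ^ 2 +
      ∑ j ∈ J, dirVec J ib v ι U w (ι j) ^ 2 * ‖U j (blowMap J w)‖ ^ 2 = 1 := by
  rw [← hw.2.2.1, radSq, ← h.b_eq_dirVec hJ hs]
  congr 1
  refine Finset.sum_congr rfl fun j hj => ?_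
  conv_rhs => rw [h.F_eq_dirVec hJ hw hs hj]
  rw [norm_smul, mul_pow, Real.norm_eq_abs, sq_abs]

/-- A direction with zero coordinates would have `b = 0` and `F j = 0` for `j ∈ J`, contrary to
`radSq J w = 1`. -/
theorem IsAdapted.dirNorm_pos (h : IsAdapted D e B K ib v ι U) (hJ : ∀ j ∈ J, j ∈ K)
    {w : Amb n c V} (hw : w ∈ blow D J A) (hs : blowMap J w ∈ e.source) :
    0 < dirNorm J ib v ι U w := by
  refine Real.sqrt_pos.2 ((Finset.sum_nonneg fun _ _ => sq_nonneg _).lt_of_ne' fun h0 => ?_)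
  have h1 := h.radSq_eq hJ hw hs
  rw [h.sum_centerIdx hJ (fun i => dirVec J ib v ι U w i ^ 2),
    add_eq_zero_iff_of_nonneg (sq_nonneg _) (Finset.sum_nonneg fun _ _ => sq_nonneg _),
    Finset.sum_eq_zero_iff_of_nonneg fun _ _ => sq_nonneg _] at h0
  rw [Finset.sum_eq_zero fun j hj => by rw [h0.2 j hj, zero_mul]] at h1
  simp [pow_eq_zero_iff] at h0
  simp [h0.1] at h1

theorem dirNorm_sq (w : Amb n c V) : dirNorm J ib v ι U w ^ 2 =
    ∑ i ∈ centerIdx J ib ι, dirVec J ib v ι U w i ^ 2 :=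
  Real.sq_sqrt (Finset.sum_nonneg fun _ _ => sq_nonneg _)

theorem IsAdapted.polar_toPolar (h : IsAdapted D e B K ib v ι U) (hJ : ∀ j ∈ J, j ∈ K)
    {w : Amb n c V} (hw : w ∈ blow D J A) (hs : blowMap J w ∈ e.source) :
    polar (centerIdx J ib ι) (toPolar J e ib v ι U w) = e (blowMap J w) := by
  have hN := (h.dirNorm_pos hJ hw hs).ne'
  ext i
  by_cases hi : i ∈ centerIdx J ib ι
  · have h1 : (polar (centerIdx J ib ι) (toPolar J e ib v ι U w)) i = w.r J * dirVec J ib v ι U w i := by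
      simp only [polar, toPolar, hi, if_true]
      field_simp
    rw [h1]
    rcases Finset.mem_insert.1 hi with rfl | hi
    · have h2 := h.b_eq _ hs
      have h3 : (blowMap J w).b = w.r J * w.b := rfl
      rw [h3, h.b_eq_dirVec hJ hs, ← mul_assoc] at h2
      exact mul_right_cancel₀ (h.v_pos _ hs).ne' h2
    · obtain ⟨j, hj, rfl⟩ := Finset.mem_image.1 hi
      have h2 := h.F_eq j (hJ j hj) _ hs
      have h3 : (blowMap J w).F j = w.r J • w.F j := by simp [blowMap, hj]
      rw [h3, h.F_eq_dirVec hJ hw hs hj, smul_smul] at h2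
      exact smul_left_injective ℝ (h.U_ne j (hJ j hj) _ hs) h2
  · simp [polar, toPolar, hi]

/-- The sphere `radSq = 1` of the ambient space and the unit sphere of the coordinates meet the same
rays. The vector `dirVec` has ambient norm 1 by `radSq_eq`, so after division by `dirNorm` the
inverse of its ambient norm is `dirNorm`. -/
theorem IsAdapted.dirScale_toPolar (h : IsAdapted D e B K ib v ι U) (hJ : ∀ j ∈ J, j ∈ K)
    {w : Amb n c V} (hw : w ∈ blow D J A) (hs : blowMap J w ∈ e.source) :
    dirScale J ib v ι U (toPolar J e ib v ι U w).2 (blowMap J w) = dirNorm J ib v ι U w := by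
  have hN := h.dirNorm_pos hJ hw hs
  have hib : (toPolar J e ib v ι U w).2 ib = dirVec J ib v ι U w ib / dirNorm J ib v ι U w := by
    simp [toPolar, centerIdx]
  have hι : ∀ j ∈ J, (toPolar J e ib v ι U w).2 (ι j) =
      dirVec J ib v ι U w (ι j) / dirNorm J ib v ι U w := by
    intro j hj
    have : ι j ∈ centerIdx J ib ι := Finset.mem_insert_of_mem (Finset.mem_image_of_mem _ hj)
    simp [toPolar, this]
  have key : ((toPolar J e ib v ι U w).2 ib * v (blowMap J w)) ^ 2 +
      ∑ j ∈ J, ((toPolar J e ib v ι U w).2 (ι j)) ^ 2 * ‖U j (blowMap J w)‖ ^ 2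
      = ((dirNorm J ib v ι U w)⁻¹) ^ 2 := by
    have h1 := h.radSq_eq hJ hw hs
    rw [hib, Finset.sum_congr rfl fun j hj => by rw [hι j hj]]
    calc _ = ((dirNorm J ib v ι U w)⁻¹) ^ 2 * ((dirVec J ib v ι U w ib * v (blowMap J w)) ^ 2 +
        ∑ j ∈ J, dirVec J ib v ι U w (ι j) ^ 2 * ‖U j (blowMap J w)‖ ^ 2) := by
          rw [mul_add, Finset.mul_sum]
          congr 1
          · ring
          · exact Finset.sum_congr rfl fun j _ => by ring
      _ = _ := by rw [h1, mul_one]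
  rw [dirScale, key, Real.sqrt_sq (inv_nonneg.2 hN.le), inv_inv]

theorem IsAdapted.ofPolar_toPolar (h : IsAdapted D e B K ib v ι U) (hJ : ∀ j ∈ J, j ∈ K)
    {w : Amb n c V} (hw : w ∈ blow D J A) (hs : blowMap J w ∈ e.source) :
    ofPolar J e.symm ib v ι U (toPolar J e ib v ι U w) = w := by
  have hN := (h.dirNorm_pos hJ hw hs).ne'
  simp only [ofPolar, h.polar_toPolar hJ hw hs, e.left_inv hs, h.dirScale_toPolar hJ hw hs]
  refine Amb.ext rfl ?_ ?_ ?_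
  · have : (toPolar J e ib v ι U w).2 ib = dirVec J ib v ι U w ib / dirNorm J ib v ι U w := by
      simp [toPolar, centerIdx]
    rw [Amb.b_mk, this, h.b_eq_dirVec hJ hs]
    field_simp
  · funext j
    by_cases hj : j ∈ J
    · have hi : ι j ∈ centerIdx J ib ι := Finset.mem_insert_of_mem (Finset.mem_image_of_mem _ hj)
      have : (toPolar J e ib v ι U w).2 (ι j) = dirVec J ib v ι U w (ι j) / dirNorm J ib v ι U w := by
        simp [toPolar, hi]
      rw [Amb.F_mk, if_pos hj, this, mul_div_cancel₀ _ hN, ← h.F_eq_dirVec hJ hw hs hj]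
    · simp [hj, blowMap]
  · simp [toPolar, blowMap, hN]

theorem IsAdapted.toPolar_mem (h : IsAdapted D e B K ib v ι U) (hJ : ∀ j ∈ J, j ∈ K)
    {w : Amb n c V} (hw : w ∈ blow D J A) (hs : blowMap J w ∈ e.source) :
    toPolar J e ib v ι U w ∈ polarModel B (centerIdx J ib ι) e.target := by
  have hN := h.dirNorm_pos hJ hw hs
  refine ⟨mul_nonneg hw.1 hN.le, ?_, fun i hi => ?_, ?_⟩
  · have : ∀ i ∈ centerIdx J ib ι, (toPolar J e ib v ι U w).2 i ^ 2 =
        ((dirNorm J ib v ι U w) ^ 2)⁻¹ * dirVec J ib v ι U w i ^ 2 := by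
      intro i hi
      simp [toPolar, hi, div_pow]
      ring
    rw [Finset.sum_congr rfl this, ← Finset.mul_sum, ← dirNorm_sq,
      inv_mul_cancel₀ (pow_ne_zero _ hN.ne')]
  · obtain rfl := h.inter_centerIdx hJ i hi
    simp only [toPolar, (Finset.mem_inter.1 hi).2, if_true]
    rw [h.dirVec_ib hJ]
    exact div_nonneg (div_nonneg hw.2.1 (h.v_pos _ hs).le) hN.le
  · rw [h.polar_toPolar hJ hw hs]
    exact e.map_source hs

end Center

end

/-! ### Charts of the blowing-up along the exceptional divisor. -/

section

section Center

variable {n c : ℕ} {V : Type} [NormedAddCommGroup V] [InnerProductSpace ℝ V] {M Sig : Set (E n)}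
  {D : BranchData M Sig c V} {J : Finset (Fin c)} {A : Set (Amb n c V)}
  {e : PartialEquiv (Amb n c V) (E (n + 1))} {B : Finset (Fin (n + 1))} {K : Set (Fin c)}
  {ib : Fin (n + 1)} {v : Amb n c V → ℝ} {ι : Fin c → Fin (n + 1)} {U : Fin c → Amb n c V → V}

theorem IsAdapted.dirScale_pos (h : IsAdapted D e B K ib v ι U) (hJ : ∀ j ∈ J, j ∈ K)
    {o : E (n + 1)} (ho : ∑ i ∈ centerIdx J ib ι, o i ^ 2 = 1) {w : Amb n c V}
    (hw : w ∈ e.source) : 0 < (o ib * v w) ^ 2 + ∑ j ∈ J, (o (ι j)) ^ 2 * ‖U j w‖ ^ 2 := by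
  have h0 : 0 ≤ ∑ j ∈ J, (o (ι j)) ^ 2 * ‖U j w‖ ^ 2 := Finset.sum_nonneg fun _ _ => by positivity
  refine (add_nonneg (sq_nonneg _) h0).lt_of_ne' fun h1 => ?_
  rw [add_eq_zero_iff_of_nonneg (sq_nonneg _) h0,
    Finset.sum_eq_zero_iff_of_nonneg fun _ _ => by positivity] at h1
  rw [h.sum_centerIdx hJ fun i => o i ^ 2, Finset.sum_eq_zero, add_zero] at ho
  · have := (h.v_pos w hw).ne'
    simp_all
  · intro j hj
    have h2 := h1.2 j hj
    have := pow_ne_zero 2 (norm_ne_zero_iff.2 (h.U_ne j (hJ j hj) w hw))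
    exact (mul_eq_zero.1 h2).resolve_right this

/-- The properties of a stage which are used for the construction of the charts of a blowing-up. -/
def IsPreStage (D : BranchData M Sig c V) (J : Finset (Fin c)) (A : Set (Amb n c V)) : Prop :=
  ∀ w ∈ A, 0 ≤ w.b ∧ (∀ j, w.F j ∈ D.L j w.x) ∧ w.r J = 1

section OfPolar

variable (hA : IsPreStage D J A) (he : e.source ⊆ A) (h : IsAdapted D e B K ib v ι U)
  (hJ : ∀ j ∈ J, j ∈ K) {u : ℝ × E (n + 1)}
  (hu : u ∈ polarModel B (centerIdx J ib ι) e.target)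
include h hJ hu

theorem IsAdapted.polarScale_pos :
    0 < dirScale J ib v ι U u.2 (e.symm (polar (centerIdx J ib ι) u)) :=
  inv_pos.2 (Real.sqrt_pos.2 (h.dirScale_pos hJ hu.2.1 (e.map_target hu.2.2.2)))

include hA he

/-- The factor `l` of the direction cancels against the radius `u.1 / l`, and the base point already
has `r J = 1`. -/
theorem IsAdapted.blowMap_ofPolar : blowMap J (ofPolar J e.symm ib v ι U u) =
    e.symm (polar (centerIdx J ib ι) u) := by
  have hl := (h.polarScale_pos hJ hu).ne'
  have hs := e.map_target hu.2.2.2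
  have hr := e.right_inv hu.2.2.2
  have hb := h.b_eq _ hs
  have hF := fun j hj => h.F_eq j (hJ j hj) _ hs
  rw [hr] at hb hF
  set w := e.symm (polar (centerIdx J ib ι) u) with hw
  set l := dirScale J ib v ι U u.2 w with hldef
  have hibmem : ib ∈ centerIdx J ib ι := Finset.mem_insert_self _ _
  have h1 : (polar (centerIdx J ib ι) u) ib = u.1 * u.2 ib := by simp [polar, hibmem]
  have h2 : ∀ j ∈ J, (polar (centerIdx J ib ι) u) (ι j) = u.1 * u.2 (ι j) := by
    intro j hj
    have : ι j ∈ centerIdx J ib ι := Finset.mem_insert_of_mem (Finset.mem_image_of_mem _ hj)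
    simp [polar, this]
  refine Amb.ext rfl ?_ ?_ ?_
  · rw [hb, h1]
    simp only [blowMap, ofPolar, Amb.b_mk, Amb.r_mk, Function.update_self, ← hw, ← hldef]
    field_simp
  · funext j
    by_cases hj : j ∈ J
    · rw [hF j hj, h2 j hj]
      simp only [blowMap, ofPolar, Amb.F_mk, Amb.r_mk, Function.update_self, ← hw, ← hldef, hj,
        if_true, smul_smul]
      congr 1
      field_simp
    · simp only [blowMap, ofPolar, Amb.F_mk, ← hw, hj, if_false]
  · have h3 := (hA w (he hs)).2.2
    simp only [blowMap, ofPolar, Amb.r_mk, Function.update_idem, ← hw]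
    rw [← h3, Function.update_eq_self]

theorem IsAdapted.ofPolar_mem : ofPolar J e.symm ib v ι U u ∈ blow D J A := by
  have hl := h.polarScale_pos hJ hu
  have hs := e.map_target hu.2.2.2
  have hbm := h.blowMap_ofPolar hA he hJ hu
  have hq : 0 ≤ u.2 ib :=
    hu.2.2.1 ib (Finset.mem_inter.2 ⟨h.ib_mem, Finset.mem_insert_self _ _⟩)
  have hv := h.v_pos _ hs
  have hpos := h.dirScale_pos hJ hu.2.1 hs
  have hL := fun j hj => h.L_eq j (hJ j hj) _ hs
  have hmem := (hA _ (he hs)).2.1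
  refine ⟨?_, ?_, ?_, fun j => ?_, ?_⟩
  · simp only [ofPolar, Amb.r_mk, Function.update_self]
    exact div_nonneg hu.1 hl.le
  · simp only [ofPolar, Amb.b_mk]
    positivity
  · simp only [radSq, ofPolar, Amb.b_mk, Amb.F_mk]
    rw [dirScale] at hl ⊢
    set w := e.symm (polar (centerIdx J ib ι) u) with hw
    set Q := (u.2 ib * v w) ^ 2 + ∑ j ∈ J, (u.2 (ι j)) ^ 2 * ‖U j w‖ ^ 2 with hQ
    calc _ = (√Q)⁻¹ ^ 2 * Q := by
          rw [hQ, mul_add, Finset.mul_sum, ← hQ]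
          congr 1
          · ring
          · refine Finset.sum_congr rfl fun j hj => ?_
            rw [if_pos hj, norm_smul, mul_pow, Real.norm_eq_abs, sq_abs]
            ring
      _ = 1 := by rw [inv_pow, Real.sq_sqrt hpos.le, inv_mul_cancel₀ hpos.ne']
  · by_cases hj : j ∈ J
    · simp only [ofPolar, Amb.F_mk, Amb.x_mk, hj, if_true]
      rw [hL j hj]
      exact Submodule.smul_mem _ _ (Submodule.mem_span_singleton_self _)
    · simp only [ofPolar, Amb.F_mk, Amb.x_mk, hj, if_false]
      exact hmem j
  · rw [hbm]
    exact he hs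

theorem IsAdapted.dirVec_ofPolar {i : Fin (n + 1)} (hi : i ∈ centerIdx J ib ι) :
    dirVec J ib v ι U (ofPolar J e.symm ib v ι U u) i =
      dirScale J ib v ι U u.2 (e.symm (polar (centerIdx J ib ι) u)) * u.2 i := by
  have hs := e.map_target hu.2.2.2
  rcases Finset.mem_insert.1 hi with rfl | hi
  · rw [h.dirVec_ib hJ, h.blowMap_ofPolar hA he hJ hu]
    have := (h.v_pos _ hs).ne'
    simp only [ofPolar, Amb.b_mk]
    field_simp
  · obtain ⟨j, hj, rfl⟩ := Finset.mem_image.1 hi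
    rw [h.dirVec_ι hJ _ hj, h.blowMap_ofPolar hA he hJ hu]
    have := norm_ne_zero_iff.2 (h.U_ne j (hJ j hj) _ hs)
    simp only [ofPolar, Amb.F_mk, hj, if_true, inner_smul_right, real_inner_self_eq_norm_sq]
    field_simp

theorem IsAdapted.dirNorm_ofPolar : dirNorm J ib v ι U (ofPolar J e.symm ib v ι U u) =
    dirScale J ib v ι U u.2 (e.symm (polar (centerIdx J ib ι) u)) := by
  rw [dirNorm, Finset.sum_congr rfl fun i hi => by rw [h.dirVec_ofPolar hA he hJ hu hi, mul_pow],
    ← Finset.mul_sum, hu.2.1, mul_one, Real.sqrt_sq (h.polarScale_pos hJ hu).le]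

theorem IsAdapted.toPolar_ofPolar : toPolar J e ib v ι U (ofPolar J e.symm ib v ι U u) = u := by
  have hl := (h.polarScale_pos hJ hu).ne'
  rw [toPolar, h.dirNorm_ofPolar hA he hJ hu, h.blowMap_ofPolar hA he hJ hu]
  refine Prod.ext ?_ ?_
  · simp only [ofPolar, Amb.r_mk, Function.update_self]
    field_simp
  · ext i
    by_cases hi : i ∈ centerIdx J ib ι
    · simp only [hi, if_true]
      rw [h.dirVec_ofPolar hA he hJ hu hi]
      field_simp
    · simp only [hi, if_false]
      rw [e.right_inv hu.2.2.2]
      simp [polar, hi]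

end OfPolar

/-- The polar coordinates of the blowing-up over the domain of the chart `e`. -/
def blowPolar (hA : IsPreStage D J A) (he : e.source ⊆ A) (h : IsAdapted D e B K ib v ι U)
    (hJ : ∀ j ∈ J, j ∈ K) : PartialEquiv (Amb n c V) (ℝ × E (n + 1)) where
  toFun := toPolar J e ib v ι U
  invFun := ofPolar J e.symm ib v ι U
  source := {w ∈ blow D J A | blowMap J w ∈ e.source}
  target := polarModel B (centerIdx J ib ι) e.target
  map_source' w hw := h.toPolar_mem hJ hw.1 hw.2
  map_target' u hu := ⟨h.ofPolar_mem hA he hJ hu, by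
    rw [h.blowMap_ofPolar hA he hJ hu]; exact e.map_target hu.2.2.2⟩
  left_inv' w hw := h.ofPolar_toPolar hJ hw.1 hw.2
  right_inv' u hu := h.toPolar_ofPolar hA he hJ hu

theorem IsAdapted.contDiffOn_dirVec (h : IsAdapted D e B K ib v ι U) (hJ : ∀ j ∈ J, j ∈ K)
    (i : Fin (n + 1)) : ContDiffOn ℝ ∞ (fun w => dirVec J ib v ι U w i)
      (blowMap J ⁻¹' e.source) := by
  refine ContDiffOn.add ?_ (ContDiffOn.sum fun j hj => ?_)
  · refine contDiffOn_ite (fun _ => ?_) fun _ => contDiffOn_const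
    exact contDiff_amb_b.contDiffOn.div (h.smooth_v.comp (contDiff_blowMap J).contDiffOn
      fun w hw => hw) fun w hw => (h.v_pos _ hw).ne'
  · refine contDiffOn_ite (fun _ => ?_) fun _ => contDiffOn_const
    have hU : ContDiffOn ℝ ∞ (fun w => U j (blowMap J w)) (blowMap J ⁻¹' e.source) :=
      (h.smooth_U j (hJ j hj)).comp (contDiff_blowMap J).contDiffOn fun w hw => hw
    exact (hU.inner ℝ (contDiff_amb_F j).contDiffOn).div (hU.norm_sq ℝ)
      fun w hw => pow_ne_zero _ (norm_ne_zero_iff.2 (h.U_ne j (hJ j hj) _ hw))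

theorem IsAdapted.contDiffOn_dirNorm (h : IsAdapted D e B K ib v ι U) (hJ : ∀ j ∈ J, j ∈ K) :
    ContDiffOn ℝ ∞ (dirNorm J ib v ι U) {w ∈ blow D J A | blowMap J w ∈ e.source} := by
  refine ContDiffOn.sqrt (ContDiffOn.sum fun i _ => ((h.contDiffOn_dirVec hJ i).mono ?_).pow 2) ?_
  · exact fun w hw => hw.2
  · exact fun w hw => (Real.sqrt_pos.1 (h.dirNorm_pos hJ hw.1 hw.2)).ne'

theorem contDiffOn_blowPolar (hA : IsPreStage D J A) (he : IsSubChart A e B)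
    (h : IsAdapted D e B K ib v ι U) (hJ : ∀ j ∈ J, j ∈ K) :
    ContDiffOn ℝ ∞ (blowPolar hA he.source_subset h hJ)
      (blowPolar hA he.source_subset h hJ).source := by
  refine ((contDiff_amb_r J).contDiffOn.mul (h.contDiffOn_dirNorm hJ)).prodMk
    (contDiffOn_euclidean.2 fun i => ?_)
  refine contDiffOn_ite (fun _ => ?_) fun _ => ?_
  · exact ((h.contDiffOn_dirVec hJ i).mono fun w hw => hw.2).div (h.contDiffOn_dirNorm hJ)
      fun w hw => (h.dirNorm_pos hJ hw.1 hw.2).ne'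
  · exact contDiffOn_euclidean.1 (he.contDiffOn.comp (contDiff_blowMap J).contDiffOn
      fun w hw => hw.2) i

theorem contDiffOn_blowPolar_symm (hA : IsPreStage D J A) (he : IsSubChart A e B)
    (h : IsAdapted D e B K ib v ι U) (hJ : ∀ j ∈ J, j ∈ K) :
    ContDiffOn ℝ ∞ (blowPolar hA he.source_subset h hJ).symm
      (blowPolar hA he.source_subset h hJ).target := by
  set s := (blowPolar hA he.source_subset h hJ).target
  have hs : ∀ u ∈ s, u ∈ polarModel B (centerIdx J ib ι) e.target := fun u hu => hu
  have hg : ContDiffOn ℝ ∞ (fun u => e.symm (polar (centerIdx J ib ι) u)) s :=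
    he.contDiffOn_symm.comp (contDiff_polar _).contDiffOn fun u hu => hu.2.2.2
  have hsrc : ∀ u ∈ s, e.symm (polar (centerIdx J ib ι) u) ∈ e.source :=
    fun u hu => e.map_target hu.2.2.2
  have hv : ContDiffOn ℝ ∞ (fun u => v (e.symm (polar (centerIdx J ib ι) u))) s :=
    h.smooth_v.comp hg hsrc
  have hU : ∀ j ∈ J, ContDiffOn ℝ ∞ (fun u => U j (e.symm (polar (centerIdx J ib ι) u))) s :=
    fun j hj => (h.smooth_U j (hJ j hj)).comp hg hsrc
  have ho : ∀ i, ContDiffOn ℝ ∞ (fun u : ℝ × E (n + 1) => u.2 i) s :=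
    fun i => ((contDiff_coord i).comp contDiff_snd).contDiffOn
  have hl : ContDiffOn ℝ ∞
      (fun u => dirScale J ib v ι U u.2 (e.symm (polar (centerIdx J ib ι) u))) s := by
    refine ContDiffOn.inv (ContDiffOn.sqrt ?_ ?_) ?_
    · exact (((ho ib).mul hv).pow 2).add (ContDiffOn.sum fun j hj =>
        ((ho (ι j)).pow 2).mul ((hU j hj).norm_sq ℝ))
    · exact fun u hu => (h.dirScale_pos hJ hu.2.1 (hsrc u hu)).ne'
    · exact fun u hu => (Real.sqrt_pos.2 (h.dirScale_pos hJ hu.2.1 (hsrc u hu))).ne'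
  refine contDiffOn_amb (contDiff_amb_x.comp_contDiffOn hg) (hl.mul ((ho ib).mul hv))
    (fun j => contDiffOn_ite (fun hj => (hl.mul (ho (ι j))).smul (hU j hj))
      fun _ => (contDiff_amb_F j).comp_contDiffOn hg) fun J' => ?_
  refine contDiffOn_update (fun J => (contDiff_amb_r J).comp_contDiffOn hg) ?_ J'
  exact contDiffOn_fst.div hl fun u hu => (h.polarScale_pos hJ hu).ne'

/-- Around the points of the exceptional divisor, the blowing-up of `A` has charts which are adapted
and which have the radius, up to a positive factor, as a further coordinate. -/
theorem exists_chart_blow (hA : IsPreStage D J A) (he : IsSubChart A e B)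
    (h : IsAdapted D e B K ib v ι U) (hJ : ∀ j ∈ J, j ∈ K) {w₀ : Amb n c V} (hw₀ : w₀ ∈ blow D J A)
    (hs : blowMap J w₀ ∈ e.source) :
    ∃ (e' : PartialEquiv (Amb n c V) (E (n + 1))) (B' : Finset (Fin (n + 1))) (i₀ : Fin (n + 1)),
      IsSubChart (blow D J A) e' B' ∧ w₀ ∈ e'.source ∧ i₀ ∈ B' ∧
      (∀ w ∈ e'.source, w.r J ≠ 0 ↔ e' w i₀ ≠ 0) ∧
      (w₀.b = 0 → i₀ ≠ ib ∧ (∀ j ∈ J, w₀.F j = 0 → i₀ ≠ ι j) ∧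
        ∃ v' U', IsAdapted D e' B' {j | j ∈ J ∧ w₀.F j = 0} ib v' ι U') := by
  set θ := blowPolar hA he.source_subset h hJ with hθ
  have hmem : w₀ ∈ θ.source := ⟨hw₀, hs⟩
  have hN₀ := h.dirNorm_pos hJ hw₀ hs
  have ho : ∀ w ∈ θ.source, ∀ i ∈ centerIdx J ib ι,
      (θ w).2 i = dirVec J ib v ι U w i / dirNorm J ib v ι U w := by
    intro w _ i hi
    simp [hθ, blowPolar, toPolar, hi]
  -- A unit vector has a nonzero component. It is determined by the others near `w₀`, so its slot
  -- can hold the radius.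
  obtain ⟨i₀, hi₀, hne⟩ : ∃ i₀ ∈ centerIdx J ib ι, (θ w₀).2 i₀ ≠ 0 := by
    by_contra! hcon
    have h1 := (θ.map_source hmem).2.1
    rw [Finset.sum_eq_zero fun i hi => by rw [hcon i hi, zero_pow two_ne_zero]] at h1
    exact zero_ne_one h1
  set s₀ : ℝ := if 0 < (θ w₀).2 i₀ then 1 else -1 with hs₀def
  have hs₀ : s₀ ^ 2 = 1 := by rw [hs₀def]; split_ifs <;> norm_num
  have hB : i₀ ∈ B → s₀ = 1 := by
    intro hi
    have h1 := (θ.map_source hmem).2.2.1 i₀ (Finset.mem_inter.2 ⟨hi, hi₀⟩)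
    rw [hs₀def, if_pos (h1.lt_of_ne' hne)]
  have hpos : 0 < s₀ * (θ w₀).2 i₀ := by
    rw [hs₀def]
    split_ifs with h1
    · rwa [one_mul]
    · have := lt_of_le_of_ne (not_lt.1 h1) hne
      linarith
  have hT : e.target ⊆ quad B := fun y hy => he.mem_quad hy
  set τ := polarChart hT hi₀ hs₀ hB with hτ
  have hsrc : (θ.trans τ).source = θ.source ∩ (fun w => s₀ * (θ w).2 i₀) ⁻¹' Ioi 0 := by
    ext w
    rw [PartialEquiv.trans_source]
    constructor
    · rintro ⟨h1, h2⟩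
      exact ⟨h1, h2.2⟩
    · rintro ⟨h1, h2⟩
      exact ⟨h1, θ.map_source h1, h2⟩
  have htgt : (θ.trans τ).target = τ.target := by
    rw [PartialEquiv.trans_target]
    exact inter_eq_left.2 fun y hy => (τ.map_target hy).1
  have hθs := contDiffOn_blowPolar hA he h hJ
  have hco : ContinuousOn (fun w => s₀ * (θ w).2 i₀) θ.source :=
    continuousOn_const.mul ((contDiff_coord (n := 0) i₀).continuous.comp_continuousOn
      (continuous_snd.comp_continuousOn hθs.continuousOn))
  have hval : ∀ w i, i ≠ i₀ → (θ.trans τ) w i = (θ w).2 i := by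
    intro w i hi
    simp [hτ, polarChart, hi]
  have hval₀ : ∀ w, (θ.trans τ) w i₀ = w.r J * dirNorm J ib v ι U w := by
    intro w
    simp [hτ, polarChart, hθ, blowPolar, toPolar]
  have hsub : (θ.trans τ).source ⊆ θ.source := by rw [hsrc]; exact inter_subset_left
  refine ⟨θ.trans τ, insert i₀ B, i₀, ⟨?_, ?_, ?_, ?_⟩, ?_, Finset.mem_insert_self _ _, ?_, ?_⟩
  · rw [hsrc]
    refine inter_preimage_relOpen ?_ hco isOpen_Ioi
    obtain ⟨O, hO, hsO⟩ := he.source_eq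
    refine ⟨blowMap J ⁻¹' O, hO.preimage (contDiff_blowMap (k := 0) J).continuous, ?_⟩
    ext w
    change (w ∈ blow D J A ∧ blowMap J w ∈ e.source) ↔ _
    rw [hsO]
    exact ⟨fun h1 => ⟨h1.1, h1.2.2⟩, fun h1 => ⟨h1.1, h1.1.2.2.2.2, h1.2⟩⟩
  · rw [htgt]
    exact polarChart_target_eq hT hi₀ hs₀ hB he.target_eq
  · exact (contDiff_polarChart hT hi₀ hs₀ hB).comp_contDiffOn (hθs.mono hsub)
  · refine (contDiffOn_blowPolar_symm hA he h hJ).comp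
      ((contDiffOn_polarSection (centerIdx J ib ι) i₀ s₀).mono ?_) ?_
    · rw [htgt]
      exact fun y hy => hy.2.1
    · rw [htgt]
      exact fun y hy => (τ.map_target hy).1
  · rw [hsrc]
    exact ⟨hmem, hpos⟩
  · intro w hw
    have hN := (h.dirNorm_pos hJ (hsub hw).1 (hsub hw).2).ne'
    rw [hval₀, mul_ne_zero_iff]
    exact ⟨fun h1 => ⟨h1, hN⟩, fun h1 => h1.1⟩
  -- The direction of `w₀` has zero component along `ib` and along `ι j` whenever `w₀.F j = 0`. So
  -- `i₀` is none of these indices, and the corresponding coordinates survive in the new chart.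
  · intro hb
    have hibmem : ib ∈ centerIdx J ib ι := Finset.mem_insert_self _ _
    have hιmem : ∀ j ∈ J, ι j ∈ centerIdx J ib ι :=
      fun j hj => Finset.mem_insert_of_mem (Finset.mem_image_of_mem _ hj)
    have hib : i₀ ≠ ib := by
      rintro rfl
      apply hne
      rw [ho w₀ hmem _ hi₀, h.dirVec_ib hJ, hb]
      simp
    have hι : ∀ j ∈ J, w₀.F j = 0 → i₀ ≠ ι j := by
      rintro j hj hF rfl
      apply hne
      rw [ho w₀ hmem _ hi₀, h.dirVec_ι hJ _ hj, hF]
      simp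
    have hcomp : ∀ {G : Type} [NormedAddCommGroup G] [NormedSpace ℝ G] {f : Amb n c V → G},
        ContDiffOn ℝ ∞ f e.source → ContDiffOn ℝ ∞ (fun w => f (blowMap J w))
          (θ.trans τ).source :=
      fun hf => hf.comp (contDiff_blowMap J).contDiffOn fun w hw => (hsub hw).2
    have hNs : ContDiffOn ℝ ∞ (dirNorm J ib v ι U) (θ.trans τ).source :=
      (h.contDiffOn_dirNorm hJ).mono hsub
    refine ⟨hib, hι, fun w => dirNorm J ib v ι U w * v (blowMap J w),
      fun j w => dirNorm J ib v ι U w • U j (blowMap J w), Finset.mem_insert_of_mem h.ib_mem,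
      hNs.mul (hcomp h.smooth_v), fun w hw => ?_, fun w hw => ?_, fun j hj => ?_,
      fun i hi j hj => h.ι_inj (hJ i hi.1) (hJ j hj.1), fun j hj => ?_, fun j hj w hw => ?_,
      fun j hj w hw => ?_, fun j hj w hw => ?_⟩
    · exact mul_pos (h.dirNorm_pos hJ (hsub hw).1 (hsub hw).2) (h.v_pos _ (hsub hw).2)
    · have hN := (h.dirNorm_pos hJ (hsub hw).1 (hsub hw).2).ne'
      rw [hval _ _ hib.symm, ho w (hsub hw) _ hibmem]
      nth_rw 1 [h.b_eq_dirVec hJ (hsub hw).2]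
      field_simp
    · rw [Finset.mem_insert, not_or]
      exact ⟨(hι j hj.1 hj.2).symm, h.ι_notMem j (hJ j hj.1)⟩
    · exact hNs.smul (hcomp (h.smooth_U j (hJ j hj.1)))
    · exact smul_ne_zero (h.dirNorm_pos hJ (hsub hw).1 (hsub hw).2).ne'
        (h.U_ne j (hJ j hj.1) _ (hsub hw).2)
    · have hN := (h.dirNorm_pos hJ (hsub hw).1 (hsub hw).2).ne'
      rw [hval _ _ (hι j hj.1 hj.2).symm, ho w (hsub hw) _ (hιmem j hj.1), smul_smul,
        div_mul_cancel₀ _ hN]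
      exact h.F_eq_dirVec hJ (hsub hw).1 (hsub hw).2 hj.1
    · have hN := (h.dirNorm_pos hJ (hsub hw).1 (hsub hw).2).ne'
      rw [Submodule.span_singleton_smul_eq (IsUnit.mk0 _ hN)]
      exact h.L_eq j (hJ j hj.1) _ (hsub hw).2

end Center

end

/-! ### The inductive step: the blowing-up of a stage is a stage. -/

section

section Stage

variable {n c : ℕ} {V : Type} [NormedAddCommGroup V] [InnerProductSpace ℝ V] {M Sig : Set (E n)}
  {D : BranchData M Sig c V} {J : Finset (Fin c)} {A : Set (Amb n c V)}
  {T : Finset (Finset (Fin c))}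

theorem IsAdapted.mono {e : PartialEquiv (Amb n c V) (E (n + 1))} {B : Finset (Fin (n + 1))}
    {K K' : Set (Fin c)} {ib : Fin (n + 1)} {v : Amb n c V → ℝ} {ι : Fin c → Fin (n + 1)}
    {U : Fin c → Amb n c V → V} (h : IsAdapted D e B K ib v ι U) (hK : K' ⊆ K) :
    IsAdapted D e B K' ib v ι U :=
  ⟨h.ib_mem, h.smooth_v, h.v_pos, h.b_eq, fun j hj => h.ι_notMem j (hK hj), h.ι_inj.mono hK,
    fun j hj => h.smooth_U j (hK hj), fun j hj => h.U_ne j (hK hj), fun j hj => h.F_eq j (hK hj),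
    fun j hj => h.L_eq j (hK hj)⟩

theorem IsStage.isPreStage (h : IsStage D T A) (hJ : J ∉ T) : IsPreStage D J A :=
  fun w hw => ⟨h.b_nonneg w hw, h.F_mem w hw, h.r_eq_one w hw J hJ⟩

/-- The center of the blowing-up of index `J`. -/
def center (J : Finset (Fin c)) : Set (Amb n c V) := {w | w.b = 0 ∧ ∀ j ∈ J, w.F j = 0}

/-- Increasing one coordinate violates no condition `0 ≤ y i`, so the curve stays in the target for
small times. -/
theorem IsSubChart.mem_closure_curve {d : ℕ} {W : Type} [NormedAddCommGroup W] [NormedSpace ℝ W]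
    {A : Set W} {e : PartialEquiv W (E d)} {B : Finset (Fin d)} (h : IsSubChart A e B) {w : W}
    (hw : w ∈ e.source) {i₀ : Fin d} :
    w ∈ closure {w' ∈ e.source | e w i₀ < e w' i₀ ∧ ∀ i ≠ i₀, e w' i = e w i} := by
  obtain ⟨O, hO, ht⟩ := h.target_eq
  set g : ℝ → E d := fun t => WithLp.toLp 2 (Function.update (e w).ofLp i₀ (e w i₀ + t)) with hg
  have hgc : Continuous g := by
    refine (PiLp.continuous_toLp 2 _).comp (continuous_const.update i₀ ?_)
    exact continuous_const.add continuous_id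
  have hg0 : g 0 = e w := by simp [hg]
  have hmem : e w ∈ O ∩ quad B := ht ▸ e.map_source hw
  have h1 : ∀ᶠ t in 𝓝[>] (0 : ℝ), g t ∈ e.target := by
    have h2 : ∀ᶠ t in 𝓝[>] (0 : ℝ), g t ∈ O :=
      (hgc.tendsto' 0 (e w) hg0).mono_left nhdsWithin_le_nhds |>.eventually (hO.mem_nhds hmem.1)
    filter_upwards [h2, self_mem_nhdsWithin] with t ht1 ht2
    rw [ht]
    refine ⟨ht1, fun i hi => ?_⟩
    by_cases hii : i = i₀
    · subst hii
      simpa [hg] using add_nonneg (hmem.2 i hi) (le_of_lt ht2)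
    · simpa [hg, hii] using hmem.2 i hi
  have h3 : Tendsto (fun t => e.symm (g t)) (𝓝[>] 0) (𝓝 w) := by
    have h4 : Tendsto g (𝓝[>] 0) (𝓝[e.target] (e w)) :=
      tendsto_nhdsWithin_iff.2 ⟨(hgc.tendsto' 0 (e w) hg0).mono_left nhdsWithin_le_nhds, h1⟩
    have h5 := (h.contDiffOn_symm.continuousOn (e w) (e.map_source hw)).tendsto.comp h4
    rwa [e.left_inv hw] at h5
  refine mem_closure_of_tendsto h3 ?_
  filter_upwards [h1, self_mem_nhdsWithin] with t ht1 ht2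
  refine ⟨e.map_target ht1, ?_, fun i hi => ?_⟩
  · rw [e.right_inv ht1]
    simpa [hg] using ht2
  · rw [e.right_inv ht1]
    simp [hg, hi]

variable (h : IsStage D T A) (hJT : J ∉ T) (hJ : ∀ j ∉ J, insert j J ∈ T)
include h hJT hJ

omit hJT in
-- The set `insert j J` has been blown up before `J`, so its equations have no common zero with `b`.
-- This is what the order of the blowings-up is for.
theorem IsStage.F_ne_of_mem_center {w : Amb n c V} (hw : w ∈ A) (hc : w ∈ center J) {j : Fin c}
    (hj : j ∉ J) : w.F j ≠ 0 := by
  intro h0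
  obtain ⟨i, hi, hne⟩ := h.separated w hw _ (hJ j hj) hc.1
  rcases Finset.mem_insert.1 hi with rfl | hi
  · exact hne h0
  · exact hne (hc.2 i hi)

omit h hJT hJ in
theorem blowMap_mem_center_iff {w : Amb n c V} (hw : w ∈ blow D J A) :
    blowMap J w ∈ center J ↔ w.r J = 0 := by
  change ((blowMap J w).b = 0 ∧ ∀ j ∈ J, (blowMap J w).F j = 0) ↔ _
  rw [← radSq_eq_zero, radSq_blowMap, hw.2.2.1, mul_one, pow_eq_zero_iff two_ne_zero]

/-- The chart from `exists_chart_blow` is adapted to branches of index in `J` only. By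
`F_ne_of_mem_center` no other branch passes through `w₀`. -/
theorem IsStage.exists_chart_exceptional {w₀ : Amb n c V} (hw₀ : w₀ ∈ blow D J A)
    (hr : w₀.r J = 0) :
    ∃ (e' : PartialEquiv (Amb n c V) (E (n + 1))) (B' : Finset (Fin (n + 1))) (i₀ : Fin (n + 1)),
      IsSubChart (blow D J A) e' B' ∧ w₀ ∈ e'.source ∧ i₀ ∈ B' ∧
      (∀ w ∈ e'.source, w.r J ≠ 0 ↔ e' w i₀ ≠ 0) ∧
      (w₀.b = 0 → ∃ ib v' ι U', i₀ ≠ ib ∧ (∀ j, w₀.F j = 0 → i₀ ≠ ι j) ∧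
        IsAdapted D e' B' {j | w₀.F j = 0} ib v' ι U') := by
  have hc := (blowMap_mem_center_iff hw₀).2 hr
  obtain ⟨e, B, he, hs, had⟩ := h.chart _ hw₀.2.2.2.2
  obtain ⟨ib, v, ι, U, had⟩ := had hc.1
  have hJK : ∀ j ∈ J, j ∈ {j | (blowMap J w₀).F j = 0} := hc.2
  obtain ⟨e', B', i₀, h1, h2, h3, h4, h5⟩ :=
    exists_chart_blow (h.isPreStage hJT) he had hJK hw₀ hs
  refine ⟨e', B', i₀, h1, h2, h3, h4, fun hb => ?_⟩
  obtain ⟨h6, h7, v', U', h8⟩ := h5 hb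
  have hK : ∀ j, w₀.F j = 0 → j ∈ J := by
    intro j hj
    by_contra hjJ
    refine h.F_ne_of_mem_center hJ hw₀.2.2.2.2 hc hjJ ?_
    simpa [blowMap, hjJ] using hj
  exact ⟨ib, v', ι, U', h6, fun j hj => h7 j (hK j hj) hj, h8.mono fun j hj => ⟨hK j hj, hj⟩⟩

/-- Raising the radius coordinate alone leaves the exceptional divisor at once, while the
coordinates which carry `b` and the vanishing `F j` stay zero. Both the density conditions and the
formulas for the strict transforms rest on this. -/
theorem IsStage.mem_closure_off_center {w₀ : Amb n c V} (hw₀ : w₀ ∈ blow D J A)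
    (hr : w₀.r J = 0) : w₀ ∈ closure {w ∈ blow D J A | w.r J ≠ 0 ∧
      (w₀.b = 0 → w.b = 0 ∧ ∀ j, w₀.F j = 0 → w.F j = 0)} := by
  obtain ⟨e', B', i₀, h1, h2, h3, h4, h5⟩ := h.exists_chart_exceptional hJT hJ hw₀ hr
  refine closure_mono ?_ (h1.mem_closure_curve h2 (i₀ := i₀))
  rintro w ⟨hws, hlt, heq⟩
  have h6 : e' w₀ i₀ = 0 := by
    by_contra h7
    exact (h4 w₀ h2).2 h7 hr
  refine ⟨h1.source_subset hws, (h4 w hws).2 (h6 ▸ hlt).ne', fun hb => ?_⟩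
  obtain ⟨ib, v', ι, U', h7, h8, h9⟩ := h5 hb
  refine ⟨?_, fun j hj => ?_⟩
  · have h10 := h9.b_eq w₀ h2
    rw [hb] at h10
    rw [h9.b_eq w hws, heq ib h7.symm,
      (mul_eq_zero.1 h10.symm).resolve_right (h9.v_pos w₀ h2).ne', zero_mul]
  · have h10 := h9.F_eq j hj w₀ h2
    rw [show w₀.F j = 0 from hj] at h10
    rw [h9.F_eq j hj w hws, heq _ (h8 j hj).symm,
      (smul_eq_zero.1 h10.symm).resolve_right (h9.U_ne j hj w₀ h2), zero_smul]

omit h hJT hJ in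
-- Off the exceptional divisor `blowInv J` is a continuous inverse of `blowMap J`, so closures are
-- transported by it.
theorem mem_closure_blow_of_ne {w₀ : Amb n c V} (hw₀ : w₀ ∈ blow D J A) (hr : w₀.r J ≠ 0)
    {S S' : Set (Amb n c V)} (hS : blowMap J w₀ ∈ closure S)
    (hSS' : ∀ w ∈ S, radSq J w ≠ 0 → blowInv J w ∈ S') : w₀ ∈ closure S' := by
  have hopen : IsOpen {w : Amb n c V | radSq J w ≠ 0} :=
    isOpen_ne.preimage (contDiff_radSq (k := 0) J).continuous
  have hmem : blowMap J w₀ ∈ {w : Amb n c V | radSq J w ≠ 0} := by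
    change radSq J (blowMap J w₀) ≠ 0
    rw [radSq_blowMap, hw₀.2.2.1, mul_one]
    exact pow_ne_zero _ hr
  have h1 := hopen.inter_closure ⟨hmem, hS⟩
  have h2 : ContinuousWithinAt (blowInv J) ({w : Amb n c V | radSq J w ≠ 0} ∩ S) (blowMap J w₀) :=
    ((contDiffOn_blowInv (k := 0) J).continuousOn.continuousAt
      (hopen.mem_nhds hmem)).continuousWithinAt
  have h3 := h2.mem_closure_image h1
  rw [blowInv_blowMap hw₀ hr] at h3
  refine closure_mono ?_ h3
  rintro _ ⟨w, ⟨hw1, hw2⟩, rfl⟩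
  exact hSS' w hw2 hw1

/-- Most conditions are pulled back along `blowMap J`. The new case of `separated` is the equation
`radSq J w = 1`. The new factor in `prod_ne` is nonzero because a point with `r J = 0` lies over the
center, which does not meet the branches outside `J`. Charts and density are treated separately off
the exceptional divisor, by transport, and on it, by the polar charts. -/
theorem IsStage.blow : IsStage D (insert J T) (blow D J A) := by
  have hpre := h.isPreStage hJT
  have hrpos : ∀ w : Amb n c V, radSq J w ≠ 0 → (∀ J', 0 < w.r J') → ∀ J', 0 < (blowInv J w).r J' := by
    intro w hw hr J'
    by_cases hJ' : J' = J
    · subst hJ'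
      simpa [blowInv] using Real.sqrt_pos.2 ((radSq_nonneg J' w).lt_of_ne' hw)
    · simpa [blowInv, hJ'] using hr J'
  refine ⟨?_, ?_, ?_, ?_, ?_, ?_, ?_, ?_, ?_, ?_, ?_⟩
  · intro w hw
    have h1 := h.x_mem (blowMap J w) hw.2.2.2.2
    exact h1
  · exact fun w hw => hw.2.1
  · intro w hw J'
    by_cases hJ' : J' = J
    · subst hJ'; exact hw.1
    · simpa [blowMap, hJ'] using h.r_nonneg _ hw.2.2.2.2 J'
  · exact fun w hw => hw.2.2.2.1
  · intro w hw j
    have h1 := h.F_eq _ hw.2.2.2.2 j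
    change D.F j w.x = _ at h1
    rw [h1]
    by_cases hj : j ∈ J
    · have h2 : J ∈ Finset.univ.filter fun J' : Finset (Fin c) => j ∈ J' := by simp [hj]
      simp only [blowMap, Amb.F_mk, Amb.r_mk, hj, if_true, smul_smul]
      rw [mul_comm, prod_update_mul _ _ _ h2]
    · have h2 : J ∉ Finset.univ.filter fun J' : Finset (Fin c) => j ∈ J' := by simp [hj]
      simp only [blowMap, Amb.F_mk, Amb.r_mk, hj, if_false]
      rw [prod_update_of_notMem _ _ _ h2]
  · intro w hw J' hJ'
    rw [Finset.mem_insert, not_or] at hJ'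
    have := h.r_eq_one _ hw.2.2.2.2 J' hJ'.2
    simpa [blowMap, hJ'.1] using this
  · intro w hw J' hJ' hb
    rcases Finset.mem_insert.1 hJ' with rfl | hJ'
    · by_contra! hcon
      have h1 := hw.2.2.1
      rw [radSq_eq_zero.2 ⟨hb, hcon⟩] at h1
      exact zero_ne_one h1
    · obtain ⟨j, hj, hne⟩ := h.separated _ hw.2.2.2.2 J' hJ' (by simp [blowMap, hb])
      refine ⟨j, hj, fun h0 => hne ?_⟩
      simp [blowMap, h0]
  · intro w hw j hF
    have h1 := h.prod_ne _ hw.2.2.2.2 j (by simp [blowMap, hF])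
    by_cases hj : j ∈ J
    · have h2 : J ∉ Finset.univ.filter fun J' : Finset (Fin c) => j ∉ J' := by simp [hj]
      simp only [blowMap, Amb.r_mk] at h1
      rwa [prod_update_of_notMem _ _ _ h2] at h1
    · have h2 : J ∈ Finset.univ.filter fun J' : Finset (Fin c) => j ∉ J' := by simp [hj]
      rw [← prod_update_mul _ _ _ h2]
      refine mul_ne_zero (fun hr => ?_) h1
      refine h.F_ne_of_mem_center hJ hw.2.2.2.2 ((blowMap_mem_center_iff hw).2 hr) hj ?_
      simpa [blowMap, hj] using hF
  · intro w hw
    by_cases hr : w.r J = 0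
    · obtain ⟨e', B', i₀, h1, h2, h3, h4, h5⟩ := h.exists_chart_exceptional hJT hJ hw hr
      refine ⟨e', B', h1, h2, fun hb => ?_⟩
      obtain ⟨ib, v', ι, U', -, -, h9⟩ := h5 hb
      exact ⟨ib, v', ι, U', h9⟩
    · obtain ⟨e, B, he, hs, had⟩ := h.chart _ hw.2.2.2.2
      refine ⟨_, B, isSubChart_blowChartOff hpre he, ⟨hw, hs, hr⟩, fun hb => ?_⟩
      obtain ⟨ib, v, ι, U, had⟩ := had (by simp [blowMap, hb])
      refine ⟨ib, _, ι, _, (isAdapted_blowChartOff hpre he had).mono fun j hj => ?_⟩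
      have : w.F j = 0 := hj
      simp [blowMap, this]
  · intro w hw
    have key : ∀ w ∈ Smoothing.blow D J A, w.r J ≠ 0 →
        w ∈ closure {w' ∈ Smoothing.blow D J A | 0 < w'.b ∧ ∀ J, 0 < w'.r J} := by
      intro w hw hr
      refine mem_closure_blow_of_ne hw hr (h.dense _ hw.2.2.2.2) ?_
      rintro w' ⟨hA, hb, hrr⟩ hne
      refine ⟨blowInv_mem hpre hA hne, mul_pos (inv_pos.2 ?_) hb, hrpos w' hne hrr⟩
      exact Real.sqrt_pos.2 ((radSq_nonneg J w').lt_of_ne' hne)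
    by_cases hr : w.r J = 0
    · have h1 := h.mem_closure_off_center hJT hJ hw hr
      refine closure_minimal ?_ isClosed_closure h1
      exact fun w' hw' => key w' hw'.1 hw'.2.1
    · exact key w hw hr
  · intro w hw hb
    have key : ∀ w ∈ Smoothing.blow D J A, w.r J ≠ 0 → w.b = 0 →
        w ∈ closure {w' ∈ Smoothing.blow D J A | w'.b = 0 ∧ (∀ J, 0 < w'.r J) ∧
          ∀ j, w'.F j ≠ 0} := by
      intro w hw hr hb
      refine mem_closure_blow_of_ne hw hr (h.dense_init _ hw.2.2.2.2 (by simp [blowMap, hb])) ?_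
      rintro w' ⟨hA, hb, hrr, hF⟩ hne
      have hpos := Real.sqrt_pos.2 ((radSq_nonneg J w').lt_of_ne' hne)
      refine ⟨blowInv_mem hpre hA hne, by simp [blowInv, hb], hrpos w' hne hrr, fun j => ?_⟩
      by_cases hj : j ∈ J <;> simp [blowInv, hj, hF j, hpos.ne']
    by_cases hr : w.r J = 0
    · have h1 := h.mem_closure_off_center hJT hJ hw hr
      refine closure_minimal ?_ isClosed_closure h1
      exact fun w' hw' => key w' hw'.1 hw'.2.1 (hw'.2.2 hb).1
    · exact key w hw hr hb

end Stage

end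

/-! ### Transport of charts to a model, and centered charts. -/

section

section Pull

variable {d : ℕ} {W G : Type} [NormedAddCommGroup W] [NormedSpace ℝ W] [NormedAddCommGroup G]
  [NormedSpace ℝ G] {X : RegSpace d} {ι : X.carrier → W}

/-- The map on `X` induced by a map defined on a subset of the image of `ι`. -/
def IsModel.pull (h : IsModel X ι) [Nonempty X.carrier] (e : PartialEquiv W G) :
    PartialEquiv X.carrier G :=
  (h.emb.injective.injOn (s := univ)).toPartialEquiv.trans e

variable (h : IsModel X ι) [Nonempty X.carrier] {e : PartialEquiv W G}

theorem IsModel.pull_source : (h.pull e).source = ι ⁻¹' e.source := by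
  simp [IsModel.pull, PartialEquiv.trans_source]

theorem IsModel.pull_target (he : e.source ⊆ range ι) : (h.pull e).target = e.target := by
  rw [IsModel.pull, PartialEquiv.trans_target]
  refine inter_eq_left.2 fun y hy => ?_
  have := he (e.map_target hy)
  simpa using this

theorem IsModel.pull_apply (q : X.carrier) : h.pull e q = e (ι q) := rfl

theorem IsModel.pull_symm (he : e.source ⊆ range ι) {y : G} (hy : y ∈ e.target) :
    ι ((h.pull e).symm y) = e.symm y := by
  have h1 : y ∈ (h.pull e).target := by rwa [h.pull_target he]
  have h2 := (h.pull e).right_inv h1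
  have h3 := (h.pull e).map_target h1
  rw [h.pull_source] at h3
  rw [h.pull_apply] at h2
  rw [← h2, e.left_inv h3, h2]

theorem IsModel.contMDiffOn_pull (hs : ContDiffOn ℝ ∞ e e.source) :
    ContMDiffOn (Corner d) 𝓘(ℝ, G) ∞ (h.pull e) (h.pull e).source := by
  rw [h.pull_source]
  exact h.contMDiffOn_comp hs fun q hq => hq

theorem IsModel.contMDiffOn_pull_symm (he : e.source ⊆ range ι)
    (hs : ContDiffOn ℝ ∞ e.symm e.target) :
    ContMDiffOn 𝓘(ℝ, G) (Corner d) ∞ (h.pull e).symm (h.pull e).target := by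
  rw [h.pull_target he]
  exact h.contMDiffOn_of_comp (hs.contMDiffOn.congr fun y hy => h.pull_symm he hy)

theorem IsModel.isCornerChart {e : PartialEquiv W (E d)} {B : Finset (Fin d)}
    (he : IsSubChart (range ι) e B) : IsCornerChart X (h.pull e) B := by
  refine ⟨?_, ?_, h.contMDiffOn_pull he.contDiffOn,
    h.contMDiffOn_pull_symm he.source_subset he.contDiffOn_symm⟩
  · obtain ⟨O, hO, hs⟩ := he.source_eq
    rw [h.pull_source, hs, preimage_inter, preimage_range, univ_inter]
    exact hO.preimage h.emb.continuous
  · rw [h.pull_target he.source_subset]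
    exact he.target_eq

end Pull

section Recenter

variable {d : ℕ} {W : Type} [NormedAddCommGroup W] [NormedSpace ℝ W]

/-- The translate of a chart. -/
def translateChart (e : PartialEquiv W (E d)) (a : E d) : PartialEquiv W (E d) :=
  e.trans (Equiv.subRight a).toPartialEquiv

theorem translateChart_source (e : PartialEquiv W (E d)) (a : E d) :
    (translateChart e a).source = e.source := by simp [translateChart]

theorem restr_source_eq (e : PartialEquiv W (E d)) (O : Set W) : (e.restr O).source = e.source ∩ O :=
  e.restr_source O

theorem IsSubChart.restr {A : Set W} {e : PartialEquiv W (E d)} {B : Finset (Fin d)}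
    (h : IsSubChart A e B) {O : Set W} (hO : IsOpen O) : IsSubChart A (e.restr O) B := by
  refine ⟨?_, ?_, h.contDiffOn.mono ?_, h.contDiffOn_symm.mono ?_⟩
  · obtain ⟨O', hO', hs⟩ := h.source_eq
    exact ⟨O' ∩ O, hO'.inter hO, by rw [restr_source_eq, hs, inter_assoc]⟩
  · obtain ⟨O', hO', ht⟩ := inter_preimage_relOpen (s := e.target) (A := quad B)
      (by obtain ⟨O, hO, ht⟩ := h.target_eq; exact ⟨O, hO, by rw [ht, inter_comm]⟩)
      h.contDiffOn_symm.continuousOn hO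
    exact ⟨O', hO', by rw [inter_comm, ← ht]; rfl⟩
  · rw [restr_source_eq]; exact inter_subset_left
  · exact fun y hy => hy.1

/-- A chart can be translated so as to be centered at a given point. -/
theorem IsSubChart.translate {A : Set W} {e : PartialEquiv W (E d)} {B : Finset (Fin d)}
    (h : IsSubChart A e B) {w : W} (hw : w ∈ e.source) :
    ∃ O, IsOpen O ∧ w ∈ O ∧
      IsSubChart A (translateChart (e.restr O) (e w)) (B.filter fun i => e w i = 0) := by
  obtain ⟨O₁, hO₁, hs⟩ := h.source_eq
  obtain ⟨O₂, hO₂, ht⟩ := h.target_eq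
  -- On this neighborhood only the faces through `e w` impose conditions, which explains the smaller
  -- index set of the translated chart.
  set P : Set (E d) := {y | ∀ i, i ∈ B → e w i ≠ 0 → 0 < y i} with hP
  have hPo : IsOpen P := by
    have : P = ⋂ i : Fin d, {y | i ∈ B → e w i ≠ 0 → 0 < y i} := by ext; simp [hP]
    rw [this]
    refine isOpen_iInter_of_finite fun i => ?_
    by_cases h1 : i ∈ B ∧ e w i ≠ 0
    · simpa [h1.1, h1.2] using isOpen_lt continuous_const (contDiff_coord (n := 0) i).continuous
    · have : {y : E d | i ∈ B → e w i ≠ 0 → 0 < y i} = univ := by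
        ext y; simp only [mem_ofPred_eq, mem_univ, iff_true]; tauto
      rw [this]; exact isOpen_univ
  have hwP : e w ∈ P := fun i hi hne => ((h.mem_quad (e.map_source hw)) i hi).lt_of_ne' hne
  obtain ⟨O, hO, hOs⟩ := inter_preimage_relOpen ⟨O₁, hO₁, hs⟩ h.contDiffOn.continuousOn hPo
  have hwO : w ∈ O := (hOs ▸ (⟨hw, hwP⟩ : w ∈ e.source ∩ e ⁻¹' P) : w ∈ A ∩ O).2
  have hr := h.restr hO
  refine ⟨O, hO, hwO, ?_, ?_, ?_, ?_⟩
  · rw [translateChart_source]; exact hr.source_eq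
  · refine ⟨(fun y => y + e w) ⁻¹' (O₂ ∩ P), (hO₂.inter hPo).preimage (by fun_prop), ?_⟩
    ext y
    have h1 : y ∈ (translateChart (e.restr O) (e w)).target ↔
        y + e w ∈ e.target ∧ e.symm (y + e w) ∈ O := by
      simp [translateChart, PartialEquiv.trans_target]
    rw [h1, ht]
    constructor
    · rintro ⟨⟨h2, h3⟩, h4⟩
      have h5 : e.symm (y + e w) ∈ A ∩ O := ⟨h.source_subset (e.map_target (ht ▸ ⟨h2, h3⟩)), h4⟩
      rw [← hOs] at h5
      have h6 := h5.2
      rw [mem_preimage, e.right_inv (ht ▸ ⟨h2, h3⟩)] at h6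
      refine ⟨⟨h2, h6⟩, fun i hi => ?_⟩
      have h7 := h3 i (Finset.mem_filter.1 hi).1
      simpa [(Finset.mem_filter.1 hi).2] using h7
    · rintro ⟨⟨h2, h3⟩, h4⟩
      have h5 : y + e w ∈ O₂ ∩ quad B := by
        refine ⟨h2, fun i hi => ?_⟩
        by_cases h6 : e w i = 0
        · simpa [h6] using h4 i (Finset.mem_filter.2 ⟨hi, h6⟩)
        · exact (h3 i hi h6).le
      refine ⟨h5, ?_⟩
      have h6 : e.symm (y + e w) ∈ e.source ∩ e ⁻¹' P := by
        refine ⟨e.map_target (ht ▸ h5), ?_⟩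
        rw [mem_preimage, e.right_inv (ht ▸ h5)]
        exact h3
      rw [hOs] at h6
      exact h6.2
  · rw [translateChart_source]
    exact hr.contDiffOn.sub contDiffOn_const
  · have h1 : ContDiff ℝ ∞ fun y : E d => y + e w := contDiff_id.add contDiff_const
    refine hr.contDiffOn_symm.comp h1.contDiffOn fun y hy => ?_
    have : y + e w ∈ (e.restr O).target := by
      simpa [translateChart, PartialEquiv.trans_target] using hy
    exact this

end Recenter

/-! ### Stages as regularized spaces, and their blowings-up. -/

section StageModel

variable {n c : ℕ} {V : Type} [NormedAddCommGroup V] [InnerProductSpace ℝ V] {M Sig : Set (E n)}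
  {D : BranchData M Sig c V} {J : Finset (Fin c)}
  {T : Finset (Finset (Fin c))} {X : RegSpace (n + 1)} {ι : X.carrier → Amb n c V}

/-- The regularized space `X` is identified by `ι` with a set obtained from `M × ℝ_{≥0}` by blowing
up the strict transforms of the intersections of the branches of index in `J`, for `J ∈ T`. -/
structure IsStageModel (D : BranchData M Sig c V) (T : Finset (Finset (Fin c)))
    (X : RegSpace (n + 1)) (ι : X.carrier → Amb n c V) : Prop where
  model : IsModel X ι
  stage : IsStage D T (range ι)
  M_eq : X.M = {q | (ι q).b = 0}
  Sig_eq : X.Sig = {q | (ι q).b = 0 ∧ ∃ j, (ι q).F j = 0}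

theorem IsStageModel.isClosed_M (h : IsStageModel D T X ι) : IsClosed X.M := by
  rw [h.M_eq]
  exact isClosed_eq ((contDiff_amb_b (k := 0)).continuous.comp h.model.emb.continuous) continuous_const

/-- Centered adapted charts. -/
theorem IsStageModel.exists_chart (h : IsStageModel D T X ι) {p : X.carrier} (hp : p ∈ X.M) :
    ∃ e B b, IsAdaptedChartAt X p e B b ∧ ∃ κ : Fin c → Fin (n + 1),
      (∀ j, (ι p).F j = 0 → κ j ≠ b ∧ ∀ q ∈ e.source, (ι q).F j = 0 ↔ e q (κ j) = 0) ∧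
      ∀ j, (ι p).F j ≠ 0 → ∀ q ∈ e.source, (ι q).F j ≠ 0 := by
  have : Nonempty X.carrier := ⟨p⟩
  rw [h.M_eq] at hp
  obtain ⟨e, B, he, hs, had⟩ := h.stage.chart (ι p) (mem_range_self p)
  obtain ⟨ib, v, κ, U, had⟩ := had hp
  -- The branches which do not pass through `p` are removed from the chart domain.
  set O₀ : Set (Amb n c V) := ⋂ j : {j // (ι p).F j ≠ 0}, {w | w.F j ≠ 0} with hO₀
  have hO₀o : IsOpen O₀ := isOpen_iInter_of_finite fun j =>
    isOpen_ne.preimage (contDiff_amb_F (k := 0) (j : Fin c)).continuous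
  have hpO₀ : ι p ∈ O₀ := mem_iInter.2 fun j => j.2
  have hs' : ι p ∈ (e.restr O₀).source := by rw [restr_source_eq]; exact ⟨hs, hpO₀⟩
  obtain ⟨O, hO, hpO, hch⟩ := (he.restr hO₀o).translate hs'
  set e' := translateChart ((e.restr O₀).restr O) (e.restr O₀ (ι p)) with he'
  have hsrc : e'.source = e.source ∩ O₀ ∩ O := by
    rw [he', translateChart_source, restr_source_eq, restr_source_eq]
  have hmem : ∀ q, q ∈ (h.model.pull e').source ↔ ι q ∈ e.source ∧ ι q ∈ O₀ ∧ ι q ∈ O := by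
    intro q
    rw [h.model.pull_source, hsrc]
    simp only [mem_preimage, mem_inter_iff, and_assoc]
  have hval : ∀ q, h.model.pull e' q = e (ι q) - e (ι p) := fun q => rfl
  -- The coordinates which carry `b` and the vanishing `F j` are zero at `p`, so the translation
  -- does not change their zero sets.
  have hib : e (ι p) ib = 0 := by
    have h1 := had.b_eq _ hs
    rw [show (ι p).b = 0 from hp] at h1
    exact (mul_eq_zero.1 h1.symm).resolve_right (had.v_pos _ hs).ne'
  have hκ : ∀ j, (ι p).F j = 0 → e (ι p) (κ j) = 0 := by
    intro j hj
    have h1 := had.F_eq j hj _ hs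
    rw [hj] at h1
    exact (smul_eq_zero.1 h1.symm).resolve_right (had.U_ne j hj _ hs)
  refine ⟨h.model.pull e', _, ib, ⟨h.model.isCornerChart hch, (hmem p).2 ⟨hs, hpO₀, hpO⟩, ?_, ?_, ?_⟩,
    κ, fun j hj => ⟨had.ib_ne hj, fun q hq => ?_⟩, fun j hj q hq => ?_⟩
  · rw [hval, sub_self]
  · exact Finset.mem_filter.2 ⟨had.ib_mem, hib⟩
  · rw [h.M_eq]
    ext q
    simp only [mem_inter_iff, mem_ofPred_eq]
    rw [and_comm]
    refine and_congr_right fun hq => ?_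
    have hq' := ((hmem q).1 hq).1
    rw [hval, had.b_eq _ hq']
    simp [hib, (had.v_pos _ hq').ne']
  · have hq' := ((hmem q).1 hq).1
    rw [hval, had.F_eq j hj _ hq']
    simp [hκ j hj, had.U_ne j hj _ hq']
  · exact mem_iInter.1 ((hmem q).1 hq).2.1 ⟨j, hj⟩

/-- The branches of the locus are the zero sets of the strict transforms `F j` in `b = 0`. By
`exists_chart`, those through a point are coordinate hyperplanes of one centered chart. -/
theorem IsStageModel.isRegularized (h : IsStageModel D T X ι) : X.IsRegularized := by
  refine ⟨h.isClosed_M, ⟨c, fun j => {q | (ι q).b = 0 ∧ (ι q).F j = 0}, ?_, fun j => ⟨?_, ?_, ?_⟩⟩, ?_⟩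
  · rw [h.Sig_eq]
    ext q
    simp
  · exact (isClosed_eq ((contDiff_amb_b (k := 0)).continuous.comp h.model.emb.continuous)
      continuous_const).inter (isClosed_eq ((contDiff_amb_F (k := 0) j).continuous.comp
        h.model.emb.continuous) continuous_const)
  · rw [h.M_eq]
    exact fun q hq => hq.1
  · intro p hp
    obtain ⟨e, B, b, he, κ, h1, -⟩ := h.exists_chart (p := p) (by rw [h.M_eq]; exact hp.1)
    refine ⟨e, B, b, he, κ j, (h1 j hp.2).1, ?_⟩
    have hM := he.2.2.2.2
    rw [h.M_eq] at hM
    ext q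
    have h2 := Set.ext_iff.1 hM q
    simp only [mem_inter_iff, mem_ofPred_eq] at h2 ⊢
    constructor
    · rintro ⟨⟨h3, h4⟩, h5⟩
      exact ⟨h5, (h2.1 ⟨h3, h5⟩).2, ((h1 j hp.2).2 q h5).1 h4⟩
    · rintro ⟨h3, h4, h5⟩
      exact ⟨⟨(h2.2 ⟨h3, h4⟩).1, ((h1 j hp.2).2 q h3).2 h5⟩, h3⟩
  · intro p hp
    obtain ⟨e, B, b, he, κ, h1, h1'⟩ := h.exists_chart hp
    classical
    refine ⟨e, B, b, he, (Finset.univ.filter fun j => (ι p).F j = 0).image κ, ?_, ?_⟩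
    · simp only [Finset.mem_image, Finset.mem_filter, Finset.mem_univ, true_and, not_exists, not_and]
      exact fun j hj => (h1 j hj).1
    · have hM := he.2.2.2.2
      rw [h.M_eq] at hM
      rw [h.Sig_eq]
      ext q
      have h2 := Set.ext_iff.1 hM q
      simp only [mem_inter_iff, mem_ofPred_eq, Finset.prod_eq_zero_iff, Finset.mem_image,
        Finset.mem_filter, Finset.mem_univ, true_and] at h2 ⊢
      constructor
      · rintro ⟨⟨h3, j, h4⟩, h5⟩
        have h6 : (ι p).F j = 0 := by
          by_contra h7
          exact h1' j h7 q h5 h4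
        exact ⟨h5, (h2.1 ⟨h3, h5⟩).2, κ j, ⟨j, h6, rfl⟩, ((h1 j h6).2 q h5).1 h4⟩
      · rintro ⟨h3, h4, _, ⟨j, h6, rfl⟩, h5⟩
        exact ⟨⟨(h2.2 ⟨h3, h4⟩).1, j, ((h1 j h6).2 q h3).2 h5⟩, h3⟩

theorem IsStageModel.Sig_eq_empty (h : IsStageModel D T X ι) (hT : ∀ j, {j} ∈ T) : X.Sig = ∅ := by
  rw [h.Sig_eq]
  refine eq_empty_of_forall_notMem ?_
  rintro q ⟨h1, j, h2⟩
  obtain ⟨i, hi, hne⟩ := h.stage.separated (ι q) (mem_range_self q) _ (hT j) h1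
  rw [Finset.mem_singleton.1 hi] at hne
  exact hne h2

theorem IsStage.isCornerSet {A : Set (Amb n c V)} (h : IsStage D T A) : IsCornerSet (n + 1) A := by
  intro w hw
  obtain ⟨e, B, he, hs, -⟩ := h.chart w hw
  exact ⟨e, B, he, hs⟩

/-- The blowing-up of a stage. -/
theorem IsStageModel.exists_blowup (h : IsStageModel D T X ι) (hJT : J ∉ T) (hJne : J.Nonempty)
    (hJ : ∀ j ∉ J, insert j J ∈ T) :
    ∃ (Y : RegSpace (n + 1)) (ι' : Y.carrier → Amb n c V) (φ : Y.carrier → X.carrier)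
      (C : Set X.carrier), IsStageModel D (insert J T) Y ι' ∧ IsRegBlowup X Y φ C ∧ C ⊆ X.Sig ∧
        ∀ q, (ι (φ q)).proj = (ι' q).proj := by
  have hst := h.stage.blow hJT hJ
  have hpre := h.stage.isPreStage hJT
  set A := range ι with hA
  set M' : Set (Amb n c V) := {w | w.b = 0}
  set S' : Set (Amb n c V) := {w | w.b = 0 ∧ ∃ j, w.F j = 0}
  set Y := hst.isCornerSet.space M' S' with hY
  set ι' : Y.carrier → Amb n c V := (Subtype.val : blow D J A → Amb n c V) with hι'
  have hmod : IsModel Y ι' := hst.isCornerSet.isModel M' S'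
  have hι'mem : ∀ q, ι' q ∈ blow D J A := fun q => Subtype.property (p := fun w => w ∈ blow D J A) q
  have hrange : range ι' = blow D J A := Subtype.range_coe
  have hex : ∀ q : Y.carrier, ∃ p, ι p = blowMap J (ι' q) := fun q => (hι'mem q).2.2.2.2
  choose φ hφ using hex
  set C : Set X.carrier := ι ⁻¹' center J with hC
  have hCr : ∀ q, φ q ∈ C ↔ (ι' q).r J = 0 := by
    intro q
    rw [hC, mem_preimage, hφ]
    exact blowMap_mem_center_iff (hι'mem q)
  have hcont : ContMDiff (Corner (n + 1)) (Corner (n + 1)) ∞ φ := by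
    rw [← contMDiffOn_univ]
    refine h.model.contMDiffOn_of_comp ?_
    refine (hmod.contMDiffOn_comp (contDiff_blowMap J).contDiffOn (mapsTo_univ _ _)).congr ?_
    exact fun q _ => hφ q
  have hφb : ∀ q, (ι (φ q)).b = (ι' q).r J * (ι' q).b := fun q => by rw [hφ]; rfl
  have hφF : ∀ q j, (ι (φ q)).F j = if j ∈ J then (ι' q).r J • (ι' q).F j else (ι' q).F j :=
    fun q j => by rw [hφ]; rfl
  have hYmodel : IsStageModel D (insert J T) Y ι' := ⟨hmod, hrange ▸ hst, rfl, rfl⟩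
  have hclos : ∀ q : Y.carrier, ∀ S : Set (Amb n c V), ι' q ∈ closure (S ∩ blow D J A) →
      q ∈ closure (ι' ⁻¹' S) := by
    intro q S hq
    rw [hmod.emb.isInducing.closure_eq_preimage_closure_image, image_preimage_eq_inter_range, hrange]
    exact hq
  refine ⟨Y, ι', φ, C, hYmodel, ⟨⟨hcont, ?_, ?_, ?_⟩, ?_, ?_⟩, ?_, fun q => ?_⟩
  · have h1 : IsClosed (center J : Set (Amb n c V)) := by
      have : (center J : Set (Amb n c V)) = radSq J ⁻¹' {0} := by
        ext w; exact radSq_eq_zero.symm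
      rw [this]
      exact isClosed_singleton.preimage (contDiff_radSq (k := 0) J).continuous
    exact h1.preimage h.model.emb.continuous
  · have hne : ∀ p ∈ Cᶜ, radSq J (ι p) ≠ 0 := fun p hp h0 => hp (radSq_eq_zero.1 h0)
    have hinv : ∀ p ∈ Cᶜ, blowInv J (ι p) ∈ blow D J A :=
      fun p hp => blowInv_mem hpre (mem_range_self p) (hne p hp)
    -- The inverse map needs a default value on `C`, supplied by a point outside `C`. If `C` is
    -- everything, the condition is vacuous as soon as there is a map at all; a nonempty `X` has
    -- points with `b > 0`, which are not in `C`.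
    by_cases hCne : ∃ p, p ∈ Cᶜ
    · obtain ⟨p₀, hp₀⟩ := hCne
      have hex' : ∀ p, ∃ q : Y.carrier, p ∈ Cᶜ → ι' q = blowInv J (ι p) := by
        intro p
        by_cases hp : p ∈ Cᶜ
        · exact ⟨(⟨blowInv J (ι p), hinv p hp⟩ : blow D J A), fun _ => rfl⟩
        · exact ⟨(⟨blowInv J (ι p₀), hinv p₀ hp₀⟩ : blow D J A), fun h => (hp h).elim⟩
      choose ψ hψι using hex'
      refine ⟨ψ, ?_, ?_, ?_⟩
      · refine hmod.contMDiffOn_of_comp ?_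
        refine (h.model.contMDiffOn_comp (contDiffOn_blowInv J) hne).congr hψι
      · intro q hq
        have hr : (ι' q).r J ≠ 0 := fun h0 => hq ((hCr q).2 h0)
        refine hmod.emb.injective ?_
        rw [hψι _ hq, hφ, blowInv_blowMap (hι'mem q) hr]
      · intro p hp
        refine h.model.emb.injective ?_
        rw [hφ, hψι p hp, blowMap_blowInv (hpre _ (mem_range_self p)).2.2 (hne p hp)]
    · have hCuniv : Cᶜ = ∅ := by
        by_contra hne'
        exact hCne (nonempty_iff_ne_empty.2 hne')
      by_cases hY' : Nonempty Y.carrier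
      · obtain ⟨y₀⟩ := hY'
        refine ⟨fun _ => y₀, ?_, ?_⟩
        · rw [hCuniv]; exact fun x hx => hx.elim
        · rw [hCuniv]; exact ⟨fun x hx => hx.elim, fun x hx => hx.elim⟩
      · by_cases hX' : Nonempty X.carrier
        · obtain ⟨x₀⟩ := hX'
          exfalso
          have hcl := h.stage.dense (ι x₀) (mem_range_self x₀)
          obtain ⟨w, ⟨x, rfl⟩, hb, -⟩ := closure_nonempty_iff.1 ⟨_, hcl⟩
          have : x ∈ Cᶜ := fun hx => hb.ne' hx.1
          rw [hCuniv] at this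
          exact this
        · exact ⟨fun x => (hX' ⟨x⟩).elim, fun x => (hX' ⟨x⟩).elim,
            fun x => (hY' ⟨x⟩).elim, fun x => (hX' ⟨x⟩).elim⟩
  -- The center has the equation `b = 0` besides one equation for each element of `J`.
  · refine ⟨J.card + 1, Nat.le_add_left 1 _, fun p hp => ?_⟩
    have : Nonempty X.carrier := ⟨p⟩
    obtain ⟨e, B, he, hs, had⟩ := h.stage.chart (ι p) (mem_range_self p)
    obtain ⟨ib, v, κ, U, had⟩ := had hp.1
    have hJK : ∀ j ∈ J, j ∈ {j | (ι p).F j = 0} := hp.2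
    refine ⟨h.model.pull e, B, centerIdx J ib κ, h.model.isCornerChart he, ?_, had.card_centerIdx hJK,
      ?_, ?_⟩
    · rw [h.model.pull_source]; exact hs
    · ext q
      rw [h.model.pull_source]
      simp only [mem_inter_iff, mem_ofPred_eq]
      rw [and_comm]
      refine and_congr_right fun hq => ?_
      rw [h.model.pull_apply]
      simp only [centerIdx, Finset.mem_insert, Finset.mem_image, forall_eq_or_imp,
        forall_exists_index, and_imp, forall_apply_eq_imp_iff₂]
      change ((ι q).b = 0 ∧ ∀ j ∈ J, (ι q).F j = 0) ↔ _
      rw [had.b_eq _ hq]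
      refine and_congr (by simp [(had.v_pos _ hq).ne']) (forall₂_congr fun j hj => ?_)
      rw [had.F_eq j (hJK j hj) _ hq]
      simp [had.U_ne j (hJK j hj) _ hq]
    · obtain ⟨w₀, hw₀⟩ : Nonempty (blow D J A) := by
        obtain ⟨w, ⟨x, rfl⟩, hb, -⟩ :=
          closure_nonempty_iff.1 ⟨_, h.stage.dense (ι p) (mem_range_self p)⟩
        exact ⟨⟨_, blowInv_mem hpre (mem_range_self x) fun h0 => hb.ne' (radSq_eq_zero.1 h0).1⟩⟩
      have : Nonempty Y.carrier := ⟨(⟨w₀, hw₀⟩ : blow D J A)⟩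
      set θ := blowPolar hpre he.source_subset had hJK
      have hθ : θ.source ⊆ range ι' := by rw [hrange]; exact fun w hw => hw.1
      refine ⟨hmod.pull θ, ?_, ?_, hmod.contMDiffOn_pull (contDiffOn_blowPolar hpre he had hJK),
        hmod.contMDiffOn_pull_symm hθ (contDiffOn_blowPolar_symm hpre he had hJK), fun q hq => ?_⟩
      · rw [hmod.pull_source, h.model.pull_source]
        ext q
        simp only [mem_preimage, hφ]
        exact ⟨fun hq => hq.2, fun hq => ⟨hι'mem q, hq⟩⟩
      · rw [hmod.pull_target hθ, h.model.pull_target he.source_subset]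
        rfl
      · rw [hmod.pull_source] at hq
        rw [h.model.pull_apply, hmod.pull_apply, hφ]
        exact (had.polar_toPolar hJK hq.1 hq.2).symm
  -- Since `b ∘ φ = r J * b`, the preimage of the initial manifold minus the center is `{b = 0, r J
  -- ≠ 0}`, whose closure contains all points with `b = 0` by `mem_closure_off_center`.
  · refine subset_antisymm (fun q hq => ?_) (closure_minimal (fun q hq => ?_) hYmodel.isClosed_M)
    · have hb : (ι' q).b = 0 := hq
      have h1 : φ ⁻¹' (X.M \ C) = ι' ⁻¹' {w | w.r J ≠ 0 ∧ w.b = 0} := by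
        ext q'
        rw [mem_preimage, Set.mem_sdiff, hCr, h.M_eq, mem_ofPred_eq, hφb]
        change _ ↔ (ι' q').r J ≠ 0 ∧ (ι' q').b = 0
        constructor
        · rintro ⟨h2, h3⟩
          exact ⟨h3, (mul_eq_zero.1 h2).resolve_left h3⟩
        · rintro ⟨h2, h3⟩
          exact ⟨by rw [h3, mul_zero], h2⟩
      rw [h1]
      refine hclos q _ ?_
      by_cases hr : (ι' q).r J = 0
      · refine closure_mono ?_ (h.stage.mem_closure_off_center hJT hJ (hι'mem q) hr)
        exact fun w hw => ⟨⟨hw.2.1, (hw.2.2 hb).1⟩, hw.1⟩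
      · exact subset_closure ⟨⟨hr, hb⟩, hι'mem q⟩
    · obtain ⟨h1, h2⟩ := hq
      rw [hCr] at h2
      rw [h.M_eq, mem_ofPred_eq, hφb] at h1
      exact (mul_eq_zero.1 h1).resolve_left h2
  · have hSigc : IsClosed Y.Sig := by
      obtain ⟨c', S, hS, hS'⟩ := hYmodel.isRegularized.2.1
      rw [hS]
      exact isClosed_iUnion_of_finite fun j => (hS' j).1
    have h1 : φ ⁻¹' (X.Sig \ C) = ι' ⁻¹' {w | w.r J ≠ 0 ∧ w.b = 0 ∧ ∃ j, w.F j = 0} := by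
      ext q'
      rw [mem_preimage, Set.mem_sdiff, hCr, h.Sig_eq, mem_ofPred_eq, hφb]
      change _ ↔ (ι' q').r J ≠ 0 ∧ (ι' q').b = 0 ∧ ∃ j, (ι' q').F j = 0
      constructor
      · rintro ⟨⟨h2, j, h4⟩, h3⟩
        refine ⟨h3, (mul_eq_zero.1 h2).resolve_left h3, j, ?_⟩
        rw [hφF] at h4
        by_cases hj : j ∈ J
        · rw [if_pos hj] at h4
          exact (smul_eq_zero.1 h4).resolve_left h3
        · rwa [if_neg hj] at h4
      · rintro ⟨h2, h3, j, h4⟩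
        refine ⟨⟨by rw [h3, mul_zero], j, ?_⟩, h2⟩
        rw [hφF, h4]
        simp
    rw [h1]
    refine subset_antisymm (fun q hq => ?_) (closure_minimal (fun q hq => ?_) hSigc)
    · obtain ⟨hb, j, hF⟩ : (ι' q).b = 0 ∧ ∃ j, (ι' q).F j = 0 := hq
      refine hclos q _ ?_
      by_cases hr : (ι' q).r J = 0
      · refine closure_mono ?_ (h.stage.mem_closure_off_center hJT hJ (hι'mem q) hr)
        exact fun w hw => ⟨⟨hw.2.1, (hw.2.2 hb).1, j, (hw.2.2 hb).2 j hF⟩, hw.1⟩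
      · exact subset_closure ⟨⟨hr, hb, j, hF⟩, hι'mem q⟩
    · exact hq.2
  · rw [h.Sig_eq]
    obtain ⟨j, hj⟩ := hJne
    exact fun q hq => ⟨hq.1, j, hq.2 j hj⟩
  · rw [hφ, proj_blowMap]

end StageModel

end

/-! ### The initial stage. -/

section

variable {n c : ℕ} {V : Type} [NormedAddCommGroup V] [InnerProductSpace ℝ V] {M Sig : Set (E n)}

section Initial

theorem contDiff_expChart : ContDiff ℝ ∞ (expChart n) := by
  refine contDiff_euclidean.2 fun i => ?_
  refine Fin.cases ?_ (fun j => ?_) i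
  · simpa [expChart] using contDiff_snd
  · have : ContDiff ℝ ∞ fun q : E n × ℝ => q.1 j := (contDiff_coord j).comp contDiff_fst
    simpa [expChart] using this.exp

theorem contDiffOn_expChart_symm : ContDiffOn ℝ ∞ (expChart n).symm (expChart n).target := by
  refine ContDiffOn.prodMk (contDiffOn_euclidean.2 fun i => ?_) (contDiff_coord 0).contDiffOn
  exact (contDiff_coord (n := ∞) i.succ).contDiffOn.log fun y hy => (hy i).ne'

theorem contMDiff_cyl_val (hM : IsOpen M) :
    letI := cylChartedSpace hM
    ContMDiff (Corner (n + 1)) 𝓘(ℝ, E n × ℝ) ∞ (Subtype.val : Cyl M → E n × ℝ) := by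
  let := cylChartedSpace hM
  have := isManifold_cyl hM
  intro q
  rw [contMDiffAt_iff]
  refine ⟨continuous_subtype_val.continuousAt, ?_⟩
  have : Nonempty (Cyl M) := ⟨q⟩
  set f := (isOpenEmbedding_cylChart hM).toOpenPartialHomeomorph (cylChart M) with hf
  have hc : extChartAt (Corner (n + 1)) q = f.extend (Corner (n + 1)) := rfl
  simp only [extChartAt_model_space_eq_id, PartialEquiv.refl_coe, Function.id_comp]
  have hval : extChartAt (Corner (n + 1)) q q = expChart n q.1 := rfl
  have hmem : expChart n q.1 ∈ (expChart n).target := (expChart n).map_source (mem_univ _)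
  rw [hval]
  have h1 := (contDiffOn_expChart_symm (n := n)).contDiffAt ((expChart n).open_target.mem_nhds hmem)
  refine h1.contDiffWithinAt.congr_of_eventuallyEq_of_mem ?_ ⟨cylChart M q, rfl⟩
  have h2 : f.target ∈ 𝓝 (cylChart M q) := f.open_target.mem_nhds (f.map_source (mem_univ q))
  have h3 := (Corner (n + 1)).image_mem_nhdsWithin h2
  refine mem_of_superset h3 ?_
  rintro _ ⟨y, hy, rfl⟩
  change (Subtype.val ∘ (extChartAt (Corner (n + 1)) q).symm) (Corner (n + 1) y) =
    (expChart n).symm (Corner (n + 1) y)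
  rw [hc]
  simp only [OpenPartialHomeomorph.extend_coe_symm, Function.comp]
  have h5 : (Corner (n + 1)).symm ((Corner (n + 1)) y) = y := (Corner (n + 1)).left_inv y
  rw [h5]
  have h6 := f.right_inv hy
  have h7 : (Corner (n + 1)) y = expChart n (f.symm y).1 := by
    nth_rw 1 [← h6]; rfl
  rw [h7]
  exact ((expChart n).left_inv (mem_univ _)).symm

/-- The embedding of `M × ℝ_{≥0}` in the ambient space. -/
def cylEmb (D : BranchData M Sig c V) (q : E n × ℝ) : Amb n c V :=
  (q.1, q.2, fun j => D.F j q.1, fun _ => 1)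

theorem contDiffOn_cylEmb (D : BranchData M Sig c V) :
    ContDiffOn ℝ ∞ (cylEmb D) {q | q.1 ∈ M} :=
  contDiffOn_amb contDiffOn_fst contDiffOn_snd
    (fun j => (D.smooth j).comp contDiffOn_fst fun _ hq => hq) fun _ => contDiffOn_const

theorem contMDiff_cylEmb (D : BranchData M Sig c V) (hM : IsOpen M) :
    letI := cylChartedSpace hM
    ContMDiff (Corner (n + 1)) 𝓘(ℝ, Amb n c V) ∞ (fun q : Cyl M => cylEmb D q.1) := by
  let := cylChartedSpace hM
  exact (contDiffOn_cylEmb D).contMDiffOn.comp_contMDiff (contMDiff_cyl_val hM) fun q => q.2.1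

/-- The image is a graph over `M × ℝ_{≥0}`: the coordinates `x` and `b` recover the point and hence
its chart. -/
theorem isModel_initialSpace (D : BranchData M Sig c V) (hM : IsOpen M) :
    IsModel (initialSpace M Sig hM) (fun q : Cyl M => cylEmb D q.1) := by
  have hc : Continuous fun q : Cyl M => cylEmb D q.1 :=
    (contDiffOn_cylEmb D).continuousOn.comp_continuous continuous_subtype_val fun q => q.2.1
  refine ⟨?_, contMDiff_cylEmb D hM, fun p => ?_⟩
  · refine IsEmbedding.of_comp (g := fun w : Amb n c V => (w.x, w.b)) hc
      (((contDiff_amb_x (k := 0)).continuous).prodMk (contDiff_amb_b (k := 0)).continuous) ?_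
    exact IsEmbedding.subtypeVal (p := fun q : E n × ℝ => q.1 ∈ M ∧ 0 ≤ q.2)
  · refine ⟨univ, isOpen_univ, mem_univ _, fun w => expChart n (w.x, w.b), ?_, fun q _ => rfl⟩
    exact (contDiff_expChart.comp (contDiff_amb_x.prodMk contDiff_amb_b)).contDiffOn

/-- The last coordinates. -/
def tailVec (y : E (n + 1)) : E n := WithLp.toLp 2 fun i => y i.succ

theorem contDiff_tailVec : ContDiff ℝ ∞ (tailVec (n := n)) :=
  contDiff_euclidean.2 fun i => contDiff_coord i.succ

/-- The chart of `M × ℝ_{≥0}` given by a chart of `M`. -/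
def cylSubChart (D : BranchData M Sig c V) (e : OpenPartialHomeomorph (E n) (E n))
    (he : e.source ⊆ M) : PartialEquiv (Amb n c V) (E (n + 1)) where
  toFun w := WithLp.toLp 2 (Fin.cons w.b (e w.x).ofLp)
  invFun y := cylEmb D (e.symm (tailVec y), y 0)
  source := {w | w ∈ range (fun q : Cyl M => cylEmb D q.1) ∧ w.x ∈ e.source}
  target := {y | tailVec y ∈ e.target ∧ 0 ≤ y 0}
  map_source' := by
    rintro _ ⟨⟨q, rfl⟩, hq⟩
    refine ⟨?_, ?_⟩
    · have : tailVec (WithLp.toLp 2 (Fin.cons (cylEmb D q.1).b (e (cylEmb D q.1).x).ofLp)) =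
          e (cylEmb D q.1).x := by ext i; simp [tailVec]
      rw [this]
      exact e.map_source hq
    · exact q.2.2
  map_target' y hy := by
    have h1 := e.map_target hy.1
    exact ⟨⟨⟨(e.symm (tailVec y), y 0), he h1, hy.2⟩, rfl⟩, h1⟩
  left_inv' := by
    rintro _ ⟨⟨q, rfl⟩, hq⟩
    have : tailVec (WithLp.toLp 2 (Fin.cons (cylEmb D q.1).b (e (cylEmb D q.1).x).ofLp)) =
        e (cylEmb D q.1).x := by ext i; simp [tailVec]
    rw [this, e.left_inv hq]
    rfl
  right_inv' y hy := by
    ext i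
    refine Fin.cases ?_ (fun j => ?_) i
    · simp [cylEmb]
    · simp only [cylEmb, Amb.x_mk, Fin.cons_succ, e.right_inv hy.1]
      simp [tailVec]

theorem isStage_initial (D : BranchData M Sig c V) (hM : IsOpen M) :
    IsStage D ∅ (range fun q : Cyl M => cylEmb D q.1) := by
  have hcE : ∀ q : Cyl M, ContinuousAt (cylEmb D) q.1 := fun q =>
    (contDiffOn_cylEmb D).continuousOn.continuousAt ((hM.preimage continuous_fst).mem_nhds q.2.1)
  refine ⟨?_, ?_, ?_, ?_, ?_, ?_, ?_, ?_, ?_, ?_, ?_⟩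
  · rintro _ ⟨q, rfl⟩; exact q.2.1
  · rintro _ ⟨q, rfl⟩; exact q.2.2
  · rintro _ ⟨q, rfl⟩ J; simp [cylEmb]
  · rintro _ ⟨q, rfl⟩ j; exact D.mem_L j _ q.2.1
  · rintro _ ⟨q, rfl⟩ j; simp [cylEmb]
  · rintro _ ⟨q, rfl⟩ J _; simp [cylEmb]
  · rintro _ ⟨q, rfl⟩ J hJ; simp at hJ
  · rintro _ ⟨q, rfl⟩ j _; simp [cylEmb]
  · rintro _ ⟨q, rfl⟩
    obtain ⟨e, ⟨hs, hp, h0, h1, h2⟩, κ, hκ, -, hU⟩ := D.chart q.1.1 q.2.1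
    have hc : ∀ {G : Type} [NormedAddCommGroup G] [NormedSpace ℝ G] {f : E n → G},
        ContDiffOn ℝ ∞ f e.source → ContDiffOn ℝ ∞ (fun w : Amb n c V => f w.x)
          (cylSubChart D e hs).source :=
      fun hf => hf.comp contDiff_amb_x.contDiffOn fun w hw => hw.2
    refine ⟨cylSubChart D e hs, {0}, ⟨?_, ?_, ?_, ?_⟩, ⟨⟨q, rfl⟩, hp⟩, fun hb => ?_⟩
    · exact ⟨Amb.x ⁻¹' e.source, e.open_source.preimage (contDiff_amb_x (k := 0)).continuous, rfl⟩
    · refine ⟨tailVec ⁻¹' e.target, e.open_target.preimage contDiff_tailVec.continuous, ?_⟩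
      ext y
      simp [cylSubChart, quad]
    · refine contDiffOn_euclidean.2 fun i => ?_
      refine Fin.cases ?_ (fun j => ?_) i
      · exact contDiff_amb_b.contDiffOn
      · exact contDiffOn_euclidean.1 (hc h1) j
    · refine (contDiffOn_cylEmb D).comp (ContDiffOn.prodMk ?_ (contDiff_coord 0).contDiffOn) ?_
      · exact h2.comp contDiff_tailVec.contDiffOn fun y hy => hy.1
      · exact fun y hy => hs (e.map_target hy.1)
    · have hU' : ∀ j, ∃ U : E n → V, D.F j q.1.1 = 0 → ContDiffOn ℝ ∞ U e.source ∧
          ∀ x ∈ e.source, U x ≠ 0 ∧ D.F j x = e x (κ j) • U x ∧ D.L j x = Submodule.span ℝ {U x} := by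
        intro j
        by_cases hj : D.F j q.1.1 = 0
        · obtain ⟨U, h⟩ := hU j hj
          exact ⟨U, fun _ => h⟩
        · exact ⟨0, fun h => (hj h).elim⟩
      choose U hU using hU'
      refine ⟨0, fun _ => 1, fun j => (κ j).succ, fun j w => U j w.x, by simp, contDiffOn_const,
        fun _ _ => one_pos, fun w hw => ?_, fun j _ => by simp [Fin.succ_ne_zero], ?_, ?_, ?_, ?_, ?_⟩
      · simp [cylSubChart]
      · exact fun i hi j hj hij => hκ hi hj (Fin.succ_injective _ hij)
      · exact fun j hj => hc (hU j hj).1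
      · exact fun j hj w hw => ((hU j hj).2 _ hw.2).1
      · rintro j hj _ ⟨⟨q', rfl⟩, hq'⟩
        exact ((hU j hj).2 _ hq').2.1
      · exact fun j hj w hw => ((hU j hj).2 _ hw.2).2.2
  · rintro _ ⟨q, rfl⟩
    have h1 : Tendsto (fun t : ℝ => (q.1.1, q.1.2 + t)) (𝓝[>] 0) (𝓝 q.1) := by
      have h2 : Continuous fun t : ℝ => (q.1.1, q.1.2 + t) := by fun_prop
      exact (h2.tendsto' 0 q.1 (by simp)).mono_left nhdsWithin_le_nhds
    refine mem_closure_of_tendsto ((hcE q).tendsto.comp h1) ?_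
    filter_upwards [self_mem_nhdsWithin] with t ht
    have h3 : 0 < q.1.2 + t := add_pos_of_nonneg_of_pos q.2.2 ht
    exact ⟨⟨⟨(q.1.1, q.1.2 + t), q.2.1, h3.le⟩, rfl⟩, h3, fun _ => one_pos⟩
  · rintro _ ⟨q, rfl⟩ hb
    have hb' : q.1.2 = 0 := hb
    obtain ⟨e, ⟨hs, hp, h0, h1, h2⟩, κ, hκ, hne, hU⟩ := D.chart q.1.1 q.2.1
    -- The diagonal leaves all coordinate hyperplanes simultaneously.
    set g : ℝ → E n := fun t => WithLp.toLp 2 fun _ => t with hg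
    have hgc : Continuous g := (PiLp.continuous_toLp 2 _).comp (continuous_pi fun _ => continuous_id)
    have hg0 : g 0 = e q.1.1 := by rw [h0]; ext; simp [hg]
    have h3 : Tendsto g (𝓝[>] 0) (𝓝 (e q.1.1)) :=
      (hgc.tendsto' 0 _ hg0).mono_left nhdsWithin_le_nhds
    have h4 : ∀ᶠ t in 𝓝[>] (0 : ℝ), g t ∈ e.target :=
      h3.eventually (e.open_target.mem_nhds (e.map_source hp))
    have h5 : Tendsto (fun t => e.symm (g t)) (𝓝[>] 0) (𝓝 q.1.1) := by
      have := (e.continuousAt_symm (e.map_source hp)).tendsto.comp h3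
      rwa [e.left_inv hp] at this
    have h6 : Tendsto (fun t => (e.symm (g t), (0 : ℝ))) (𝓝[>] 0) (𝓝 q.1) := by
      have h8 := h5.prodMk_nhds (tendsto_const_nhds (x := (0 : ℝ)))
      have h9 : (q.1.1, (0 : ℝ)) = q.1 := Prod.ext rfl hb'.symm
      exact h9 ▸ h8
    refine mem_closure_of_tendsto ((hcE q).tendsto.comp h6) ?_
    filter_upwards [h4, self_mem_nhdsWithin] with t ht ht'
    have h7 := e.map_target ht
    refine ⟨⟨⟨(e.symm (g t), 0), hs h7, le_rfl⟩, rfl⟩, rfl, fun _ => one_pos, fun j => ?_⟩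
    change D.F j (e.symm (g t)) ≠ 0
    by_cases hj : D.F j q.1.1 = 0
    · obtain ⟨U, -, hU⟩ := hU j hj
      obtain ⟨h8, h9, -⟩ := hU _ h7
      rw [h9, e.right_inv ht]
      exact smul_ne_zero (ne_of_gt ht') h8
    · exact hne j hj _ h7

theorem isStageModel_initial (D : BranchData M Sig c V) (hM : IsOpen M) :
    IsStageModel D ∅ (initialSpace M Sig hM) (fun q : Cyl M => cylEmb D q.1) := by
  refine ⟨isModel_initialSpace D hM, isStage_initial D hM, rfl, ?_⟩
  refine Set.ext fun q => ?_
  have h : q.1.1 ∈ Sig ↔ ∃ j, D.F j q.1.1 = 0 := by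
    rw [D.mem_Sig]
    exact and_iff_right q.2.1
  exact and_congr_right fun _ => h

end Initial

/-! ### The sequence of blowings-up. -/

section Sequence

/-- A regularized space obtained from `M × ℝ_{≥0}` by a sequence of blowings-up. -/
structure StageState (D : BranchData M Sig c V) where
  T : Finset (Finset (Fin c))
  X : RegSpace (n + 1)
  ι : X.carrier → Amb n c V
  model : IsStageModel D T X ι
  nonempty : ∀ J ∈ T, J.Nonempty

variable {D : BranchData M Sig c V}

/-- The nonempty sets of indices of branches. -/
def allIdx (c : ℕ) : Finset (Finset (Fin c)) := Finset.univ.filter fun J => J.Nonempty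

/-- The next `J` has maximal cardinality among the nonempty sets not yet treated, so every `insert j
J` has been treated. When no set is left the state is repeated, which permits the definition of an
infinite sequence of states. -/
theorem StageState.exists_next (s : StageState D) :
    ∃ (s' : StageState D) (φ : s'.X.carrier → s.X.carrier) (C : Set s.X.carrier),
      (∀ q, (s.ι (φ q)).proj = (s'.ι q).proj) ∧
      (s.T.card < (allIdx c).card →
        s'.T.card = s.T.card + 1 ∧ IsRegBlowup s.X s'.X φ C ∧ C ⊆ s.X.Sig) := by
  by_cases hlt : s.T.card < (allIdx c).card
  · obtain ⟨J₁, hJ₁, hJ₁'⟩ := Finset.exists_mem_notMem_of_card_lt_card hlt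
    obtain ⟨J, hJ, hmax⟩ := Finset.exists_max_image ((allIdx c) \ s.T) Finset.card
      ⟨J₁, Finset.mem_sdiff.2 ⟨hJ₁, hJ₁'⟩⟩
    obtain ⟨hJall, hJT⟩ := Finset.mem_sdiff.1 hJ
    have hJne : J.Nonempty := (Finset.mem_filter.1 hJall).2
    obtain ⟨Y, ι', φ, C, hY, hb, hC, hproj⟩ := s.model.exists_blowup hJT hJne (by
      intro j hj
      by_contra hcon
      have := hmax (insert j J) (Finset.mem_sdiff.2
        ⟨Finset.mem_filter.2 ⟨Finset.mem_univ _, Finset.insert_nonempty _ _⟩, hcon⟩)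
      rw [Finset.card_insert_of_notMem hj] at this
      omega)
    refine ⟨⟨insert J s.T, Y, ι', hY, fun J' hJ' => ?_⟩, φ, C, hproj, fun _ => ⟨?_, hb, hC⟩⟩
    · rcases Finset.mem_insert.1 hJ' with rfl | h
      · exact hJne
      · exact s.nonempty J' h
    · exact Finset.card_insert_of_notMem hJT
  · exact ⟨s, id, ∅, fun _ => rfl, fun h => (hlt h).elim⟩

/-- There is one blowing-up for each nonempty set of branches, and the cardinality of `T` counts
them. At the end `T` contains the singletons, so the discontinuity locus is empty by `Sig_eq_empty`.
-/
theorem exists_blowupSequence (D : BranchData M Sig c V) (hM : IsOpen M) :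
    ∃ b : BlowupSequence (initialSpace M Sig hM),
      (∀ k, ∃ T ι, IsStageModel D T (b.space k) ι ∧ ∀ q, b.proj k q = (ι q).proj) ∧
      (∀ k < b.r, b.center k ⊆ (b.space k).Sig) ∧ (b.space b.r).Sig = ∅ := by
  choose nx ph ce hproj hstep using StageState.exists_next (D := D)
  set s₀ : StageState D := ⟨∅, initialSpace M Sig hM, _, isStageModel_initial D hM, by simp⟩ with hs₀
  set st : ℕ → StageState D := fun k => Nat.rec s₀ (fun _ s => nx s) k with hst
  have hcard : ∀ k ≤ (allIdx c).card, (st k).T.card = k := by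
    intro k
    induction k with
    | zero => intro _; rfl
    | succ k ih =>
      intro hk
      have h1 := ih (by omega)
      have h2 := (hstep (st k) (by omega)).1
      rw [h1] at h2
      exact h2
  have hblow : ∀ k < (allIdx c).card,
      IsRegBlowup (st k).X (nx (st k)).X (ph (st k)) (ce (st k)) ∧ ce (st k) ⊆ (st k).X.Sig :=
    fun k hk => (hstep (st k) (by rw [hcard k hk.le]; exact hk)).2
  let b : BlowupSequence (initialSpace M Sig hM) :=
    { r := (allIdx c).card
      next := fun k => (st (k + 1)).X
      -- The index 0 is separate because `stage` is defined by cases.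
      φ := fun k => match k with
        | 0 => ph s₀
        | k + 1 => ph (st (k + 1))
      center := fun k => match k with
        | 0 => ce s₀
        | k + 1 => ce (st (k + 1))
      isBlowup := fun k hk => match k with
        | 0 => (hblow 0 hk).1
        | k + 1 => (hblow (k + 1) hk).1 }
  have hspace0 : ∀ q : (b.space 0).carrier, b.proj 0 q = (s₀.ι q).proj := by
    intro q
    change (Subtype.val (q : Cyl M) : E n × ℝ) = (cylEmb D (q : Cyl M).1).proj
    simp [Amb.proj, cylEmb]
  have hspace : ∀ k, ∀ q : (b.space (k + 1)).carrier, b.proj (k + 1) q = ((st (k + 1)).ι q).proj := by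
    intro k
    induction k with
    | zero =>
      intro q
      have h1 := hspace0 (ph s₀ q)
      exact h1.trans (hproj _ q)
    | succ k ih =>
      intro q
      have h1 := ih (ph (st (k + 1)) q)
      exact h1.trans (hproj _ q)
  have hfull : ∀ s : StageState D, s.T.card = (allIdx c).card → s.X.Sig = ∅ := by
    intro s hs
    refine s.model.Sig_eq_empty fun j => ?_
    have hsub : s.T ⊆ allIdx c := fun J hJ => Finset.mem_filter.2 ⟨Finset.mem_univ _, s.nonempty J hJ⟩
    rw [Finset.eq_of_subset_of_card_le hsub hs.ge]
    exact Finset.mem_filter.2 ⟨Finset.mem_univ _, Finset.singleton_nonempty j⟩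
  refine ⟨b, fun k => ?_, fun k hk => ?_, ?_⟩
  · cases k with
    | zero => exact ⟨s₀.T, s₀.ι, s₀.model, hspace0⟩
    | succ k => exact ⟨_, (st (k + 1)).ι, (st (k + 1)).model, hspace k⟩
  · cases k with
    | zero => exact (hblow 0 hk).2
    | succ k => exact (hblow (k + 1) hk).2
  · have h1 := hfull (st (allIdx c).card) (hcard _ le_rfl)
    have h2 : ∀ k, (b.space k).Sig = ∅ ↔ (st k).X.Sig = ∅ := by
      intro k
      cases k <;> exact Iff.rfl
    exact (h2 _).2 h1

end Sequence

end

/-! ### Smooth dependence of integrals on parameters. -/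

section

section ParametricIntegral

variable {P G F : Type*} [NormedAddCommGroup P] [NormedSpace ℝ P] [NormedAddCommGroup G]
  [NormedSpace ℝ G] [NormedAddCommGroup F] [NormedSpace ℝ F]

theorem contDiffOn_smul_of_tsupport_subset {χ : G → ℝ} (hχ : ContDiff ℝ ∞ χ) {U : Set G}
    (hU : IsOpen U) (hχU : tsupport χ ⊆ U) {s : Set P} (hs : IsOpen s) {g : P × G → F}
    (hg : ContDiffOn ℝ ∞ g (s ×ˢ U)) :
    ContDiffOn ℝ ∞ (fun q : P × G => χ q.2 • g q) (s ×ˢ univ) := by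
  rintro ⟨p, x⟩ ⟨hp, -⟩
  refine ContDiffAt.contDiffWithinAt ?_
  by_cases hx : x ∈ U
  · exact (hχ.comp contDiff_snd).contDiffAt.smul (hg.contDiffAt ((hs.prod hU).mem_nhds ⟨hp, hx⟩))
  · have h1 : (tsupport χ)ᶜ ∈ 𝓝 x :=
      (isClosed_tsupport χ).isOpen_compl.mem_nhds fun h => hx (hχU h)
    refine (contDiffAt_const (c := (0 : F))).congr_of_eventuallyEq ?_
    filter_upwards [continuous_snd.continuousAt.preimage_mem_nhds h1] with q hq
    simp [image_eq_zero_of_notMem_tsupport hq]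

variable [MeasurableSpace G] [BorelSpace G] {μ : Measure G}

/-- After the reflection of the variable, the integral is the value at 0 of a convolution with
parameters. The weight need only be locally integrable. -/
theorem contDiffOn_integral_smul {w : G → ℝ} (hw : LocallyIntegrable w μ) {s : Set P}
    (hs : IsOpen s) {k : Set G} (hk : IsCompact k) {g : P → G → F}
    (hgs : ∀ p, ∀ x, p ∈ s → x ∉ k → g p x = 0) (hg : ContDiffOn ℝ ∞ ↿g (s ×ˢ univ)) :
    ContDiffOn ℝ ∞ (fun p => ∫ t, w t • g p t ∂μ) s := by
  have h1 : ContDiffOn ℝ ∞ ↿(fun p x => g p (-x)) (s ×ˢ univ) := by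
    refine hg.comp (f := fun q : P × G => (q.1, -q.2)) ?_ fun q hq => ⟨hq.1, mem_univ _⟩
    exact (contDiff_fst.prodMk contDiff_snd.neg).contDiffOn
  have h2 := contDiffOn_convolution_right_with_param (ContinuousLinearMap.lsmul ℝ ℝ) hs
    (hk.neg) (g := fun p x => g p (-x)) (fun p x hp hx => hgs p _ hp (by simpa using hx)) hw h1
  refine (h2.comp (f := fun p => (p, (0 : G))) (contDiff_id.prodMk contDiff_const).contDiffOn
    fun p hp => ⟨hp, mem_univ _⟩).congr fun p _ => ?_
  simp [convolution]

/-- The interval enters as a weight, its indicator function. A bump function equal to 1 on the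
interval makes the integrand globally smooth without changing the integral. -/
theorem contDiffOn_intervalIntegral {s : Set P} (hs : IsOpen s) {g : P × ℝ → F}
    (hg : ContDiffOn ℝ ∞ g (s ×ˢ Metric.ball (1 / 2) 1)) :
    ContDiffOn ℝ ∞ (fun p => ∫ u in (0 : ℝ)..1, g (p, u)) s := by
  let χ : ContDiffBump (1 / 2 : ℝ) := ⟨1 / 2, 3 / 4, by norm_num, by norm_num⟩
  have h1 : tsupport χ ⊆ Metric.ball (1 / 2) 1 := by
    rw [χ.tsupport_eq]
    exact Metric.closedBall_subset_ball (by norm_num [χ])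
  have h2 := contDiffOn_smul_of_tsupport_subset χ.contDiff Metric.isOpen_ball h1 hs hg
  have hw : LocallyIntegrable ((Ioc (0 : ℝ) 1).indicator (fun _ => (1 : ℝ))) volume :=
    ((integrable_indicator_iff measurableSet_Ioc).2 (by simp)).locallyIntegrable
  refine (contDiffOn_integral_smul hw hs χ.hasCompactSupport
    (g := fun p u => χ u • g (p, u)) (fun p u _ hu => ?_) h2).congr fun p _ => ?_
  · simp [image_eq_zero_of_notMem_tsupport hu]
  · rw [intervalIntegral.integral_of_le zero_le_one, ← integral_indicator measurableSet_Ioc]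
    refine integral_congr_ae (Eventually.of_forall fun u => ?_)
    by_cases hu : u ∈ Ioc (0 : ℝ) 1
    · have : χ u = 1 := χ.one_of_mem_closedBall (by
        rw [Real.closedBall_eq_Icc]
        exact ⟨by simpa [χ] using hu.1.le, by norm_num [χ]; exact hu.2⟩)
      simp [hu, this]
    · simp [hu]

end ParametricIntegral

section Det

variable {n : ℕ}

theorem contDiff_clm_det {k : WithTop ℕ∞} : ContDiff ℝ k (fun L : E n →L[ℝ] E n => L.det) := by
  have h1 : ∀ L : E n →L[ℝ] E n, L.det =
      (LinearMap.toMatrix (EuclideanSpace.basisFun (Fin n) ℝ).toBasis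
        (EuclideanSpace.basisFun (Fin n) ℝ).toBasis (L : E n →ₗ[ℝ] E n)).det := fun L => by
    rw [LinearMap.det_toMatrix]
  simp only [h1, Matrix.det_apply]
  refine ContDiff.sum fun σ _ => ContDiff.const_smul _ (contDiff_prod fun i _ => ?_)
  simp only [LinearMap.toMatrix_apply]
  have h2 : ∀ a, ContDiff ℝ k fun L : E n →L[ℝ] E n => L (EuclideanSpace.basisFun (Fin n) ℝ a) :=
    fun a => contDiff_id.clm_apply contDiff_const
  exact (contDiff_coord (σ i)).comp (h2 i)

theorem volume_coord_eq_zero (i : Fin n) : volume {y : E n | y i = 0} = 0 := by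
  have h := Measure.addHaar_submodule (volume : Measure (E n))
    (LinearMap.ker (EuclideanSpace.proj i : E n →L[ℝ] ℝ).toLinearMap) ?_
  · refine (congrArg volume ?_).trans h
    ext y; simp
  · intro h
    have h1 : EuclideanSpace.single i (1 : ℝ) ∈
      LinearMap.ker (EuclideanSpace.proj i : E n →L[ℝ] ℝ).toLinearMap := by rw [h]; trivial
    simp at h1

end Det

end

/-! ### Pieces of a piecewise smooth function; the regularization for positive `ε`. -/

section

variable {n : ℕ} {M Sig : Set (E n)} {f m : E n → ℝ}

section Pieces

variable {p : E n} {e : OpenPartialHomeomorph (E n) (E n)} {I : Finset (Fin n)}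

/-- The points of a ball whose coordinates of index in `I` have the signs prescribed by `T`. -/
def orthant (I T : Finset (Fin n)) (ρ : ℝ) : Set (E n) :=
  {y ∈ Metric.ball (0 : E n) ρ | ∀ i ∈ I, y i ≠ 0 ∧ (0 < y i ↔ i ∈ T)}

theorem convex_orthant (I T : Finset (Fin n)) (ρ : ℝ) : Convex ℝ (orthant I T ρ) := by
  have h1 : orthant I T ρ = Metric.ball (0 : E n) ρ ∩
      ⋂ i : Fin n, {y : E n | i ∈ I → y i ≠ 0 ∧ (0 < y i ↔ i ∈ T)} := by
    ext y; simp [orthant]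
  rw [h1]
  refine (convex_ball _ _).inter (convex_iInter fun i => ?_)
  by_cases hi : i ∈ I
  · have hl : IsLinearMap ℝ fun y : E n => y i := ⟨fun _ _ => rfl, fun _ _ => rfl⟩
    by_cases hT : i ∈ T
    · have : {y : E n | i ∈ I → y i ≠ 0 ∧ (0 < y i ↔ i ∈ T)} = {y | 0 < y i} := by
        ext y; simp only [hi, hT, mem_ofPred_eq, forall_true_left, iff_true]
        exact ⟨fun h => h.2, fun h => ⟨h.ne', h⟩⟩
      rw [this]
      exact convex_halfSpace_gt hl 0
    · have : {y : E n | i ∈ I → y i ≠ 0 ∧ (0 < y i ↔ i ∈ T)} = {y | y i < 0} := by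
        ext y; simp only [hi, hT, mem_ofPred_eq, forall_true_left, iff_false, not_lt]
        exact ⟨fun h => h.2.lt_of_ne h.1, fun h => ⟨h.ne, h.le⟩⟩
      rw [this]
      exact convex_halfSpace_lt hl 0
  · simp [hi, convex_univ]

/-- An orthant is convex, hence connected, and it avoids the hyperplanes which form `Sig` in the
chart. -/
theorem image_orthant_subset (he : IsChartAt M p e)
    (hI : ∀ x ∈ e.source, x ∈ Sig ↔ ∃ i ∈ I, e x i = 0) {ρ : ℝ}
    (hρ : Metric.ball 0 ρ ⊆ e.target) {T : Finset (Fin n)} {y : E n} (hy : y ∈ orthant I T ρ) :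
    e.symm '' orthant I T ρ ⊆ connectedComponentIn (M \ Sig) (e.symm y) := by
  refine IsPreconnected.subset_connectedComponentIn ?_ (mem_image_of_mem _ hy) ?_
  · exact (convex_orthant I T ρ).isPreconnected.image _
      (e.continuousOn_symm.mono fun z hz => hρ hz.1)
  · rintro _ ⟨z, hz, rfl⟩
    have h1 := e.map_target (hρ hz.1)
    refine ⟨he.1 h1, fun h => ?_⟩
    obtain ⟨i, hi, h2⟩ := (hI _ h1).1 h
    rw [e.right_inv (hρ hz.1)] at h2
    exact (hz.2 i hi).1 h2

theorem exists_piece (he : IsChartAt M p e)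
    (hI : ∀ x ∈ e.source, x ∈ Sig ↔ ∃ i ∈ I, e x i = 0) {ρ : ℝ}
    (hρ : Metric.ball 0 ρ ⊆ e.target) (hf : f ∈ PiecewiseSmooth M Sig) (T : Finset (Fin n)) :
    ∃ h, ContDiffOn ℝ ∞ h M ∧ ∀ y ∈ orthant I T ρ, f (e.symm y) = h (e.symm y) := by
  rcases (orthant I T ρ).eq_empty_or_nonempty with h0 | ⟨y, hy⟩
  · exact ⟨0, contDiffOn_const, by simp [h0]⟩
  · have h1 := image_orthant_subset he hI hρ hy
    have h2 := connectedComponentIn_subset _ _ (h1 (mem_image_of_mem _ hy))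
    obtain ⟨h, hh, hfh⟩ := hf.2 _ h2
    exact ⟨h, hh, fun z hz => hfh (h1 (mem_image_of_mem _ hz))⟩

theorem exists_ball_subset_target (he : IsChartAt M p e) :
    ∃ ρ > 0, Metric.ball 0 ρ ⊆ e.target := by
  have h := e.map_source he.2.1
  rw [he.2.2.1] at h
  exact Metric.isOpen_iff.1 e.open_target _ h

end Pieces

section Integrable

theorem IsNormalCrossings.exists_chart (hSig : IsNormalCrossings M Sig) {p : E n} (hp : p ∈ M) :
    ∃ e, IsChartAt M p e ∧ ∃ I : Finset (Fin n), ∀ x ∈ e.source, x ∈ Sig ↔ ∃ i ∈ I, e x i = 0 := by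
  obtain ⟨e, he, I, hI⟩ := hSig.2 p hp
  refine ⟨e, he, I, fun x hx => ?_⟩
  have h1 := Set.ext_iff.1 hI x
  simp only [mem_inter_iff, hx, and_true, mem_ofPred_eq, true_and, Finset.prod_eq_zero_iff] at h1
  exact h1

theorem IsNormalCrossings.isOpen_diff (hSig : IsNormalCrossings M Sig) : IsOpen (M \ Sig) := by
  rw [isOpen_iff_mem_nhds]
  rintro p ⟨hp, hpS⟩
  obtain ⟨e, he, I, hI⟩ := hSig.exists_chart hp
  have h1 : ∀ i ∈ I, ∀ᶠ x in 𝓝 p, e x i ≠ 0 := fun i hi => by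
    refine ContinuousAt.eventually_ne ?_ fun h => hpS ((hI p he.2.1).2 ⟨i, hi, h⟩)
    exact (contDiff_coord (n := 0) i).continuous.continuousAt.comp (e.continuousAt he.2.1)
  filter_upwards [(Filter.eventually_all_finset I).2 h1, e.open_source.mem_nhds he.2.1] with x hx hxs
  exact ⟨he.1 hxs, fun h => by
    obtain ⟨i, hi, h2⟩ := (hI x hxs).1 h
    exact hx i hi h2⟩

theorem IsNormalCrossings.volume_eq_zero (hSig : IsNormalCrossings M Sig) :
    volume (M ∩ Sig) = 0 := by
  refine measure_null_of_locally_null _ fun p hp => ?_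
  obtain ⟨e, he, I, hI⟩ := hSig.exists_chart hp.1
  refine ⟨(M ∩ Sig) ∩ e.source, inter_mem self_mem_nhdsWithin
    (mem_nhdsWithin_of_mem_nhds (e.open_source.mem_nhds he.2.1)), ?_⟩
  have h1 : (M ∩ Sig) ∩ e.source ⊆ ⋃ i : Fin n, e.symm '' (e.target ∩ {y | y i = 0}) := by
    rintro x ⟨⟨-, hxS⟩, hx⟩
    obtain ⟨i, -, hi⟩ := (hI x hx).1 hxS
    exact mem_iUnion.2 ⟨i, e x, ⟨e.map_source hx, hi⟩, e.left_inv hx⟩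
  refine measure_mono_null h1 (measure_iUnion_null fun i => ?_)
  refine addHaar_image_eq_zero_of_differentiableOn_of_addHaar_eq_zero _
    ((he.2.2.2.2.differentiableOn (by simp)).mono inter_subset_left) ?_
  exact measure_mono_null inter_subset_right (volume_coord_eq_zero i)

/-- Near `p`, on each of the finitely many orthants, `f` agrees with a function continuous on `M`,
hence bounded on the compact set `K`. The arbitrary values of `f` on `Sig` do not matter since `M ∩
Sig` is a null set. -/
theorem IsNormalCrossings.locallyIntegrableOn (hSig : IsNormalCrossings M Sig)
    (hf : f ∈ PiecewiseSmooth M Sig) : LocallyIntegrableOn f M := by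
  intro p hp
  obtain ⟨e, he, I, hI⟩ := hSig.exists_chart hp
  obtain ⟨ρ, hρ, hρt⟩ := exists_ball_subset_target he
  set K := e.symm '' Metric.closedBall 0 (ρ / 2) with hK
  have hKt : Metric.closedBall 0 (ρ / 2) ⊆ Metric.ball (0 : E n) ρ :=
    Metric.closedBall_subset_ball (by linarith)
  have hKc : IsCompact K := (isCompact_closedBall _ _).image_of_continuousOn
    (e.continuousOn_symm.mono (hKt.trans hρt))
  have hKM : K ⊆ M := by
    rintro _ ⟨y, hy, rfl⟩
    exact he.1 (e.map_target (hρt (hKt hy)))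
  have hKn : K ∈ 𝓝 p := by
    have h1 : e ⁻¹' Metric.closedBall 0 (ρ / 2) ∈ 𝓝 p :=
      (e.continuousAt he.2.1).preimage_mem_nhds (by
        rw [he.2.2.1]; exact Metric.closedBall_mem_nhds _ (by linarith))
    filter_upwards [h1, e.open_source.mem_nhds he.2.1] with x hx hxs
    exact ⟨e x, hx, e.left_inv hxs⟩
  refine ⟨K, mem_nhdsWithin_of_mem_nhds hKn, ?_⟩
  choose h hh hfh using exists_piece he hI hρt hf
  have hb : ∀ T, ∃ C, ∀ x ∈ K, ‖h T x‖ ≤ C := fun T =>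
    hKc.exists_bound_of_continuousOn ((hh T).continuousOn.mono hKM)
  choose C hC using hb
  have hnull : volume (M ∩ Sig) = 0 := hSig.volume_eq_zero
  have : IsFiniteMeasure (volume.restrict K) := ⟨by simpa using hKc.measure_lt_top⟩
  refine Integrable.of_bound ?_ (∑ T, |C T|) ?_
  · have h1 : AEStronglyMeasurable f (volume.restrict (M \ Sig)) :=
      hf.1.continuousOn.aestronglyMeasurable hSig.isOpen_diff.measurableSet
    have h2 : AEStronglyMeasurable f (volume.restrict (K \ Sig)) :=
      h1.mono_measure (Measure.restrict_mono (sdiff_subset_sdiff_left hKM) le_rfl)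
    have h3 : (K \ Sig : Set (E n)) =ᵐ[volume] K := by
      have h4 : Sig ∩ K ⊆ M ∩ Sig := fun x hx => ⟨hKM hx.2, hx.1⟩
      rw [← sdiff_inter_self_eq_sdiff]
      exact sdiff_null_ae_eq_self (measure_mono_null h4 hnull)
    rwa [Measure.restrict_congr_set h3] at h2
  · have h3 : ∀ᵐ x ∂volume, x ∉ M ∩ Sig := measure_eq_zero_iff_ae_notMem.1 hnull
    filter_upwards [ae_restrict_of_ae h3, ae_restrict_mem hKc.measurableSet] with x hx hxK
    obtain ⟨y, hy, rfl⟩ := hxK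
    have hyt := hρt (hKt hy)
    set T := I.filter fun i => 0 < y i with hT
    have h4 : y ∈ orthant I T ρ := by
      refine ⟨hKt hy, fun i hi => ⟨fun h0 => hx ⟨hKM ⟨y, hy, rfl⟩, ?_⟩, by simp [hT, hi]⟩⟩
      rw [hI _ (e.map_target hyt), e.right_inv hyt]
      exact ⟨i, hi, h0⟩
    rw [hfh T y h4]
    refine (hC T _ ⟨y, hy, rfl⟩).trans ((le_abs_self _).trans ?_)
    exact Finset.single_le_sum (f := fun T => |C T|) (fun T _ => abs_nonneg _) (Finset.mem_univ T)

end Integrable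

section Reg

/-- Rescaling the variable by `ε` removes the factor `ε⁻ⁿ`. At `ε = 0` the right side is `f x`
because `m` has integral 1, so a single formula covers both cases. -/
theorem reg_eq_integral (hm : ∫ x, m x = 1) {x : E n} {ε : ℝ} (hε : 0 ≤ ε) :
    reg m f (x, ε) = ∫ s, m s * f (x - ε • s) := by
  rcases hε.eq_or_lt with rfl | hε
  · simp [reg, integral_mul_const, hm]
  · have h1 : reg m f (x, ε) = (ε ^ n)⁻¹ * ∫ t, m (ε⁻¹ • t) * f (x - ε • ε⁻¹ • t) := by
      simp only [reg, hε, if_true, convolution, rescale, ← integral_const_mul]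
      refine integral_congr_ae (Eventually.of_forall fun t => ?_)
      simp [smul_inv_smul₀ hε.ne', mul_assoc]
    rw [h1, Measure.integral_comp_inv_smul_of_nonneg volume (fun s => m s * f (x - ε • s)) hε.le]
    simp [hε.ne']

theorem contDiffOn_rescale (hm : ContDiff ℝ ∞ m) :
    ContDiffOn ℝ ∞ (fun q : ℝ × E n => rescale m q.1 q.2) (Ioi 0 ×ˢ univ) := by
  have h1 : ContDiffOn ℝ ∞ (fun q : ℝ × E n => q.1⁻¹) (Ioi 0 ×ˢ univ) :=
    contDiff_fst.contDiffOn.inv fun q hq => (mem_Ioi.1 hq.1).ne'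
  have h2 : ContDiffOn ℝ ∞ (fun q : ℝ × E n => (q.1 ^ n)⁻¹) (Ioi 0 ×ˢ univ) :=
    (contDiff_fst.pow n).contDiffOn.inv fun q hq => pow_ne_zero _ (mem_Ioi.1 hq.1).ne'
  exact h2.mul (hm.comp_contDiffOn (h1.smul contDiff_snd.contDiffOn))

/-- For compact `K ⊆ M` the cut-off of `f` is locally integrable on all of `ℝⁿ`, unlike `f` itself.
-/
theorem reg_eq_convolution {x : E n} {ε : ℝ} (hε : 0 < ε) {K : Set (E n)}
    (hK : ∀ t ∈ tsupport m, x - ε • t ∈ K) :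
    reg m f (x, ε) = (rescale m ε ⋆ K.indicator f) x := by
  simp only [reg, hε, if_true, convolution]
  refine integral_congr_ae (Eventually.of_forall fun t => ?_)
  by_cases ht : ε⁻¹ • t ∈ tsupport m
  · have := hK _ ht
    rw [smul_inv_smul₀ hε.ne'] at this
    simp [this]
  · simp [rescale, image_eq_zero_of_notMem_tsupport ht]

theorem isCompact_sub_smul {k : Set (E n)} (hk : IsCompact k) (x : E n) (ε : ℝ) :
    IsCompact ((fun t => x - ε • t) '' k) :=
  hk.image (by fun_prop)

theorem locallyIntegrable_indicator (hf : LocallyIntegrableOn f M) {K : Set (E n)} (hK : IsCompact K)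
    (hKM : K ⊆ M) : LocallyIntegrable (K.indicator f) :=
  ((integrable_indicator_iff hK.measurableSet).2
    (hf.integrableOn_compact_subset hKM hK)).locallyIntegrable

theorem rescale_hasCompactSupport (hc : HasCompactSupport m) {ε : ℝ} (hε : 0 < ε) :
    HasCompactSupport (rescale m ε) :=
  (hc.comp_smul (inv_ne_zero hε.ne')).mul_left

theorem reg_add {g : E n → ℝ} (hm : IsMollifier m) (hf : LocallyIntegrableOn f M)
    (hg : LocallyIntegrableOn g M) {q : E n × ℝ} (hq : q ∈ regDomain M m) :
    reg m (f + g) q = reg m f q + reg m g q := by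
  obtain ⟨x, ε⟩ := q
  obtain ⟨hx, hε, hM⟩ := hq
  rcases (show 0 ≤ ε from hε).eq_or_lt with rfl | hε
  · simp [reg]
  · have hK : ∀ t ∈ tsupport m, x - ε • t ∈ (fun t => x - ε • t) '' tsupport m :=
      fun t ht => ⟨t, ht, rfl⟩
    set K := (fun t => x - ε • t) '' tsupport m
    have hKc : IsCompact K := isCompact_sub_smul hm.2.2.2 x ε
    have hKM : K ⊆ M := by rintro _ ⟨t, ht, rfl⟩; exact hM t ht
    have hcont : Continuous (rescale m ε) :=
      continuous_const.mul (hm.1.continuous.comp (continuous_const_smul _))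
    rw [reg_eq_convolution hε hK, reg_eq_convolution hε hK, reg_eq_convolution hε hK, indicator_add']
    have hex : ∀ {g : E n → ℝ}, LocallyIntegrableOn g M →
        ConvolutionExistsAt (rescale m ε) (K.indicator g) x (ContinuousLinearMap.lsmul ℝ ℝ) volume :=
      fun hg => (rescale_hasCompactSupport hm.2.2.2 hε).convolutionExists_left _ hcont
        (locallyIntegrable_indicator hg hKc hKM) x
    exact (hex hf).distrib_add (hex hg)

theorem reg_smul (c : ℝ) (q : E n × ℝ) : reg m (c • f) q = c * reg m f q := by
  simp only [reg, convolution]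
  split_ifs
  · rw [← integral_const_mul]
    refine integral_congr_ae (Eventually.of_forall fun t => ?_)
    simp [mul_left_comm]
  · rfl

/-- For `ε > 0` all derivatives fall on the rescaled mollifier. One compact set `K` serves all
nearby points. -/
theorem contDiffAt_reg (hM : IsOpen M) (hm : IsMollifier m) (hf : LocallyIntegrableOn f M)
    {q : E n × ℝ} (hq : q ∈ regDomain M m) (hpos : 0 < q.2) : ContDiffAt ℝ ∞ (reg m f) q := by
  set k := (fun t => q.1 - q.2 • t) '' tsupport m with hk
  have hkc : IsCompact k := isCompact_sub_smul hm.2.2.2 _ _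
  have hkM : k ⊆ M := by rintro _ ⟨t, ht, rfl⟩; exact hq.2.2 t ht
  obtain ⟨K, hK, hkK, hKM⟩ := exists_compact_between hkc hM hkM
  have hev : ∀ᶠ q' in 𝓝 q, ∀ t ∈ tsupport m, q'.1 - q'.2 • t ∈ interior K := by
    refine hm.2.2.2.isCompact.eventually_forall_of_forall_eventually fun t ht => ?_
    have hc : Continuous fun z : (E n × ℝ) × E n => z.1.1 - z.1.2 • z.2 := by fun_prop
    exact hc.continuousAt.eventually (isOpen_interior.mem_nhds (hkK ⟨t, ht, rfl⟩))
  obtain ⟨R, hR⟩ := hm.2.2.2.isCompact.isBounded.subset_closedBall 0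
  have h1 := contDiffOn_convolution_left_with_param (ContinuousLinearMap.lsmul ℝ ℝ)
    (μ := volume) (n := ⊤) (f := K.indicator f) (g := fun ε : ℝ => rescale m ε)
    (s := Ioo 0 (2 * q.2)) (k := Metric.closedBall 0 (2 * q.2 * R)) isOpen_Ioo
    (isCompact_closedBall _ _) (fun ε x hε hx => by
      have h2 : ε⁻¹ • x ∉ tsupport m := by
        intro h
        have h3 := hR h
        rw [mem_closedBall_zero_iff, norm_smul, norm_inv, Real.norm_of_nonneg hε.1.le,
          inv_mul_le_iff₀ hε.1] at h3
        refine hx (mem_closedBall_zero_iff.2 (h3.trans ?_))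
        have : 0 ≤ R := by
          by_contra hR0
          have := hR h
          rw [Metric.closedBall_eq_empty.2 (not_le.1 hR0)] at this
          exact this
        exact mul_le_mul_of_nonneg_right hε.2.le this
      simp [rescale, image_eq_zero_of_notMem_tsupport h2])
    (locallyIntegrable_indicator hf hK hKM)
    ((contDiffOn_rescale hm.1).mono (prod_mono (fun ε hε => hε.1) le_rfl))
  have h2 : ContDiffAt ℝ ∞ (fun q : E n × ℝ => (rescale m q.2 ⋆ K.indicator f) q.1) q := by
    refine (h1.contDiffAt (x := (q.2, q.1)) ?_).comp (f := fun q : E n × ℝ => (q.2, q.1)) q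
      (contDiff_snd.prodMk contDiff_fst).contDiffAt
    exact (isOpen_Ioo.prod isOpen_univ).mem_nhds ⟨⟨hpos, by linarith⟩, mem_univ _⟩
  refine h2.congr_of_eventuallyEq ?_
  filter_upwards [hev, continuous_snd.continuousAt.eventually (lt_mem_nhds hpos)] with q' h3 h4
  exact reg_eq_convolution (x := q'.1) (ε := q'.2) h4 fun t ht => interior_subset (h3 t ht)

end Reg

end

/-! ### Extension to `ε = 0` where the kernel sees no jump. -/

section

variable {n : ℕ} {M Sig : Set (E n)} {f m : E n → ℝ} {p : E n}
  {e : OpenPartialHomeomorph (E n) (E n)} {I : Finset (Fin n)}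

/-- The number `L` comes from a local Lipschitz constant of `e`: it converts the range of the
mollifier in `M` into a range in the coordinates. -/
theorem exists_chart_radii (he : IsChartAt M p e) :
    ∃ ρ δ L : ℝ, 0 < ρ ∧ 0 < δ ∧ 0 < L ∧ Metric.ball 0 ρ ⊆ e.target ∧ Metric.ball p δ ⊆ e.source ∧
      (∀ x ∈ Metric.ball p δ, e x ∈ Metric.ball 0 (ρ / 2)) ∧
      ∀ z ∈ Metric.ball 0 ρ, ∀ x ∈ Metric.ball p δ, ‖e x - z‖ ≤ L * ‖x - e.symm z‖ := by
  obtain ⟨K, t, ht, hK⟩ := ((he.2.2.2.1.contDiffAt (e.open_source.mem_nhds he.2.1)).of_le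
    (show (1 : WithTop ℕ∞) ≤ ∞ by exact_mod_cast le_top)).exists_lipschitzOnWith
  have h0 := e.map_source he.2.1
  have h1 : e.symm ⁻¹' t ∩ e.target ∈ 𝓝 (0 : E n) := by
    rw [← he.2.2.1]
    refine inter_mem ((e.continuousAt_symm h0).preimage_mem_nhds ?_) (e.open_target.mem_nhds h0)
    rwa [e.left_inv he.2.1]
  obtain ⟨ρ, hρ, h2⟩ := Metric.mem_nhds_iff.1 h1
  have h3 : e ⁻¹' Metric.ball 0 (ρ / 2) ∩ e.source ∩ t ∈ 𝓝 p := by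
    refine inter_mem (inter_mem ((e.continuousAt he.2.1).preimage_mem_nhds ?_)
      (e.open_source.mem_nhds he.2.1)) ht
    rw [he.2.2.1]
    exact Metric.ball_mem_nhds _ (half_pos hρ)
  obtain ⟨δ, hδ, h4⟩ := Metric.mem_nhds_iff.1 h3
  refine ⟨ρ, δ, K + 1, hρ, hδ, by positivity, fun z hz => (h2 hz).2, fun x hx => (h4 hx).1.2,
    fun x hx => (h4 hx).1.1, fun z hz x hx => ?_⟩
  have h5 := hK.norm_sub_le (h4 hx).2 (h2 hz).1
  rw [e.right_inv (h2 hz).2] at h5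
  exact h5.trans (mul_le_mul_of_nonneg_right (by linarith) (norm_nonneg _))

theorem abs_coord_sub_le (y z : E n) (i : Fin n) : |y i - z i| ≤ ‖y - z‖ := by
  simpa using PiLp.norm_apply_le (y - z) i

/-- Where no coordinate of index in `I` changes sign at distance `C * ε` of `x`, the regularization
is smooth. -/
theorem exists_extension_of_signs (he : IsChartAt M p e)
    (hI : ∀ x ∈ e.source, x ∈ Sig ↔ ∃ i ∈ I, e x i = 0) (hm : IsMollifier m)
    (hf : f ∈ PiecewiseSmooth M Sig) (T : Finset (Fin n)) :
    ∃ C > 0, ∃ O, IsOpen O ∧ (p, (0 : ℝ)) ∈ O ∧ ∃ H, ContDiffOn ℝ ∞ H O ∧ ∀ x ε, (x, ε) ∈ O →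
      0 ≤ ε → (∀ i ∈ I, i ∈ T → C * ε < e x i) → (∀ i ∈ I, i ∉ T → e x i < -(C * ε)) →
      reg m f (x, ε) = H (x, ε) := by
  obtain ⟨ρ, δ, L, hρ, hδ, hL, ha, hb, hc, hd⟩ := exists_chart_radii he
  obtain ⟨R, hR0, hR⟩ := hm.2.2.2.isCompact.isBounded.subset_closedBall_lt 0 0
  obtain ⟨h, hh, hfh⟩ := exists_piece he hI ha hf T
  set O : Set (E n × ℝ) := {q | ‖q.1 - p‖ + |q.2| * (R + 1) < δ} with hO
  have hOo : IsOpen O := isOpen_lt (by fun_prop) continuous_const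
  have hmem : ∀ q ∈ O, ∀ s ∈ Metric.ball (0 : E n) (R + 1), q.1 - q.2 • s ∈ Metric.ball p δ := by
    intro q hq s hs
    rw [mem_ball_zero_iff] at hs
    rw [mem_ball_iff_norm]
    calc ‖q.1 - q.2 • s - p‖ = ‖(q.1 - p) - q.2 • s‖ := by congr 1; abel
      _ ≤ ‖q.1 - p‖ + |q.2| * ‖s‖ := (norm_sub_le _ _).trans_eq (by rw [norm_smul, Real.norm_eq_abs])
      _ ≤ ‖q.1 - p‖ + |q.2| * (R + 1) := by gcongr
      _ < δ := hq
  -- For `s` in the support of `m`, the coordinates of `x - ε • s` differ from those of `x` by at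
  -- most `L * R * ε`, so those of index in `I` keep their signs. Thus `f` may be replaced by the
  -- function `h` of one orthant.
  refine ⟨L * R + 1, by positivity, O, hOo, by simpa [hO] using hδ,
    fun q => ∫ s, m s * h (q.1 - q.2 • s), ?_, fun x ε hx hε h1 h2 => ?_⟩
  · have h1 : ContDiffOn ℝ ∞ (fun z : (E n × ℝ) × E n => h (z.1.1 - z.1.2 • z.2))
        (O ×ˢ Metric.ball 0 (R + 1)) := by
      refine hh.comp (ContDiff.contDiffOn ?_) fun z hz => he.1 (hb (hmem _ hz.1 _ hz.2))
      exact (contDiff_fst.comp contDiff_fst).sub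
        ((contDiff_snd.comp contDiff_fst).smul contDiff_snd)
    have h2 := contDiffOn_smul_of_tsupport_subset hm.1 Metric.isOpen_ball
      (hR.trans (Metric.closedBall_subset_ball (by linarith))) hOo h1
    refine (contDiffOn_integral_smul (μ := volume) (w := fun _ => 1) (locallyIntegrable_const 1) hOo
      hm.2.2.2.isCompact (g := fun q s => m s • h (q.1 - q.2 • s)) (fun q s _ hs => ?_) h2).congr
      fun q _ => by simp
    simp [image_eq_zero_of_notMem_tsupport hs]
  · rw [reg_eq_integral hm.2.2.1 hε]
    refine integral_congr_ae (Eventually.of_forall fun s => ?_)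
    by_cases hs : s ∈ tsupport m
    · have hsR : ‖s‖ ≤ R := mem_closedBall_zero_iff.1 (hR hs)
      have h3 := hmem _ hx s (mem_ball_zero_iff.2 (by linarith))
      have h3' := hmem _ hx 0 (mem_ball_zero_iff.2 (by simpa using by linarith))
      simp only [smul_zero, sub_zero] at h3 h3'
      have h4 : e (x - ε • s) ∈ Metric.ball 0 ρ :=
        Metric.ball_subset_ball (by linarith) (hc _ h3)
      have h5 := hd _ h4 x h3'
      rw [e.left_inv (hb h3), sub_sub_cancel, norm_smul, Real.norm_of_nonneg hε] at h5
      have h6 : ‖e x - e (x - ε • s)‖ ≤ L * R * ε := by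
        refine h5.trans ?_
        calc L * (ε * ‖s‖) ≤ L * (ε * R) := by gcongr
          _ = L * R * ε := by ring
      have h7 : e (x - ε • s) ∈ orthant I T ρ := by
        refine ⟨h4, fun i hi => ?_⟩
        have h8 := abs_le.1 ((abs_coord_sub_le (e x) (e (x - ε • s)) i).trans h6)
        by_cases hiT : i ∈ T
        · have h9 := h1 i hi hiT
          have : 0 < e (x - ε • s) i := by linarith [h8.2]
          exact ⟨this.ne', by simp [this, hiT]⟩
        · have h9 := h2 i hi hiT
          have : e (x - ε • s) i < 0 := by linarith [h8.1]
          exact ⟨this.ne, by simp [this.le, hiT]⟩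
      have h8 := hfh _ h7
      rw [e.left_inv (hb h3)] at h8
      simp only [h8]
    · simp [image_eq_zero_of_notMem_tsupport hs]

/-- The average of the derivative of `σ` along a segment, applied to the direction. -/
def meanDeriv {W : Type*} [NormedAddCommGroup W] [NormedSpace ℝ W] (σ : E n → W) (y v : E n) (ε : ℝ) :
    W :=
  ∫ u in (0 : ℝ)..1, fderiv ℝ σ (y - (u * ε) • v) v

/-- This is the fundamental theorem of calculus along a segment. It replaces the difference quotient
with denominator `ε` by an expression which makes sense at `ε = 0`. -/
theorem smul_meanDeriv {W : Type*} [NormedAddCommGroup W] [NormedSpace ℝ W] [CompleteSpace W]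
    {σ : E n → W} {y v : E n} {ε : ℝ}
    (hσ : ∀ u ∈ Icc (0 : ℝ) 1, ContDiffAt ℝ 1 σ (y - (u * ε) • v)) :
    ε • meanDeriv σ y v ε = σ y - σ (y - ε • v) := by
  have hd : ∀ u ∈ uIcc (0 : ℝ) 1, HasDerivAt (fun u : ℝ => σ (y - (u * ε) • v))
      (-(ε • fderiv ℝ σ (y - (u * ε) • v) v)) u := by
    intro u hu
    rw [uIcc_of_le zero_le_one] at hu
    have h1 : HasDerivAt (fun u : ℝ => y - (u * ε) • v) (-(ε • v)) u := by
      simpa using (((hasDerivAt_id u).mul_const ε).smul_const v).const_sub y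
    have h2 := ((hσ u hu).differentiableAt one_ne_zero).hasFDerivAt.comp_hasDerivAt u h1
    rwa [map_neg, map_smul] at h2
  have hc : ContinuousOn (fun u : ℝ => fderiv ℝ σ (y - (u * ε) • v) v) (uIcc (0 : ℝ) 1) := by
    intro u hu
    rw [uIcc_of_le zero_le_one] at hu
    have h1 : ContinuousAt (fderiv ℝ σ) (y - (u * ε) • v) :=
      ((hσ u hu).fderiv_right (m := 0) le_rfl).continuousAt
    have h2 : ContinuousAt (fun u : ℝ => y - (u * ε) • v) u := by fun_prop
    exact ((ContinuousAt.comp (f := fun u : ℝ => y - (u * ε) • v) h1 h2).clm_apply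
      continuousAt_const).continuousWithinAt
  have h1 := intervalIntegral.integral_eq_sub_of_hasDerivAt hd
    ((hc.const_smul ε).neg.intervalIntegrable)
  rw [intervalIntegral.integral_neg, intervalIntegral.integral_smul] at h1
  simp only [one_mul, zero_mul, zero_smul, sub_zero] at h1
  rw [meanDeriv, ← neg_inj, h1, neg_sub]

end

/-! ### Extension to `ε = 0` as a function of the ratios. -/

section

variable {n : ℕ} {M Sig : Set (E n)} {f m : E n → ℝ} {p : E n}
  {e : OpenPartialHomeomorph (E n) (E n)} {I : Finset (Fin n)}

/-- The vectors whose positive coordinates of index in `A` are those of index in `T`. -/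
def signSet (A T : Finset (Fin n)) : Set (E n) := {t | ∀ i ∈ A, 0 < t i ↔ i ∈ T}

theorem measurableSet_signSet (A T : Finset (Fin n)) : MeasurableSet (signSet A T) := by
  have h1 : signSet A T = ⋂ i : Fin n, {t : E n | i ∈ A → (0 < t i ↔ i ∈ T)} := by
    ext; simp [signSet]
  rw [h1]
  refine MeasurableSet.iInter fun i => ?_
  have h2 : MeasurableSet {t : E n | 0 < t i} :=
    (isOpen_lt continuous_const (contDiff_coord (n := 0) i).continuous).measurableSet
  by_cases hA : i ∈ A
  · by_cases hT : i ∈ T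
    · simpa [hA, hT] using h2
    · simpa [hA, hT, compl_ofPred] using h2.compl
  · simp [hA]

/-- The sets `signSet A T`, `T ⊆ A`, form a partition, so only the pattern of positive coordinates
of `t` contributes. -/
theorem sum_indicator_signSet (A : Finset (Fin n)) (t : E n) (a : Finset (Fin n) → ℝ) :
    ∑ T ∈ A.powerset, (signSet A T).indicator (fun _ => (1 : ℝ)) t * a T =
      a (A.filter fun i => 0 < t i) := by
  rw [Finset.sum_eq_single (A.filter fun i => 0 < t i)]
  · rw [indicator_of_mem, one_mul]
    intro i hi
    simp [hi]
  · intro T hT hne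
    rw [indicator_of_notMem, zero_mul]
    intro h
    refine hne (Finset.ext fun i => ?_)
    rw [Finset.mem_filter]
    exact ⟨fun hi => ⟨Finset.mem_powerset.1 hT hi, (h i (Finset.mem_powerset.1 hT hi)).2 hi⟩,
      fun hi => (h i hi.1).1 hi.2⟩
  · intro h
    exact (h (Finset.mem_powerset.2 (Finset.filter_subset _ _))).elim

theorem det_fderiv_symm_ne_zero (he : IsChartAt M p e) {z : E n} (hz : z ∈ e.target) :
    (fderiv ℝ e.symm z).det ≠ 0 := by
  have h1 : HasFDerivAt e (fderiv ℝ e (e.symm z)) (e.symm z) :=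
    ((he.2.2.2.1.contDiffAt (e.open_source.mem_nhds (e.map_target hz))).differentiableAt
      (by simp)).hasFDerivAt
  have h2 : HasFDerivAt e.symm (fderiv ℝ e.symm z) z :=
    ((he.2.2.2.2.contDiffAt (e.open_target.mem_nhds hz)).differentiableAt (by simp)).hasFDerivAt
  have h3 := (h1.comp z h2).unique ((hasFDerivAt_id z).congr_of_eventuallyEq (by
    filter_upwards [e.open_target.mem_nhds hz] with y hy using e.right_inv hy))
  have h4 : (fderiv ℝ e (e.symm z)).det * (fderiv ℝ e.symm z).det = 1 := by
    rw [ContinuousLinearMap.det, ContinuousLinearMap.det, ← LinearMap.det_comp,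
      ← ContinuousLinearMap.toLinearMap_comp, h3]
    simp
  exact right_ne_zero_of_mul_eq_one h4

/-- Two substitutions: `x' = e.symm z`, with the Jacobian of `e.symm`, and then `z = y - ε • (α -
t)`, whose Jacobian cancels `ε⁻ⁿ`. In the application `y = e x` and `e x i = ε * α i`, so the
coordinate of `z` of index `i` is `ε * t i`. -/
theorem reg_eq_integral_chart (he : IsChartAt M p e) {x y : E n} {ε ρ : ℝ} (hε : 0 < ε)
    (hρ : Metric.ball 0 ρ ⊆ e.target)
    (hsupp : ∀ x', m (ε⁻¹ • (x - x')) ≠ 0 → x' ∈ e.symm '' Metric.ball 0 ρ) (α : E n) :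
    reg m f (x, ε) = ∫ t, (Metric.ball 0 ρ).indicator
      (fun z => |(fderiv ℝ e.symm z).det| * (m (ε⁻¹ • (x - e.symm z)) * f (e.symm z)))
        (y - ε • (α - t)) := by
  set Φ : E n → ℝ := (Metric.ball 0 ρ).indicator
    (fun z => |(fderiv ℝ e.symm z).det| * (m (ε⁻¹ • (x - e.symm z)) * f (e.symm z))) with hΦ
  have h1 : reg m f (x, ε) = (ε ^ n)⁻¹ * ∫ x', m (ε⁻¹ • (x - x')) * f x' := by
    simp only [reg, hε, if_true, convolution_eq_swap, rescale, ← integral_const_mul]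
    refine integral_congr_ae (Eventually.of_forall fun t => ?_)
    simp [mul_assoc]
  have h2 : ∫ x', m (ε⁻¹ • (x - x')) * f x' = ∫ z, Φ z := by
    rw [hΦ, integral_indicator Metric.isOpen_ball.measurableSet]
    rw [← setIntegral_eq_integral_of_forall_compl_eq_zero (s := e.symm '' Metric.ball 0 ρ)]
    · exact integral_image_eq_integral_abs_det_fderiv_smul volume
        Metric.isOpen_ball.measurableSet (fun z hz =>
          ((he.2.2.2.2.contDiffAt (e.open_target.mem_nhds (hρ hz))).differentiableAt
            (by simp)).hasFDerivAt.hasFDerivWithinAt) (e.symm.injOn.mono hρ) _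
    · intro x' hx'
      rw [not_imp_comm.1 (hsupp x') hx', zero_mul]
  have h3 : ∫ t, Φ (y - ε • (α - t)) = (ε ^ n)⁻¹ * ∫ z, Φ z := by
    rw [integral_sub_left_eq_self (fun s => Φ (y - ε • s)) volume α,
      Measure.integral_comp_smul_of_nonneg volume (fun s => Φ (y - s)) ε (hR := hε.le),
      integral_sub_left_eq_self Φ volume y]
    simp
  rw [h1, h2, h3]

theorem ae_coord_ne_zero : ∀ᵐ t : E n, ∀ i, t i ≠ 0 :=
  ae_all_iff.2 fun i => measure_eq_zero_iff_ae_notMem.1 (volume_coord_eq_zero i)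

/-- Where some coordinates of `x` are of the form `ε * α i` and the others do not change sign at
distance `C * ε` of `x`, the regularization is a smooth function of `x`, `ε` and `α`. -/
theorem exists_extension_of_ratios (he : IsChartAt M p e)
    (hI : ∀ x ∈ e.source, x ∈ Sig ↔ ∃ i ∈ I, e x i = 0) (hm : IsMollifier m)
    (hf : f ∈ PiecewiseSmooth M Sig) (A T : Finset (Fin n)) :
    ∃ C > 0, ∃ O, IsOpen O ∧ (p, (0 : ℝ)) ∈ O ∧ ∃ H : (E n × ℝ) × E n → ℝ,
      ContDiffOn ℝ ∞ H (O ×ˢ univ) ∧ ∀ x ε α, (x, ε) ∈ O → 0 < ε → (∀ i ∈ A, e x i = ε * α i) →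
      (∀ i ∈ I, i ∉ A → i ∈ T → C * ε < e x i) → (∀ i ∈ I, i ∉ A → i ∉ T → e x i < -(C * ε)) →
      reg m f (x, ε) = H ((x, ε), α) := by
  obtain ⟨ρ, δ, L, hρ, hδ, hL, ha, hb, hc, hd⟩ := exists_chart_radii he
  obtain ⟨R, hR0, hR⟩ := hm.2.2.2.isCompact.isBounded.subset_closedBall_lt 0 0
  choose h hh hfh using exists_piece he hI ha hf
  have hmR : ∀ t, m t ≠ 0 → ‖t‖ ≤ R := fun t ht =>
    mem_closedBall_zero_iff.1 (hR (subset_tsupport _ ht))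
  set C := L * R + 1 with hC
  have hC0 : 0 < C := by positivity
  set O : Set (E n × ℝ) := {q | ‖q.1 - p‖ + |q.2| * R < δ ∧ |q.2| * (2 * (C + 2)) < ρ / 2} with hO
  have hOo : IsOpen O :=
    (isOpen_lt (f := fun q : E n × ℝ => ‖q.1 - p‖ + |q.2| * R) (by fun_prop) continuous_const).inter
      (isOpen_lt (f := fun q : E n × ℝ => |q.2| * (2 * (C + 2))) (by fun_prop) continuous_const)
  have hxδ : ∀ q ∈ O, q.1 ∈ Metric.ball p δ := by
    intro q hq
    rw [mem_ball_iff_norm]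
    have : 0 ≤ |q.2| * R := by positivity
    linarith [hq.1]
  have hball : ∀ q ∈ O, ∀ s ∈ Metric.ball (0 : E n) (C + 2), ∀ u ∈ Metric.ball (1 / 2 : ℝ) 1,
      e q.1 - (u * q.2) • s ∈ Metric.ball 0 ρ := by
    intro q hq s hs u hu
    rw [mem_ball_zero_iff] at hs
    have h1 := mem_ball_zero_iff.1 (hc _ (hxδ q hq))
    have hu2 : |u| ≤ 2 := by
      rw [Real.ball_eq_Ioo] at hu
      rw [abs_le]
      constructor <;> linarith [hu.1, hu.2]
    rw [mem_ball_zero_iff]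
    calc ‖e q.1 - (u * q.2) • s‖ ≤ ‖e q.1‖ + |u| * |q.2| * ‖s‖ :=
          (norm_sub_le _ _).trans_eq (by rw [norm_smul, norm_mul, Real.norm_eq_abs, Real.norm_eq_abs])
      _ ≤ ‖e q.1‖ + 2 * |q.2| * (C + 2) := by gcongr
      _ < ρ := by linarith [hq.2]
  have hone : (1 : ℝ) ∈ Metric.ball (1 / 2 : ℝ) 1 := by
    rw [Real.ball_eq_Ioo]; norm_num
  have hball1 : ∀ q ∈ O, ∀ s ∈ Metric.ball (0 : E n) (C + 2), e q.1 - q.2 • s ∈ Metric.ball 0 ρ :=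
    fun q hq s hs => by simpa using hball q hq s hs 1 hone
  -- The cutoff makes the kernel below globally defined and compactly supported. For `‖s‖ > C`,
  -- where it need not be 1, the factor `m` vanishes by `hfar`, since `C > L * R`.
  let χ : ContDiffBump (0 : E n) := ⟨C, C + 1, hC0, by linarith⟩
  have hχ : tsupport χ ⊆ Metric.ball 0 (C + 2) := by
    rw [χ.tsupport_eq]
    exact Metric.closedBall_subset_ball (by simp [χ])
  -- The kernel for the sign pattern `S` on `A`; the signs outside `A` are those of `T`. The
  -- argument of `m` is a mean derivative in place of `(x - x') / ε`, so the kernel is smooth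
  -- through `ε = 0`.
  set k : Finset (Fin n) → E n × ℝ → E n → ℝ := fun S q s =>
    χ s • (|(fderiv ℝ e.symm (e q.1 - q.2 • s)).det| *
      (m (meanDeriv e.symm (e q.1) s q.2) * h (S ∪ (T \ A)) (e.symm (e q.1 - q.2 • s)))) with hk
  have hσ : ContDiffOn ℝ ∞ e.symm (Metric.ball 0 ρ) := he.2.2.2.2.mono ha
  have hdσ : ContDiffOn ℝ ∞ (fderiv ℝ e.symm) (Metric.ball 0 ρ) :=
    hσ.fderiv_of_isOpen Metric.isOpen_ball (by simp)
  have hfst : ContDiffOn ℝ ∞ (fun z : (E n × ℝ) × E n => e z.1.1) (O ×ˢ Metric.ball 0 (C + 2)) :=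
    he.2.2.2.1.comp (contDiff_fst.comp contDiff_fst).contDiffOn fun z hz => hb (hxδ _ hz.1)
  have hz1 : ContDiffOn ℝ ∞ (fun z : (E n × ℝ) × E n => e z.1.1 - z.1.2 • z.2)
      (O ×ˢ Metric.ball 0 (C + 2)) :=
    hfst.sub ((contDiff_snd.comp contDiff_fst).smul contDiff_snd).contDiffOn
  have hmaps : MapsTo (fun z : (E n × ℝ) × E n => e z.1.1 - z.1.2 • z.2)
      (O ×ˢ Metric.ball 0 (C + 2)) (Metric.ball 0 ρ) := fun z hz => hball1 _ hz.1 _ hz.2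
  have hmean : ContDiffOn ℝ ∞
      (fun z : (E n × ℝ) × E n => meanDeriv e.symm (e z.1.1) z.2 z.1.2)
      (O ×ˢ Metric.ball 0 (C + 2)) := by
    refine contDiffOn_intervalIntegral (g := fun z : ((E n × ℝ) × E n) × ℝ =>
      fderiv ℝ e.symm (e z.1.1.1 - (z.2 * z.1.1.2) • z.1.2) z.1.2) (hOo.prod Metric.isOpen_ball) ?_
    have h1 : ContDiffOn ℝ ∞ (fun z : ((E n × ℝ) × E n) × ℝ => e z.1.1.1)
        ((O ×ˢ Metric.ball 0 (C + 2)) ×ˢ Metric.ball (1 / 2) 1) :=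
      hfst.comp contDiff_fst.contDiffOn fun z hz => hz.1
    have h2 : ContDiff ℝ ∞ (fun z : ((E n × ℝ) × E n) × ℝ => (z.2 * z.1.1.2) • z.1.2) :=
      (contDiff_snd.mul (contDiff_snd.comp (contDiff_fst.comp contDiff_fst))).smul
        (contDiff_snd.comp contDiff_fst)
    refine ContDiffOn.clm_apply (hdσ.comp (h1.sub h2.contDiffOn) fun z hz => ?_)
      (contDiff_snd.comp contDiff_fst).contDiffOn
    exact hball _ hz.1.1 _ hz.1.2 _ hz.2
  have hksmooth : ∀ S, ContDiffOn ℝ ∞ ↿(k S) (O ×ˢ univ) := by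
    intro S
    refine contDiffOn_smul_of_tsupport_subset χ.contDiff Metric.isOpen_ball hχ hOo ?_
    refine ContDiffOn.mul (fun z hz => ?_) (ContDiffOn.mul (hm.1.comp_contDiffOn hmean) ?_)
    · refine ContDiffWithinAt.abs ?_ (det_fderiv_symm_ne_zero he (ha (hmaps hz)))
      exact (contDiff_clm_det.comp_contDiffOn (hdσ.comp hz1 hmaps)) z hz
    · exact (hh _).comp (hσ.comp hz1 hmaps) fun z hz => he.1 (e.map_target (ha (hmaps hz)))
  have hkzero : ∀ S q s, q ∈ O → s ∉ Metric.closedBall (0 : E n) (C + 1) → k S q s = 0 := by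
    intro S q s _ hs
    have : χ s = 0 := image_eq_zero_of_notMem_tsupport (by rw [χ.tsupport_eq]; exact hs)
    simp [hk, this]
  have hw : ∀ S, LocallyIntegrable ((signSet A S).indicator fun _ => (1 : ℝ)) volume := fun S =>
    (locallyIntegrable_const (1 : ℝ)).indicator (measurableSet_signSet A S)
  -- The jumps of `f` are carried by indicators of sign patterns, for which local integrability
  -- suffices: in the convolution the derivatives in `α` fall on the kernel.
  refine ⟨C, hC0, O, hOo, ⟨by simpa using hδ, by simpa using half_pos hρ⟩,
    fun z => ∑ S ∈ A.powerset, ((signSet A S).indicator (fun _ => (1 : ℝ)) ⋆ k S z.1) z.2,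
    ContDiffOn.sum fun S _ => contDiffOn_convolution_right_with_param (n := ⊤) _ hOo
      (isCompact_closedBall _ _) (hkzero S) (hw S) (hksmooth S), ?_⟩
  intro x ε α hx hε hα hpos hneg
  have hxp := hxδ _ hx
  have hsupp : ∀ x', m (ε⁻¹ • (x - x')) ≠ 0 → ‖x - x'‖ ≤ ε * R := by
    intro x' hx'
    have := hmR _ hx'
    rwa [norm_smul, norm_inv, Real.norm_of_nonneg hε.le, inv_mul_le_iff₀ hε] at this
  rw [reg_eq_integral_chart he hε ha (fun x' hx' => ?_) α (y := e x)]
  swap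
  · have h1 : x' ∈ Metric.ball p δ := by
      rw [mem_ball_iff_norm]
      have h2 : ‖x' - p‖ ≤ ‖x - x'‖ + ‖x - p‖ := by
        rw [norm_sub_rev x x']
        exact norm_sub_le_norm_sub_add_norm_sub x' x p
      have h3 : ‖x - p‖ + |ε| * R < δ := hx.1
      rw [abs_of_pos hε] at h3
      linarith [hsupp x' hx']
    exact ⟨e x', Metric.ball_subset_ball (by linarith) (hc _ h1), e.left_inv (hb h1)⟩
  have hint : ∀ S ∈ A.powerset, Integrable fun t =>
      (signSet A S).indicator (fun _ => (1 : ℝ)) t * k S (x, ε) (α - t) := by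
    intro S _
    have h1 : HasCompactSupport (k S (x, ε)) :=
      HasCompactSupport.intro (isCompact_closedBall 0 (C + 1)) fun s hs => hkzero S _ s hx hs
    have h2 : Continuous (k S (x, ε)) :=
      (hksmooth S).continuousOn.comp_continuous (Continuous.prodMk_right (x, ε))
        fun s => ⟨hx, mem_univ _⟩
    exact h1.convolutionExists_right (ContinuousLinearMap.lsmul ℝ ℝ) (hw S) h2 α
  simp only [convolution, ContinuousLinearMap.lsmul_apply, smul_eq_mul]
  rw [← integral_finsetSum _ hint]
  refine integral_congr_ae ?_
  -- The excluded null set contains the points where `z` may lie on a hyperplane and `f` is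
  -- uncontrolled.
  filter_upwards [ae_coord_ne_zero] with t ht
  rw [sum_indicator_signSet A t fun S => k S (x, ε) (α - t)]
  set s := α - t with hs
  set z := e x - ε • s with hz
  have hzi : ∀ i, z i = e x i - ε * s i := fun i => by simp [hz]
  have hfar : z ∈ Metric.ball 0 ρ → C < ‖s‖ → m (ε⁻¹ • (x - e.symm z)) = 0 := by
    intro hzb hsC
    by_contra hne
    have h1 := hd z hzb x hxp
    rw [hz, sub_sub_cancel, ← hz, norm_smul, Real.norm_of_nonneg hε.le] at h1
    have h2 : ε * ‖s‖ ≤ ε * (L * R) := h1.trans (by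
      calc L * ‖x - e.symm z‖ ≤ L * (ε * R) := by gcongr; exact hsupp _ hne
        _ = ε * (L * R) := by ring)
    have := le_of_mul_le_mul_left h2 hε
    linarith
  have hmeanz : s ∈ Metric.ball 0 (C + 2) →
      meanDeriv e.symm (e x) s ε = ε⁻¹ • (x - e.symm z) := by
    intro hsb
    have h1 := smul_meanDeriv (σ := e.symm) (y := e x) (v := s) (ε := ε) fun u hu =>
      ((hσ.contDiffAt (Metric.isOpen_ball.mem_nhds (hball _ hx s hsb u (by
        rw [Real.ball_eq_Ioo]; constructor <;> linarith [hu.1, hu.2])))).of_le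
          (by exact_mod_cast le_top))
    rw [e.left_inv (hb hxp)] at h1
    rw [← h1, inv_smul_smul₀ hε.ne']
  by_cases hsC : ‖s‖ ≤ C
  · have hsb : s ∈ Metric.ball 0 (C + 2) := mem_ball_zero_iff.2 (by linarith)
    have hzb : z ∈ Metric.ball 0 ρ := hball1 _ hx s hsb
    have hχ1 : χ s = 1 := χ.one_of_mem_closedBall (mem_closedBall_zero_iff.2 hsC)
    have horth : z ∈ orthant I (A.filter (fun i => 0 < t i) ∪ (T \ A)) ρ := by
      refine ⟨hzb, fun i hi => ?_⟩
      by_cases hiA : i ∈ A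
      -- For `i ∈ A` the contributions of `α i` cancel, so the sign pattern depends on `t` only.
      · have h1 : z i = ε * t i := by
          rw [hzi, hα i hiA, hs, PiLp.sub_apply]; ring
        rw [h1]
        refine ⟨mul_ne_zero hε.ne' (ht i), ?_⟩
        simp [hiA, hε]
      · have h1 : |s i| ≤ C := by
          have := abs_coord_sub_le s 0 i
          simp only [PiLp.zero_apply, sub_zero] at this
          exact this.trans hsC
        have h2 := abs_le.1 h1
        have h3 : ε * s i ≤ C * ε := by nlinarith
        have h4 : -(C * ε) ≤ ε * s i := by nlinarith
        by_cases hiT : i ∈ T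
        · have h5 : 0 < z i := by rw [hzi]; linarith [hpos i hi hiA hiT]
          exact ⟨h5.ne', by simp [h5, hiT, hiA]⟩
        · have h5 : z i < 0 := by rw [hzi]; linarith [hneg i hi hiA hiT]
          exact ⟨h5.ne, by simp [h5.le, hiT, hiA]⟩
    rw [indicator_of_mem hzb]
    simp only [hk, hχ1, one_smul, hmeanz hsb, hfh _ z horth, ← hz]
  · push Not at hsC
    have h1 : k (A.filter fun i => 0 < t i) (x, ε) s = 0 := by
      by_cases hsb : s ∈ Metric.ball 0 (C + 2)
      · simp only [hk, hmeanz hsb, hfar (hball1 _ hx s hsb) hsC, zero_mul, mul_zero, smul_zero]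
      · refine hkzero _ _ s hx fun h => hsb ?_
        exact Metric.closedBall_subset_ball (by linarith) h
    rw [h1]
    by_cases hzb : z ∈ Metric.ball 0 ρ
    · rw [indicator_of_mem hzb, hfar hzb hsC, zero_mul, mul_zero]
    · rw [indicator_of_notMem hzb]

end

/-! ### Local extension of the regularization on a stage. -/

section

variable {n c : ℕ} {V : Type} [NormedAddCommGroup V] [InnerProductSpace ℝ V] {M Sig : Set (E n)}
  {D : BranchData M Sig c V} {T : Finset (Finset (Fin c))} {A : Set (Amb n c V)} {f m : E n → ℝ}

theorem isOpen_regDomain_pos (hM : IsOpen M) (hm : HasCompactSupport m) :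
    IsOpen {q ∈ regDomain M m | 0 < q.2} := by
  rw [isOpen_iff_mem_nhds]
  rintro q ⟨hq, hpos⟩
  have hev : ∀ᶠ q' in 𝓝 q, ∀ t ∈ tsupport m, q'.1 - q'.2 • t ∈ M := by
    refine hm.isCompact.eventually_forall_of_forall_eventually fun t ht => ?_
    have hc : Continuous fun z : (E n × ℝ) × E n => z.1.1 - z.1.2 • z.2 := by fun_prop
    exact hc.continuousAt.eventually (hM.mem_nhds (hq.2.2 t ht))
  filter_upwards [hev, continuous_snd.continuousAt.eventually (lt_mem_nhds hpos),
    continuous_fst.continuousAt.eventually (hM.mem_nhds hq.1)] with q' h1 h2 h3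
  exact ⟨⟨h3, h2.le, h1⟩, h2⟩

/-- The product of the radii of the blowings-up whose center is contained in the branch `j`. -/
def radIn (j : Fin c) (w : Amb n c V) : ℝ := ∏ J with j ∈ J, w.r J

/-- The product of `b` and of the radii of the blowings-up whose center is not contained in the
branch `j`. -/
def radOut (j : Fin c) (w : Amb n c V) : ℝ := w.b * ∏ J with j ∉ J, w.r J

theorem proj_snd_eq (j : Fin c) (w : Amb n c V) : w.proj.2 = radIn j w * radOut j w := by
  rw [radIn, radOut, mul_left_comm, Finset.prod_filter_mul_prod_filter_not]
  rfl

theorem contDiff_radOut {k : WithTop ℕ∞} (j : Fin c) :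
    ContDiff ℝ k (radOut j : Amb n c V → ℝ) :=
  contDiff_amb_b.mul (contDiff_prod fun J _ => contDiff_amb_r J)

theorem IsStage.radIn_nonneg (h : IsStage D T A) {w : Amb n c V} (hw : w ∈ A) (j : Fin c) :
    0 ≤ radIn j w := Finset.prod_nonneg fun J _ => h.r_nonneg w hw J

theorem IsStage.proj_snd_nonneg (h : IsStage D T A) {w : Amb n c V} (hw : w ∈ A) :
    0 ≤ w.proj.2 := mul_nonneg (h.b_nonneg w hw) (Finset.prod_nonneg fun J _ => h.r_nonneg w hw J)

open Classical in
/-- The indices of the coordinates vanishing on the branches of index in a set. -/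
def coordIdx (κ : Fin c → Fin n) (P : Fin c → Prop) : Finset (Fin n) :=
  (Finset.univ.filter P).image κ

theorem mem_coordIdx {κ : Fin c → Fin n} {P : Fin c → Prop} {i : Fin n} :
    i ∈ coordIdx κ P ↔ ∃ j, P j ∧ κ j = i := by simp [coordIdx]

/-- Coordinates of the ambient space whose products with radii are coordinates of `M`. -/
theorem IsStage.exists_coords (h : IsStage D T A) {p : E n} (hp : p ∈ M) :
    ∃ (e : OpenPartialHomeomorph (E n) (E n)) (κ : Fin c → Fin n) (z : Fin c → Amb n c V → ℝ),
      IsChartAt M p e ∧ InjOn κ {j | D.F j p = 0} ∧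
      (∀ x ∈ e.source, x ∈ Sig ↔ ∃ i ∈ coordIdx κ fun j => D.F j p = 0, e x i = 0) ∧
      ∀ j, D.F j p = 0 → ContDiffOn ℝ ∞ (z j) {w | w.x ∈ e.source} ∧
        ∀ w ∈ A, w.x ∈ e.source → e w.x (κ j) = radIn j w * z j w ∧ (z j w = 0 → w.F j = 0) := by
  obtain ⟨e, he, κ, hκ, hne, hU⟩ := D.chart p hp
  have hU' : ∀ j, ∃ U : E n → V, D.F j p = 0 → ContDiffOn ℝ ∞ U e.source ∧
      ∀ x ∈ e.source, U x ≠ 0 ∧ D.F j x = e x (κ j) • U x ∧ D.L j x = Submodule.span ℝ {U x} := by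
    intro j
    by_cases hj : D.F j p = 0
    · obtain ⟨U, h⟩ := hU j hj
      exact ⟨U, fun _ => h⟩
    · exact ⟨0, fun h => (hj h).elim⟩
  choose U hU using hU'
  refine ⟨e, κ, fun j w => inner ℝ (U j w.x) (w.F j) / ‖U j w.x‖ ^ 2, he, hκ, fun x hx => ?_,
    fun j hj => ⟨?_, fun w hw hwx => ?_⟩⟩
  · rw [D.mem_Sig, and_iff_right (he.1 hx)]
    constructor
    · rintro ⟨j, hj⟩
      have hjp : D.F j p = 0 := by
        by_contra hjp
        exact hne j hjp x hx hj
      obtain ⟨h1, h2, -⟩ := (hU j hjp).2 x hx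
      rw [hj] at h2
      exact ⟨κ j, mem_coordIdx.2 ⟨j, hjp, rfl⟩, (smul_eq_zero.1 h2.symm).resolve_right h1⟩
    · rintro ⟨_, hi, h0⟩
      obtain ⟨j, hj, rfl⟩ := mem_coordIdx.1 hi
      exact ⟨j, by rw [((hU j hj).2 x hx).2.1, h0, zero_smul]⟩
  · have h1 : ContDiffOn ℝ ∞ (fun w : Amb n c V => U j w.x) {w | w.x ∈ e.source} :=
      (hU j hj).1.comp contDiff_amb_x.contDiffOn fun w hw => hw
    refine (h1.inner ℝ (contDiff_amb_F j).contDiffOn).div (h1.norm_sq ℝ) fun w hw => ?_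
    exact pow_ne_zero _ (norm_ne_zero_iff.2 ((hU j hj).2 _ hw).1)
  · obtain ⟨h1, h2, h3⟩ := (hU j hj).2 _ hwx
    have h4 := h.F_mem w hw j
    rw [h3] at h4
    obtain ⟨a, ha⟩ := Submodule.mem_span_singleton.1 h4
    have h5 : inner ℝ (U j w.x) (w.F j) / ‖U j w.x‖ ^ 2 = a := by
      rw [← ha, real_inner_smul_right, real_inner_self_eq_norm_sq,
        mul_div_cancel_right₀ _ (pow_ne_zero _ (norm_ne_zero_iff.2 h1))]
    simp only [h5]
    refine ⟨smul_left_injective ℝ h1 ?_, fun h0 => by rw [← ha, h0, zero_smul]⟩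
    have h6 := h.F_eq w hw j
    rw [h2, ← ha, smul_smul] at h6
    exact h6

/-- Where `ε > 0` the regularization is already smooth. Over `ε = 0`, every branch through `w.x`
gives a coordinate `radIn j * z j`, while `ε = radIn j * radOut j`. Depending on whether `radOut j`
vanishes at `w`, either the coordinate dominates `ε` or the ratio `z j / radOut j` is smooth. -/
theorem IsStage.exists_local_extension (h : IsStage D T A) (hM : IsOpen M) (hm : IsMollifier m)
    (hSig : IsNormalCrossings M Sig) (hf : f ∈ PiecewiseSmooth M Sig) {w : Amb n c V} (hw : w ∈ A)
    (hwm : w.proj ∈ regDomain M m) (hwS : ¬ (w.b = 0 ∧ ∃ j, w.F j = 0)) :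
    ∃ O, IsOpen O ∧ w ∈ O ∧ ∃ G : Amb n c V → ℝ, ContDiffOn ℝ ∞ G O ∧ ∀ w' ∈ A, w' ∈ O →
      ¬ (w'.proj.2 = 0 ∧ w'.proj.1 ∈ Sig) → G w' = reg m f w'.proj := by
  rcases (h.proj_snd_nonneg hw).eq_or_lt with h0 | hpos
  swap
  · have hO := isOpen_regDomain_pos hM hm.2.2.2
    refine ⟨_, hO.preimage (contDiff_amb_proj (k := 0)).continuous, ⟨hwm, hpos⟩,
      fun w => reg m f w.proj, ?_, fun _ _ _ _ => rfl⟩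
    have h1 : ContDiffOn ℝ ∞ (reg m f) {q ∈ regDomain M m | 0 < q.2} := fun q hq =>
      (contDiffAt_reg hM hm (hSig.locallyIntegrableOn hf) hq.1 hq.2).contDiffWithinAt
    exact h1.comp contDiff_amb_proj.contDiffOn fun w hw => hw
  obtain ⟨e, κ, z, he, hκ, hI, hz⟩ := h.exists_coords (h.x_mem w hw)
  set K : Fin c → Prop := fun j => D.F j w.x = 0 with hK
  -- If `z j` vanished, so would `F j`, and by `prod_ne` the only factor of `radOut j` which can
  -- vanish is `b`; then `w` would lie in the discontinuity locus.
  have hzne : ∀ j, K j → radOut j w = 0 → z j w ≠ 0 := by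
    intro j hj hr hz0
    have h1 := ((hz j hj).2 w hw he.2.1).2 hz0
    have h2 := h.prod_ne w hw j h1
    exact hwS ⟨(mul_eq_zero.1 hr).resolve_right h2, j, h1⟩
  set A' := coordIdx κ fun j => K j ∧ radOut j w ≠ 0 with hA'
  set T' := coordIdx κ fun j => K j ∧ 0 < z j w with hT'
  have hxc : ContinuousAt (Amb.x : Amb n c V → E n) w := (contDiff_amb_x (k := 0)).continuous.continuousAt
  have hsrc : ∀ᶠ w' in 𝓝 w, Amb.x w' ∈ e.source :=
    hxc.eventually (e.open_source.mem_nhds he.2.1)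
  have hzc : ∀ j, K j → ContinuousAt (z j) w := fun j hj =>
    (hz j hj).1.continuousOn.continuousAt hsrc
  have hrc : ∀ j, ContinuousAt (radOut j) w := fun j => (contDiff_radOut (k := 0) j).continuous.continuousAt
  have hprojc : ContinuousAt (Amb.proj : Amb n c V → E n × ℝ) w :=
    (contDiff_amb_proj (k := 0)).continuous.continuousAt
  have hwproj : w.proj = (w.x, 0) := Prod.ext rfl h0.symm
  have hnear : ∀ C : ℝ, ∀ O₁ : Set (E n × ℝ), IsOpen O₁ → (w.x, (0 : ℝ)) ∈ O₁ →
      ∃ O, IsOpen O ∧ w ∈ O ∧ ∀ w' ∈ O, w'.x ∈ e.source ∧ w'.proj ∈ O₁ ∧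
        (∀ j, K j → radOut j w ≠ 0 → radOut j w' ≠ 0) ∧
        (∀ j, K j → radOut j w = 0 → 0 < z j w → C * radOut j w' < z j w') ∧
        (∀ j, K j → radOut j w = 0 → z j w < 0 → z j w' < -(C * radOut j w')) := by
    intro C O₁ hO₁ hmem
    have h1 : ∀ᶠ w' in 𝓝 w, ∀ j, K j → radOut j w ≠ 0 → radOut j w' ≠ 0 :=
      eventually_all.2 fun j => by
        by_cases h1 : radOut j w ≠ 0
        · exact ((hrc j).eventually_ne h1).mono fun w' h _ _ => h
        · exact Eventually.of_forall fun _ _ h2 => (h1 h2).elim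
    have h2 : ∀ᶠ w' in 𝓝 w, ∀ j, K j → radOut j w = 0 → 0 < z j w → C * radOut j w' < z j w' :=
      eventually_all.2 fun j => by
        by_cases h1 : K j ∧ radOut j w = 0 ∧ 0 < z j w
        · have h2 : C * radOut j w < z j w := by rw [h1.2.1, mul_zero]; exact h1.2.2
          exact ((continuousAt_const.mul (hrc j)).eventually_lt (hzc j h1.1) h2).mono
            fun _ h _ _ _ => h
        · exact Eventually.of_forall fun _ a b c => (h1 ⟨a, b, c⟩).elim
    have h3 : ∀ᶠ w' in 𝓝 w, ∀ j, K j → radOut j w = 0 → z j w < 0 → z j w' < -(C * radOut j w') :=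
      eventually_all.2 fun j => by
        by_cases h1 : K j ∧ radOut j w = 0 ∧ z j w < 0
        · have h2 : z j w < -(C * radOut j w) := by rw [h1.2.1, mul_zero, neg_zero]; exact h1.2.2
          exact ((hzc j h1.1).eventually_lt (continuousAt_const.mul (hrc j)).neg h2).mono
            fun _ h _ _ _ => h
        · exact Eventually.of_forall fun _ a b c => (h1 ⟨a, b, c⟩).elim
    have h4 : ∀ᶠ w' in 𝓝 w, Amb.proj w' ∈ O₁ :=
      hprojc.eventually (hO₁.mem_nhds (by rw [hwproj]; exact hmem))
    obtain ⟨O, hO, hOo, hwO⟩ := eventually_nhds_iff.1 (hsrc.and (h4.and (h1.and (h2.and h3))))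
    exact ⟨O, hOo, hwO, hO⟩
  -- A zero of `radIn j` lies over `ε = 0` and over the branch `j`, so it lies over `Sig × {0}`.
  -- Positivity lets inequalities between `z j` and `radOut j` be multiplied by `radIn j`.
  have hPpos : ∀ j, K j → ∀ w' ∈ A, w'.x ∈ e.source → ¬ (w'.proj.2 = 0 ∧ w'.proj.1 ∈ Sig) →
      0 < radIn j w' := by
    intro j hj w' hw' hx' hS
    refine (h.radIn_nonneg hw' j).lt_of_ne' fun hr => hS ⟨?_, ?_⟩
    · rw [proj_snd_eq j, hr, zero_mul]
    · refine (hI _ hx').2 ⟨κ j, mem_coordIdx.2 ⟨j, hj, rfl⟩, ?_⟩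
      rw [((hz j hj).2 w' hw' hx').1, hr, zero_mul]
  have hsign : ∀ C : ℝ, ∀ w' ∈ A, w'.x ∈ e.source → ¬ (w'.proj.2 = 0 ∧ w'.proj.1 ∈ Sig) →
      (∀ j, K j → radOut j w = 0 → 0 < z j w → C * radOut j w' < z j w') →
      (∀ j, K j → radOut j w = 0 → z j w < 0 → z j w' < -(C * radOut j w')) →
      (∀ i ∈ coordIdx κ K, i ∉ A' → i ∈ T' → C * w'.proj.2 < e w'.x i) ∧
      (∀ i ∈ coordIdx κ K, i ∉ A' → i ∉ T' → e w'.x i < -(C * w'.proj.2)) := by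
    intro C w' hw' hx' hS h1 h2
    refine ⟨fun i hi hiA hiT => ?_, fun i hi hiA hiT => ?_⟩
    · obtain ⟨j, ⟨hj, hjz⟩, rfl⟩ := mem_coordIdx.1 hiT
      have hr : radOut j w = 0 := by
        by_contra hr
        exact hiA (mem_coordIdx.2 ⟨j, ⟨hj, hr⟩, rfl⟩)
      rw [((hz j hj).2 w' hw' hx').1, proj_snd_eq j, mul_left_comm]
      exact mul_lt_mul_of_pos_left (h1 j hj hr hjz) (hPpos j hj w' hw' hx' hS)
    · obtain ⟨j, hj, rfl⟩ := mem_coordIdx.1 hi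
      have hr : radOut j w = 0 := by
        by_contra hr
        exact hiA (mem_coordIdx.2 ⟨j, ⟨hj, hr⟩, rfl⟩)
      have hjz : z j w < 0 := by
        refine lt_of_le_of_ne (not_lt.1 fun h => hiT (mem_coordIdx.2 ⟨j, ⟨hj, h⟩, rfl⟩))
          (hzne j hj hr)
      rw [((hz j hj).2 w' hw' hx').1, proj_snd_eq j, mul_left_comm, ← mul_neg]
      exact mul_lt_mul_of_pos_left (h2 j hj hr hjz) (hPpos j hj w' hw' hx' hS)
  -- Without ratios, points with `ε = 0` outside `Sig` have to be included, and the lemma on signs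
  -- covers them. One ratio forces `ε > 0` at the points to be compared, because both `radIn j` and
  -- `radOut j` are nonzero there.
  rcases A'.eq_empty_or_nonempty with hempty | ⟨i₀, hi₀⟩
  · obtain ⟨C, -, O₁, hO₁, hmem, H, hH, hreg⟩ := exists_extension_of_signs he hI hm hf T'
    obtain ⟨O, hO, hwO, hOw⟩ := hnear C O₁ hO₁ hmem
    refine ⟨O, hO, hwO, fun w => H w.proj,
      hH.comp contDiff_amb_proj.contDiffOn fun w' hw' => (hOw w' hw').2.1,
      fun w' hw' hw'O hS => ?_⟩
    obtain ⟨h1, h2, -, h4, h5⟩ := hOw w' hw'O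
    obtain ⟨h6, h7⟩ := hsign C w' hw' h1 hS h4 h5
    rw [hempty] at h6 h7
    exact (hreg w'.x w'.proj.2 h2 (h.proj_snd_nonneg hw') (fun i hi => h6 i hi (by simp))
      fun i hi => h7 i hi (by simp)).symm
  · obtain ⟨C, -, O₁, hO₁, hmem, H, hH, hreg⟩ := exists_extension_of_ratios he hI hm hf A' T'
    obtain ⟨O, hO, hwO, hOw⟩ := hnear C O₁ hO₁ hmem
    have : Nonempty (Fin c) := by
      obtain ⟨j, -, -⟩ := mem_coordIdx.1 hi₀
      exact ⟨j⟩
    set κ' : Fin n → Fin c := Function.invFunOn κ {j | K j} with hκ'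
    have hκκ' : ∀ j, K j → κ' (κ j) = j := fun j hj => hκ.leftInvOn_invFunOn hj
    set α : Amb n c V → E n := fun w' => WithLp.toLp 2 fun i =>
      if i ∈ A' then z (κ' i) w' / radOut (κ' i) w' else 0 with hα
    refine ⟨O, hO, hwO, fun w' => H (w'.proj, α w'), ?_, fun w' hw' hw'O hS => ?_⟩
    · refine hH.comp (contDiff_amb_proj.contDiffOn.prodMk (contDiffOn_euclidean.2 fun i => ?_))
        fun w' hw' => ⟨(hOw w' hw').2.1, mem_univ _⟩
      refine contDiffOn_ite (fun hi => ?_) fun _ => contDiffOn_const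
      obtain ⟨j, ⟨hj, hjr⟩, rfl⟩ := mem_coordIdx.1 hi
      rw [hκκ' j hj]
      exact ((hz j hj).1.mono fun w' hw' => (hOw w' hw').1).div (contDiff_radOut j).contDiffOn
        fun w' hw' => (hOw w' hw').2.2.1 j hj hjr
    · obtain ⟨h1, h2, h3, h4, h5⟩ := hOw w' hw'O
      obtain ⟨h6, h7⟩ := hsign C w' hw' h1 hS h4 h5
      have hpos : 0 < w'.proj.2 := by
        obtain ⟨j, ⟨hj, hjr⟩, -⟩ := mem_coordIdx.1 hi₀
        refine (h.proj_snd_nonneg hw').lt_of_ne' ?_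
        rw [proj_snd_eq j]
        exact mul_ne_zero (hPpos j hj w' hw' h1 hS).ne' (h3 j hj hjr)
      refine (hreg w'.x w'.proj.2 (α w') h2 hpos (fun i hi => ?_) h6 h7).symm
      have hi' := hi
      obtain ⟨j, ⟨hj, hjr⟩, rfl⟩ := mem_coordIdx.1 hi
      have h8 := h3 j hj hjr
      simp only [hα, hi', if_true, hκκ' j hj]
      rw [((hz j hj).2 w' hw' h1).1, proj_snd_eq j]
      field_simp

/-- Near a point of the initial manifold outside the discontinuity locus, the points lying over the
complement of `Sig` lie over the same connected component. -/
theorem IsStage.exists_nhds_component (h : IsStage D T A) {w : Amb n c V} (hw : w ∈ A)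
    (hF : ∀ j, w.F j ≠ 0) :
    ∃ O ∈ 𝓝 w, ∀ w₁ ∈ A, ∀ w₂ ∈ A, w₁ ∈ O → w₂ ∈ O → (∀ j, D.F j w₁.x ≠ 0) →
      (∀ j, D.F j w₂.x ≠ 0) → w₂.x ∈ connectedComponentIn (M \ Sig) w₁.x := by
  obtain ⟨e, κ, z, he, hκ, hI, hz⟩ := h.exists_coords (h.x_mem w hw)
  obtain ⟨ρ, hρ, hρt⟩ := exists_ball_subset_target he
  have hxc : ContinuousAt (Amb.x : Amb n c V → E n) w := (contDiff_amb_x (k := 0)).continuous.continuousAt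
  have hsrc : ∀ᶠ w' in 𝓝 w, Amb.x w' ∈ e.source :=
    hxc.eventually (e.open_source.mem_nhds he.2.1)
  have hball : ∀ᶠ w' in 𝓝 w, e (Amb.x w') ∈ Metric.ball 0 ρ := by
    refine (ContinuousAt.comp (g := e) (e.continuousAt he.2.1) hxc).eventually
      (Metric.isOpen_ball.mem_nhds ?_)
    simpa [he.2.2.1] using hρ
  have hev : ∀ᶠ w' in 𝓝 w, ∀ j, D.F j w.x = 0 → 0 < z j w * z j w' :=
    eventually_all.2 fun j => by
      by_cases hj : D.F j w.x = 0
      · have hzj : z j w ≠ 0 := fun h0 => hF j (((hz j hj).2 w hw he.2.1).2 h0)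
        have hzc : ContinuousAt (z j) w := (hz j hj).1.continuousOn.continuousAt hsrc
        exact ((continuousAt_const.mul hzc).eventually
          (lt_mem_nhds (mul_self_pos.2 hzj))).mono fun _ h _ => h
      · exact Eventually.of_forall fun _ h => (hj h).elim
  refine ⟨_, hsrc.and (hball.and hev), fun w₁ hw₁ w₂ hw₂ hO₁ hO₂ hF₁ hF₂ => ?_⟩
  -- At these points `radIn j > 0` and `z j` has its sign at `w`, so the sign of every coordinate of
  -- a branch is fixed: all of them lie over one orthant.
  have key : ∀ w' ∈ A, Amb.x w' ∈ e.source ∧ e (Amb.x w') ∈ Metric.ball 0 ρ ∧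
      (∀ j, D.F j w.x = 0 → 0 < z j w * z j w') → (∀ j, D.F j w'.x ≠ 0) →
      e w'.x ∈ orthant (coordIdx κ fun j => D.F j w.x = 0)
        (coordIdx κ fun j => D.F j w.x = 0 ∧ 0 < z j w) ρ := by
    rintro w' hw' ⟨h1, h2, h3⟩ hF'
    refine ⟨h2, fun i hi => ?_⟩
    obtain ⟨j, hj, rfl⟩ := mem_coordIdx.1 hi
    have h4 : 0 < radIn j w' := by
      refine (h.radIn_nonneg hw' j).lt_of_ne' fun hr => hF' j ?_
      rw [h.F_eq w' hw' j]
      change radIn j w' • _ = _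
      rw [hr, zero_smul]
    have h5 := h3 j hj
    rw [((hz j hj).2 w' hw' h1).1]
    refine ⟨mul_ne_zero h4.ne' (right_ne_zero_of_mul h5.ne'), ?_⟩
    rw [mul_pos_iff_of_pos_left h4]
    constructor
    · intro h6
      exact mem_coordIdx.2 ⟨j, ⟨hj, pos_of_mul_pos_left h5 h6.le⟩, rfl⟩
    · intro h6
      obtain ⟨j', ⟨hj', hz'⟩, hjj⟩ := mem_coordIdx.1 h6
      rw [hκ hj' hj hjj] at hz'
      exact pos_of_mul_pos_right h5 hz'.le
  have h1 := image_orthant_subset he hI hρt (key w₁ hw₁ hO₁ hF₁)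
  have h2 := h1 (mem_image_of_mem _ (key w₂ hw₂ hO₂ hF₂))
  rwa [e.left_inv hO₁.1, e.left_inv hO₂.1] at h2

end

/-! ### The extension operator on a regularized space. -/

section

variable {n c : ℕ} {V : Type} [NormedAddCommGroup V] [InnerProductSpace ℝ V] {M Sig : Set (E n)}
  {D : BranchData M Sig c V} {T : Finset (Finset (Fin c))} {X : RegSpace (n + 1)}
  {ι : X.carrier → Amb n c V} {f m : E n → ℝ}

/-- The extension by continuity of the regularization of `f` to a blown-up space. -/
def regExtension (ι : X.carrier → Amb n c V) (m f : E n → ℝ) (q : X.carrier) : ℝ :=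
  limUnder (𝓝[{q' | 0 < (ι q').proj.2}] q) fun q' => reg m f (ι q').proj

theorem IsStageModel.neBot (h : IsStageModel D T X ι) (q : X.carrier) :
    (𝓝[{q' | 0 < (ι q').proj.2}] q).NeBot := by
  rw [← mem_closure_iff_nhdsWithin_neBot, h.model.emb.closure_eq_preimage_closure_image]
  refine closure_mono ?_ (h.stage.dense (ι q) (mem_range_self q))
  rintro _ ⟨⟨q', rfl⟩, hb, hr⟩
  exact ⟨q', mul_pos hb (Finset.prod_pos fun J _ => hr J), rfl⟩

/-- The points over `ε > 0` are dense, and there the regularization equals the continuous function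
`G`. So the limit is `G`, even at points over `Sig × {0}`, where `f` itself prescribes no value. -/
theorem IsStageModel.exists_regExtension_eq (h : IsStageModel D T X ι) (hM : IsOpen M)
    (hm : IsMollifier m) (hSig : IsNormalCrossings M Sig) (hf : f ∈ PiecewiseSmooth M Sig)
    {q : X.carrier} (hq : (ι q).proj ∈ regDomain M m) (hqS : q ∉ X.Sig) :
    ∃ O, IsOpen O ∧ ι q ∈ O ∧ ∃ G : Amb n c V → ℝ, ContDiffOn ℝ ∞ G O ∧
      (∀ q', ι q' ∈ O → regExtension ι m f q' = G (ι q')) ∧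
      ∀ q', ι q' ∈ O → ¬ ((ι q').proj.2 = 0 ∧ (ι q').proj.1 ∈ Sig) →
        regExtension ι m f q' = reg m f (ι q').proj := by
  rw [h.Sig_eq] at hqS
  obtain ⟨O, hO, hqO, G, hG, hGr⟩ :=
    h.stage.exists_local_extension hM hm hSig hf (mem_range_self q) hq hqS
  have key : ∀ q', ι q' ∈ O → regExtension ι m f q' = G (ι q') := by
    intro q' hq'
    have := h.neBot q'
    refine Tendsto.limUnder_eq ?_
    have h1 : ContinuousAt (fun q => G (ι q)) q' :=
      ContinuousAt.comp (hG.continuousOn.continuousAt (hO.mem_nhds hq'))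
        h.model.emb.continuous.continuousAt
    refine (h1.tendsto.mono_left nhdsWithin_le_nhds).congr' ?_
    filter_upwards [self_mem_nhdsWithin, mem_nhdsWithin_of_mem_nhds
      ((hO.preimage h.model.emb.continuous).mem_nhds hq')] with q'' h2 h3
    exact hGr _ (mem_range_self _) h3 fun h4 => (ne_of_gt h2) h4.1
  exact ⟨O, hO, hqO, G, hG, key, fun q' hq' hS => (key q' hq').trans
    (hGr _ (mem_range_self _) hq' hS)⟩

theorem IsStageModel.mem_regDomain (h : IsStageModel D T X ι) {q : X.carrier} (hM0 : q ∈ X.M) :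
    (ι q).proj ∈ regDomain M m := by
  rw [h.M_eq] at hM0
  have h0 : (ι q).proj.2 = 0 := mul_eq_zero_of_left hM0 _
  refine ⟨h.stage.x_mem _ (mem_range_self q), h0.ge, fun t _ => ?_⟩
  rw [h0, zero_smul, sub_zero]
  exact h.stage.x_mem _ (mem_range_self q)

theorem IsStageModel.mem_closure_generic (h : IsStageModel D T X ι) {q : X.carrier} (hq : q ∈ X.M) :
    q ∈ closure {q' | q' ∈ X.M ∧ ∀ j, D.F j (ι q').x ≠ 0} := by
  rw [h.M_eq] at hq
  rw [h.model.emb.closure_eq_preimage_closure_image]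
  refine closure_mono ?_ (h.stage.dense_init (ι q) (mem_range_self q) hq)
  rintro _ ⟨⟨q', rfl⟩, hb, hr, hF⟩
  refine ⟨q', ⟨by rw [h.M_eq]; exact hb, fun j => ?_⟩, rfl⟩
  rw [h.stage.F_eq _ (mem_range_self q')]
  exact smul_ne_zero (Finset.prod_pos fun J _ => hr J).ne' (hF j)

theorem IsStageModel.exists_nhds_component (h : IsStageModel D T X ι) {q : X.carrier}
    (hq : q ∈ X.M \ X.Sig) :
    ∃ O, IsOpen O ∧ q ∈ O ∧ ∀ q₁ q₂, q₁ ∈ O → q₂ ∈ O → (∀ j, D.F j (ι q₁).x ≠ 0) →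
      (∀ j, D.F j (ι q₂).x ≠ 0) → (ι q₂).x ∈ connectedComponentIn (M \ Sig) (ι q₁).x := by
  have h1 := hq.1
  have h2 := hq.2
  rw [h.M_eq] at h1
  rw [h.Sig_eq] at h2
  obtain ⟨O, hO, hcc⟩ := h.stage.exists_nhds_component (mem_range_self q)
    fun j hj => h2 ⟨h1, j, hj⟩
  obtain ⟨O', hO', hOo, hqO⟩ := mem_nhds_iff.1 hO
  exact ⟨ι ⁻¹' O', hOo.preimage h.model.emb.continuous, hqO, fun q₁ q₂ h₁ h₂ =>
    hcc _ (mem_range_self _) _ (mem_range_self _) (hO' h₁) (hO' h₂)⟩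

/-- The generic points near a connected subset of `X.M \ X.Sig` lie over the same component. -/
theorem IsStageModel.exists_component (h : IsStageModel D T X ι) {p : X.carrier}
    (hp : p ∈ X.M \ X.Sig) :
    ∃ y ∈ M \ Sig, ∀ q ∈ connectedComponentIn (X.M \ X.Sig) p, ∃ O, IsOpen O ∧ q ∈ O ∧
      ∀ q' ∈ O, (∀ j, D.F j (ι q').x ≠ 0) → (ι q').x ∈ connectedComponentIn (M \ Sig) y := by
  obtain ⟨O, hO, hpO, hOc⟩ := h.exists_nhds_component hp
  obtain ⟨q₀, hq₀O, hq₀M, hq₀F⟩ := mem_closure_iff.1 (h.mem_closure_generic hp.1) O hO hpO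
  set y := (ι q₀).x with hy
  have hyM : y ∈ M \ Sig := by
    refine ⟨h.stage.x_mem _ (mem_range_self q₀), fun h1 => ?_⟩
    obtain ⟨-, j, hj⟩ := (D.mem_Sig _).1 h1
    exact hq₀F j hj
  refine ⟨y, hyM, ?_⟩
  set G : Set X.carrier → Prop := fun O => ∀ q' ∈ O, (∀ j, D.F j (ι q').x ≠ 0) →
    (ι q').x ∈ connectedComponentIn (M \ Sig) y with hG
  -- The open sets `u` and `v` collect the points near which all, respectively none, of the generic
  -- points lie over the component of `y`. They cover `X.M \ X.Sig`, and they do not meet in it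
  -- because generic points are dense. Connectedness then decides for `u`.
  set u : Set X.carrier := ⋃₀ {O | IsOpen O ∧ G O} with hu
  set v : Set X.carrier := ⋃₀ {O | IsOpen O ∧ ∀ q' ∈ O, (∀ j, D.F j (ι q').x ≠ 0) →
    (ι q').x ∉ connectedComponentIn (M \ Sig) y} with hv
  have huo : IsOpen u := isOpen_sUnion fun O hO => hO.1
  have hvo : IsOpen v := isOpen_sUnion fun O hO => hO.1
  have hcov : X.M \ X.Sig ⊆ u ∪ v := by
    intro q hq
    obtain ⟨O, hO, hqO, hOc⟩ := h.exists_nhds_component hq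
    by_cases hex : ∃ q₁ ∈ O, (∀ j, D.F j (ι q₁).x ≠ 0) ∧
      (ι q₁).x ∈ connectedComponentIn (M \ Sig) y
    · obtain ⟨q₁, hq₁, hF₁, hc₁⟩ := hex
      refine Or.inl ⟨O, ⟨hO, fun q' hq' hF' => ?_⟩, hqO⟩
      rw [connectedComponentIn_eq hc₁]
      exact hOc q₁ q' hq₁ hq' hF₁ hF'
    · exact Or.inr ⟨O, ⟨hO, fun q' hq' hF' hc' => hex ⟨q', hq', hF', hc'⟩⟩, hqO⟩
  have hdisj : Disjoint (X.M \ X.Sig ∩ u) v := by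
    rw [Set.disjoint_left]
    rintro q ⟨hq, O₁, ⟨hO₁, h₁⟩, hqO₁⟩ ⟨O₂, ⟨hO₂, h₂⟩, hqO₂⟩
    obtain ⟨q', hq', -, hF'⟩ := mem_closure_iff.1 (h.mem_closure_generic hq.1) (O₁ ∩ O₂)
      (hO₁.inter hO₂) ⟨hqO₁, hqO₂⟩
    exact h₂ q' hq'.2 hF' (h₁ q' hq'.1 hF')
  have hpre : IsPreconnected (connectedComponentIn (X.M \ X.Sig) p) := isPreconnected_connectedComponentIn
  have hpu : p ∈ u := ⟨O, ⟨hO, fun q' hq' hF' => hOc q₀ q' hq₀O hq' hq₀F hF'⟩, hpO⟩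
  have hsub : connectedComponentIn (X.M \ X.Sig) p ⊆ u := by
    intro q hq
    by_contra hqu
    have hqv : q ∈ v := (hcov (connectedComponentIn_subset _ _ hq)).resolve_left hqu
    obtain ⟨q', hq', hq'u, hq'v⟩ := hpre u v huo hvo
      ((connectedComponentIn_subset _ _).trans hcov)
      ⟨p, mem_connectedComponentIn hp, hpu⟩ ⟨q, hq, hqv⟩
    exact Set.disjoint_left.1 hdisj ⟨connectedComponentIn_subset _ _ hq', hq'u⟩ hq'v
  intro q hq
  obtain ⟨O, ⟨hO, hGO⟩, hqO⟩ := hsub hq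
  exact ⟨O, hO, hqO, hGO⟩

/-- Off the locus the extension is locally a smooth function of the ambient coordinates. On a
component of the initial manifold minus the locus it equals the pullback of the smooth extension `g`
of one piece of `f`: both are continuous and agree at the generic points, all of which lie over one
component of `M \ Sig`. -/
theorem IsStageModel.regExtension_mem (h : IsStageModel D T X ι) (hM : IsOpen M)
    (hm : IsMollifier m) (hSig : IsNormalCrossings M Sig) (hf : f ∈ PiecewiseSmooth M Sig) :
    regExtension ι m f ∈ X.PiecewiseSmooth {q | (ι q).proj ∈ regDomain M m} := by
  refine ⟨fun q hq => ?_, fun p hp => ?_⟩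
  · obtain ⟨O, hO, hqO, G, hG, hGr, -⟩ := h.exists_regExtension_eq hM hm hSig hf hq.1 hq.2
    have h1 := h.model.contMDiffOn_comp (s := ι ⁻¹' O) hG fun q hq => hq
    have h2 := (h1.congr fun q' hq' => hGr q' hq').contMDiffAt
      ((hO.preimage h.model.emb.continuous).mem_nhds hqO)
    exact h2.contMDiffWithinAt
  · have hMU : X.M ∩ {q | (ι q).proj ∈ regDomain M m} = X.M :=
      inter_eq_left.2 fun q hq => h.mem_regDomain hq
    rw [hMU] at hp ⊢
    obtain ⟨y, hy, hcomp⟩ := h.exists_component hp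
    obtain ⟨g, hg, hfg⟩ := hf.2 y hy
    refine ⟨fun q => g (ι q).x, ?_, fun q hq => ?_⟩
    · exact h.model.contMDiffOn_comp (hg.comp contDiff_amb_x.contDiffOn fun w hw => hw)
        fun q _ => h.stage.x_mem _ (mem_range_self q)
    · have hqM := connectedComponentIn_subset _ _ hq
      obtain ⟨O, hO, hqO, G, hG, hGr, hGr'⟩ :=
        h.exists_regExtension_eq hM hm hSig hf (h.mem_regDomain hqM.1) hqM.2
      obtain ⟨O', hO', hqO', hc⟩ := hcomp q hq
      have hcont : ContinuousAt (fun q => G (ι q)) q :=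
        ContinuousAt.comp (hG.continuousOn.continuousAt (hO.mem_nhds hqO))
          h.model.emb.continuous.continuousAt
      have hcont' : ContinuousAt (fun q => g (ι q).x) q :=
        ContinuousAt.comp (f := fun q => (ι q).x) (hg.continuousOn.continuousAt (hM.mem_nhds
          (h.stage.x_mem _ (mem_range_self q))))
          ((contDiff_amb_x (k := 0)).continuous.comp h.model.emb.continuous).continuousAt
      have hne : (𝓝[{q' | q' ∈ X.M ∧ ∀ j, D.F j (ι q').x ≠ 0}] q).NeBot :=
        mem_closure_iff_nhdsWithin_neBot.1 (h.mem_closure_generic hqM.1)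
      rw [hGr q hqO]
      refine tendsto_nhds_unique (l := 𝓝[{q' | q' ∈ X.M ∧ ∀ j, D.F j (ι q').x ≠ 0}] q)
        (hcont.tendsto.mono_left nhdsWithin_le_nhds)
        ((hcont'.tendsto.mono_left nhdsWithin_le_nhds).congr' ?_)
      filter_upwards [self_mem_nhdsWithin, mem_nhdsWithin_of_mem_nhds
        ((hO.preimage h.model.emb.continuous).mem_nhds hqO),
        mem_nhdsWithin_of_mem_nhds (hO'.mem_nhds hqO')] with q' h1 h2 h3
      have h4 : (ι q').proj.2 = 0 := by
        have := h1.1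
        rw [h.M_eq] at this
        exact mul_eq_zero_of_left this _
      have h5 : (ι q').x ∉ Sig := fun h6 => by
        obtain ⟨-, j, hj⟩ := (D.mem_Sig _).1 h6
        exact h1.2 j hj
      rw [← hGr q' h2, hGr' q' h2 fun h6 => h5 h6.2, ← hfg (hc q' h3 h1.2)]
      simp only [reg, h4, lt_irrefl, if_false]
      rfl

theorem IsStageModel.regExtension_eq (h : IsStageModel D T X ι) (hM : IsOpen M)
    (hm : IsMollifier m) (hSig : IsNormalCrossings M Sig) (hf : f ∈ PiecewiseSmooth M Sig)
    {q : X.carrier} (hq : (ι q).proj ∈ regDomain M m)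
    (hqS : ¬ ((ι q).proj.2 = 0 ∧ (ι q).proj.1 ∈ Sig)) :
    regExtension ι m f q = reg m f (ι q).proj := by
  obtain ⟨O, -, hqO, G, -, -, hG⟩ := h.exists_regExtension_eq hM hm hSig hf hq fun hS => by
    rw [h.Sig_eq] at hS
    obtain ⟨hb, j, hj⟩ := hS
    refine hqS ⟨mul_eq_zero_of_left hb _, (D.mem_Sig _).2
      ⟨h.stage.x_mem _ (mem_range_self q), j, ?_⟩⟩
    change D.F j (ι q).x = 0
    rw [h.stage.F_eq _ (mem_range_self q), hj, smul_zero]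
  exact hG q hqO hqS

/-- The function `regExtension` need not depend linearly on `f` at the irrelevant points, where no
limit is guaranteed. Instead, the pairs `(f, g)` such that `g` extends the regularization of `f`
form a vector space which projects onto the space of all `f`; a linear section of this projection is
used. -/
theorem IsStageModel.exists_linearMap (h : IsStageModel D T X ι) (hM : IsOpen M)
    (hm : IsMollifier m) (hSig : IsNormalCrossings M Sig) :
    ∃ L : PiecewiseSmooth M Sig →ₗ[ℝ] X.PiecewiseSmooth {q | (ι q).proj ∈ regDomain M m},
      ∀ (f : PiecewiseSmooth M Sig) (q : X.carrier), (ι q).proj ∈ regDomain M m →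
        ¬ ((ι q).proj.2 = 0 ∧ (ι q).proj.1 ∈ Sig) → (L f).1 q = reg m f.1 (ι q).proj := by
  set U : Set X.carrier := {q | (ι q).proj ∈ regDomain M m} with hU
  let W : Submodule ℝ (PiecewiseSmooth M Sig × X.PiecewiseSmooth U) :=
    { carrier := {z | ∀ q ∈ U, ¬ ((ι q).proj.2 = 0 ∧ (ι q).proj.1 ∈ Sig) →
        z.2.1 q = reg m z.1.1 (ι q).proj}
      add_mem' := fun {a b} ha hb q hq hS => by
        change a.2.1 q + b.2.1 q = reg m (a.1.1 + b.1.1) _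
        rw [reg_add hm (hSig.locallyIntegrableOn a.1.2) (hSig.locallyIntegrableOn b.1.2) hq,
          ha q hq hS, hb q hq hS]
      zero_mem' := fun q _ _ => by
        change (0 : ℝ) = reg m 0 _
        have := reg_smul (m := m) (f := (0 : E n → ℝ)) 0 (ι q).proj
        rw [zero_smul, zero_mul] at this
        exact this.symm
      smul_mem' := fun a z hz q hq hS => by
        change a * z.2.1 q = reg m (a • z.1.1) _
        rw [reg_smul, hz q hq hS] }
  have hsurj : Function.Surjective (LinearMap.fst ℝ _ _ ∘ₗ W.subtype) := fun f =>
    ⟨⟨(f, ⟨regExtension ι m f.1, h.regExtension_mem hM hm hSig f.2⟩), fun q hq hS =>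
      h.regExtension_eq hM hm hSig f.2 hq hS⟩, rfl⟩
  obtain ⟨s, hs⟩ := LinearMap.exists_rightInverse_of_surjective _ (LinearMap.range_eq_top.2 hsurj)
  refine ⟨LinearMap.snd ℝ _ _ ∘ₗ W.subtype ∘ₗ s, fun f q hq hS => ?_⟩
  have h1 : (s f).1.1 = f := LinearMap.congr_fun hs f
  have h2 := (s f).2 q hq hS
  rw [h1] at h2
  exact h2

end

/-! ### Hadamard's lemma and vector valued equations. -/

section

variable {n : ℕ} {M : Set (E n)}

section Hadamard

variable {W : Type*} [NormedAddCommGroup W] [NormedSpace ℝ W] [CompleteSpace W]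

/-- Hadamard's lemma: a smooth function vanishing where a coordinate vanishes is a multiple of this
coordinate. -/
theorem exists_eq_coord_smul {G : E n → W} {ρ : ℝ} (hG : ContDiffOn ℝ ∞ G (Metric.ball 0 ρ))
    (i : Fin n) (h0 : ∀ z ∈ Metric.ball 0 ρ, z i = 0 → G z = 0) :
    ∃ U : E n → W, ContDiffOn ℝ ∞ U (Metric.ball 0 (ρ / 4)) ∧
      ∀ z ∈ Metric.ball 0 (ρ / 4), G z = z i • U z := by
  set v : E n := EuclideanSpace.single i 1 with hv
  have hvn : ‖v‖ = 1 := by simp [hv]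
  -- The bound `|u| ≤ 2` on the enlarged interval needed by `contDiffOn_intervalIntegral` gives a
  -- norm below `3ρ/4`; hence the radius `ρ / 4`.
  have hball : ∀ z ∈ Metric.ball (0 : E n) (ρ / 4), ∀ u ∈ Metric.ball (1 / 2 : ℝ) 1,
      z - (u * z i) • v ∈ Metric.ball 0 ρ := by
    intro z hz u hu
    rw [mem_ball_zero_iff] at hz ⊢
    have hu2 : |u| ≤ 2 := by
      rw [Real.ball_eq_Ioo] at hu
      rw [abs_le]
      constructor <;> linarith [hu.1, hu.2]
    have hzi : |z i| ≤ ‖z‖ := by simpa using abs_coord_sub_le z 0 i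
    have hz0 := norm_nonneg z
    calc ‖z - (u * z i) • v‖ ≤ ‖z‖ + |u| * |z i| :=
          (norm_sub_le _ _).trans_eq (by
            rw [norm_smul, hvn, mul_one, norm_mul, Real.norm_eq_abs, Real.norm_eq_abs])
      _ ≤ ‖z‖ + 2 * ‖z‖ := by gcongr
      _ < ρ := by linarith
  refine ⟨fun z => meanDeriv G z v (z i), ?_, fun z hz => ?_⟩
  · have hdG : ContDiffOn ℝ ∞ (fderiv ℝ G) (Metric.ball 0 ρ) :=
      hG.fderiv_of_isOpen Metric.isOpen_ball (by simp)
    refine contDiffOn_intervalIntegral (g := fun z : E n × ℝ =>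
      fderiv ℝ G (z.1 - (z.2 * z.1 i) • v) v) Metric.isOpen_ball ?_
    refine ContDiffOn.clm_apply (hdG.comp (ContDiff.contDiffOn ?_) fun z hz => ?_) contDiffOn_const
    · exact contDiff_fst.sub ((contDiff_snd.mul ((contDiff_coord i).comp contDiff_fst)).smul
        contDiff_const)
    · exact hball _ hz.1 _ hz.2
  · have h1 := smul_meanDeriv (σ := G) (y := z) (v := v) (ε := z i) fun u hu =>
      ((hG.contDiffAt (Metric.isOpen_ball.mem_nhds (hball z hz u (by
        rw [Real.ball_eq_Ioo]; constructor <;> linarith [hu.1, hu.2])))).of_le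
          (by exact_mod_cast le_top))
    have h2 : z - z i • v ∈ Metric.ball 0 ρ := by
      simpa using hball z hz 1 (by rw [Real.ball_eq_Ioo]; norm_num)
    rw [h1, h0 _ h2 (by simp [hv]), sub_zero]

end Hadamard

section Partition

/-- A partition of unity of the manifold `M`, extended by zero to functions on `ℝⁿ`. That the sum is
1 is not needed, only that the functions have no common zero. -/
theorem exists_smooth_partition (hM : IsOpen M) {W : E n → Set (E n)} (hW : ∀ p ∈ M, IsOpen (W p))
    (hpW : ∀ p ∈ M, p ∈ W p) :
    ∃ χ : E n → E n → ℝ, (∀ p, ContDiffOn ℝ ∞ (χ p) M) ∧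
      (∀ x ∈ M, ∃ Λ : Finset (E n), ∀ᶠ y in 𝓝 x, ∀ p ∉ Λ, χ p y = 0) ∧
      (∀ x ∈ M, ∃ p ∈ M, χ p x ≠ 0) ∧ ∀ p, ∀ x ∈ M, (p ∈ M ∧ x ∈ W p) ∨ χ p =ᶠ[𝓝 x] 0 := by
  classical
  let N : TopologicalSpace.Opens (E n) := ⟨M, hM⟩
  have : LocallyCompactSpace N := hM.isOpenEmbedding_subtypeVal.locallyCompactSpace
  have : SigmaCompactSpace N := sigmaCompactSpace_of_locallyCompact_secondCountable
  obtain ⟨f, hf⟩ := SmoothPartitionOfUnity.exists_isSubordinate 𝓘(ℝ, E n) (isClosed_univ (X := N))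
    (fun p : N => Subtype.val ⁻¹' W p.1) (fun p => (hW p.1 p.2).preimage continuous_subtype_val)
    fun p _ => mem_iUnion.2 ⟨p, hpW p.1 p.2⟩
  let χ : E n → E n → ℝ := fun p x =>
    if h : p ∈ M ∧ x ∈ M then f ⟨p, h.1⟩ ⟨x, h.2⟩ else 0
  have hχ : ∀ (p : E n) (hp : p ∈ M) (x : N), χ p x.1 = f ⟨p, hp⟩ x := fun p hp x =>
    dif_pos ⟨hp, x.2⟩
  have hχ0 : ∀ p ∉ M, χ p = 0 := fun p hp => funext fun x => dif_neg fun h => hp h.1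
  have hev : ∀ (x : N) (P : E n → Prop), (∀ᶠ y : N in 𝓝 x, P y.1) → ∀ᶠ y in 𝓝 x.1, P y := by
    intro x P h
    rw [← hM.isOpenEmbedding_subtypeVal.map_nhds_eq x]
    exact h
  refine ⟨χ, fun p => ?_, fun x hx => ?_, fun x hx => ?_, fun p x hx => ?_⟩
  · by_cases hp : p ∈ M
    · intro x hx
      have h1 : ContMDiffAt 𝓘(ℝ, E n) 𝓘(ℝ, ℝ) ∞ (fun y : N => χ p y.1) ⟨x, hx⟩ := by
        refine ((f ⟨p, hp⟩).contMDiff.contMDiffAt).congr_of_eventuallyEq ?_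
        exact Eventually.of_forall fun y => hχ p hp y
      exact (contMDiffAt_iff_contDiffAt.1 ((contMDiffAt_subtype_iff (U := N)).1 h1)).contDiffWithinAt
    · rw [hχ0 p hp]
      exact contDiffOn_const
  · obtain ⟨t, ht, hfin⟩ := f.locallyFinite ⟨x, hx⟩
    refine ⟨hfin.toFinset.image Subtype.val, hev ⟨x, hx⟩ _ ?_⟩
    filter_upwards [ht] with y hy p hp
    by_cases hpM : p ∈ M
    · rw [hχ p hpM]
      by_contra hne
      exact hp (Finset.mem_image.2 ⟨⟨p, hpM⟩, hfin.mem_toFinset.2 ⟨y, hne, hy⟩, rfl⟩)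
    · rw [hχ0 p hpM]; rfl
  · obtain ⟨p, hp⟩ := f.exists_pos_of_mem (mem_univ (⟨x, hx⟩ : N))
    exact ⟨p.1, p.2, by rw [hχ p.1 p.2 ⟨x, hx⟩]; exact hp.ne'⟩
  · by_cases hpM : p ∈ M
    · by_cases hxW : x ∈ W p
      · exact Or.inl ⟨hpM, hxW⟩
      · right
        refine hev ⟨x, hx⟩ _ ?_
        have h1 : (⟨x, hx⟩ : N) ∉ tsupport (f ⟨p, hpM⟩) := fun h => hxW (hf ⟨p, hpM⟩ h)
        filter_upwards [(isClosed_tsupport _).isOpen_compl.mem_nhds h1] with y hy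
        rw [hχ p hpM]
        exact image_eq_zero_of_notMem_tsupport hy
    · right
      rw [hχ0 p hpM]

/-- A hypersurface with local equations is the zero set of a smooth vector valued function with
nonzero derivative. -/
theorem exists_vector_equation {V : Type*} [NormedAddCommGroup V] [InnerProductSpace ℝ V]
    {δ : E n → V} (hδ : Orthonormal ℝ δ) (hM : IsOpen M) {S : Set (E n)}
    (hS : ∀ p ∈ M, ∃ W, IsOpen W ∧ p ∈ W ∧ ∃ g : E n → ℝ, ContDiffOn ℝ ∞ g W ∧
      ∀ x ∈ W, (g x = 0 ↔ x ∈ S) ∧ (x ∈ S → fderiv ℝ g x ≠ 0)) :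
    ∃ F : E n → V, ContDiffOn ℝ ∞ F M ∧ ∀ x ∈ M, (F x = 0 ↔ x ∈ S) ∧ (x ∈ S → fderiv ℝ F x ≠ 0) := by
  have hS' : ∀ p, ∃ W, ∃ g : E n → ℝ, p ∈ M → IsOpen W ∧ p ∈ W ∧ ContDiffOn ℝ ∞ g W ∧
      ∀ x ∈ W, (g x = 0 ↔ x ∈ S) ∧ (x ∈ S → fderiv ℝ g x ≠ 0) := by
    intro p
    by_cases hp : p ∈ M
    · obtain ⟨W, h1, h2, g, h3⟩ := hS p hp
      exact ⟨W, g, fun _ => ⟨h1, h2, h3⟩⟩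
    · exact ⟨∅, 0, fun h => (hp h).elim⟩
  choose W g hg using hS'
  obtain ⟨χ, hχ, hfin, hne, hsupp⟩ := exists_smooth_partition hM (fun p hp => (hg p hp).1)
    fun p hp => (hg p hp).2.1
  have hprod : ∀ p, ContDiffOn ℝ ∞ (fun x => χ p x * g p x) M := by
    intro p x hx
    refine ContDiffAt.contDiffWithinAt ?_
    rcases hsupp p x hx with ⟨hp, hxW⟩ | h0
    · exact ((hχ p).contDiffAt (hM.mem_nhds hx)).mul
        ((hg p hp).2.2.1.contDiffAt ((hg p hp).1.mem_nhds hxW))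
    · refine (contDiffAt_const (c := (0 : ℝ))).congr_of_eventuallyEq ?_
      filter_upwards [h0] with y hy
      simp [hy]
  -- Each local equation has its own orthonormal direction, so that no cancellation occurs: the
  -- inner product with `δ p` recovers `χ p * g p`.
  set F : E n → V := fun x => ∑ᶠ p, (χ p x * g p x) • δ p with hF
  have hsum : ∀ x ∈ M, ∃ Λ : Finset (E n), ∀ᶠ y in 𝓝 x, (∀ p ∉ Λ, χ p y = 0) ∧
      F y = ∑ p ∈ Λ, (χ p y * g p y) • δ p := by
    intro x hx
    obtain ⟨Λ, hΛ⟩ := hfin x hx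
    refine ⟨Λ, hΛ.mono fun y hy => ⟨hy, finsum_eq_sum_of_support_subset _ fun p hp => ?_⟩⟩
    by_contra hpΛ
    exact hp (by simp [hy p hpΛ])
  have hcoord : ∀ p, ∀ x ∈ M, inner ℝ (δ p) (F x) = χ p x * g p x := by
    intro p x hx
    obtain ⟨Λ, hΛ⟩ := hsum x hx
    obtain ⟨h1, h2⟩ := hΛ.self_of_nhds
    rw [h2]
    by_cases hp : p ∈ Λ
    · exact hδ.inner_right_sum (fun p => χ p x * g p x) hp
    · rw [inner_sum, h1 p hp, zero_mul]
      refine Finset.sum_eq_zero fun q hq => ?_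
      rw [inner_smul_right, hδ.2 (ne_of_mem_of_not_mem hq hp).symm, mul_zero]
  have hFs : ContDiffOn ℝ ∞ F M := by
    intro x hx
    obtain ⟨Λ, hΛ⟩ := hsum x hx
    refine ContDiffAt.contDiffWithinAt ?_
    refine ContDiffAt.congr_of_eventuallyEq ?_ (hΛ.mono fun y hy => hy.2)
    exact ContDiffAt.sum fun p _ => ((hprod p).contDiffAt (hM.mem_nhds hx)).smul contDiffAt_const
  have hW : ∀ p, ∀ x ∈ M, χ p x ≠ 0 → p ∈ M ∧ x ∈ W p := fun p x hx h =>
    (hsupp p x hx).resolve_right fun h0 => h h0.self_of_nhds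
  refine ⟨F, hFs, fun x hx => ⟨⟨fun h0 => ?_, fun hxS => ?_⟩, fun hxS h0 => ?_⟩⟩
  · obtain ⟨p, hp, hpx⟩ := hne x hx
    obtain ⟨hp, hxW⟩ := hW p x hx hpx
    have h1 := hcoord p x hx
    rw [h0, inner_zero_right] at h1
    exact (((hg p hp).2.2.2 x hxW).1).1 ((mul_eq_zero.1 h1.symm).resolve_left hpx)
  · rw [hF]
    refine finsum_eq_zero_of_forall_eq_zero fun p => ?_
    by_cases hpx : χ p x = 0
    · simp [hpx]
    · obtain ⟨hp, hxW⟩ := hW p x hx hpx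
      rw [(((hg p hp).2.2.2 x hxW).1).2 hxS, mul_zero, zero_smul]
  -- On `S` the function `g p` vanishes, so the derivative of `χ p * g p` is `χ p x` times that of
  -- `g p`, which is nonzero.
  · obtain ⟨p, hp, hpx⟩ := hne x hx
    obtain ⟨hp, hxW⟩ := hW p x hx hpx
    obtain ⟨h1, h2⟩ := (hg p hp).2.2.2 x hxW
    have hFd : HasFDerivAt F (0 : E n →L[ℝ] V) x := by
      rw [← h0]
      exact ((hFs.contDiffAt (hM.mem_nhds hx)).differentiableAt (by simp)).hasFDerivAt
    have h3 := (innerSL ℝ (δ p)).hasFDerivAt.comp x hFd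
    have hχd := (((hχ p).contDiffAt (hM.mem_nhds hx)).differentiableAt (by simp)).hasFDerivAt
    have hgd := (((hg p hp).2.2.1.contDiffAt ((hg p hp).1.mem_nhds hxW)).differentiableAt
      (by simp)).hasFDerivAt
    have h4 := (hχd.mul hgd).congr_of_eventuallyEq (f₁ := innerSL ℝ (δ p) ∘ F) (by
      filter_upwards [hM.mem_nhds hx] with y hy
      simpa using hcoord p y hy)
    have h5 := h4.unique h3
    rw [h1.2 hxS, zero_smul, add_zero, ContinuousLinearMap.comp_zero] at h5
    exact h2 hxS ((smul_eq_zero.1 h5).resolve_left hpx)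

end Partition

end

/-! ### The branches of a normal crossings variety in local coordinates. -/

section

variable {n : ℕ} {M Sig : Set (E n)} {p : E n} {e : OpenPartialHomeomorph (E n) (E n)}

theorem exists_single_ne_zero {L : E n →L[ℝ] ℝ} (hL : L ≠ 0) :
    ∃ i, L (EuclideanSpace.single i 1) ≠ 0 := by
  by_contra! h
  refine hL (ContinuousLinearMap.coe_injective ?_)
  refine (EuclideanSpace.basisFun (Fin n) ℝ).toBasis.ext fun i => ?_
  simpa using h i

/-- A regular level set contained in a union of coordinate hyperplanes is a coordinate hyperplane. -/
theorem exists_coord_zero_iff {ψ : E n → ℝ} (hψ : ContDiffAt ℝ 1 ψ 0) (h0 : ψ 0 = 0)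
    (hd : fderiv ℝ ψ 0 ≠ 0) {I : Finset (Fin n)}
    (hI : ∀ᶠ z in 𝓝 0, ψ z = 0 → ∃ i ∈ I, z i = 0) :
    ∃ i ∈ I, ∀ᶠ z in 𝓝 (0 : E n), ψ z = 0 ↔ z i = 0 := by
  -- With a nonzero partial derivative of index `i`, the function `ψ` is strictly monotone on short
  -- segments parallel to the `i`-th axis, and close to 0 each of them contains exactly one zero.
  obtain ⟨i, hi⟩ := exists_single_ne_zero hd
  set v : E n := EuclideanSpace.single i 1 with hv
  have hvn : ‖v‖ = 1 := by simp [hv]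
  set a := fderiv ℝ ψ 0 v with ha
  have hev : ∀ᶠ z in 𝓝 (0 : E n), ContDiffAt ℝ 1 ψ z ∧ 0 < a * fderiv ℝ ψ z v ∧
      (ψ z = 0 → ∃ i ∈ I, z i = 0) := by
    refine (hψ.eventually (by simp)).and (Eventually.and ?_ hI)
    have h1 : ContinuousAt (fun z => a * fderiv ℝ ψ z v) 0 :=
      continuousAt_const.mul
        (((hψ.fderiv_right (m := 0) le_rfl).continuousAt).clm_apply continuousAt_const)
    exact h1.eventually (lt_mem_nhds (mul_self_pos.2 hi))
  obtain ⟨ρ, hρ, hρs⟩ := Metric.mem_nhds_iff.1 hev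
  set r := ρ / 2 with hr
  have hr0 : 0 < r := half_pos hρ
  have hball : ∀ z ∈ Metric.ball (0 : E n) r, ∀ t ∈ Icc (-r) r, z + t • v ∈ Metric.ball 0 ρ := by
    intro z hz t ht
    rw [mem_ball_zero_iff] at hz ⊢
    have h1 : |t| ≤ r := abs_le.2 ht
    calc ‖z + t • v‖ ≤ ‖z‖ + |t| := (norm_add_le _ _).trans_eq (by
          rw [norm_smul, hvn, mul_one, Real.norm_eq_abs])
      _ < ρ := by linarith
  have hder : ∀ z ∈ Metric.ball (0 : E n) r, ∀ t ∈ Icc (-r) r,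
      HasDerivAt (fun t : ℝ => a * ψ (z + t • v)) (a * fderiv ℝ ψ (z + t • v) v) t := by
    intro z hz t ht
    have h1 : HasDerivAt (fun t : ℝ => z + t • v) v t := by
      simpa using ((hasDerivAt_id t).smul_const v).const_add z
    exact ((((hρs (hball z hz t ht)).1.differentiableAt one_ne_zero).hasFDerivAt).comp_hasDerivAt
      t h1).const_mul a
  have hcont : ∀ z ∈ Metric.ball (0 : E n) r,
      ContinuousOn (fun t : ℝ => a * ψ (z + t • v)) (Icc (-r) r) :=
    fun z hz t ht => (hder z hz t ht).continuousAt.continuousWithinAt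
  have hmono : ∀ z ∈ Metric.ball (0 : E n) r,
      StrictMonoOn (fun t : ℝ => a * ψ (z + t • v)) (Icc (-r) r) := by
    intro z hz
    refine strictMonoOn_of_deriv_pos (convex_Icc _ _) (hcont z hz) fun t ht => ?_
    have ht' := interior_subset ht
    rw [(hder z hz t ht').deriv]
    exact (hρs (hball z hz t ht')).2.1
  have hm0 : (0 : ℝ) ∈ Icc (-r) r := ⟨by linarith, hr0.le⟩
  have hmr : r ∈ Icc (-r) r := ⟨by linarith, le_rfl⟩
  have hmr' : -r ∈ Icc (-r) r := ⟨le_rfl, by linarith⟩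
  have h0r : (0 : E n) ∈ Metric.ball 0 r := Metric.mem_ball_self hr0
  have hcr : ∀ t ∈ Icc (-r) r, ContinuousAt (fun z : E n => a * ψ (z + t • v)) 0 := by
    intro t ht
    refine continuousAt_const.mul (ContinuousAt.comp (f := fun z : E n => z + t • v) ?_ (by fun_prop))
    exact (hρs (hball 0 h0r t ht)).1.continuousAt
  have hgood : ∀ᶠ z in 𝓝 (0 : E n), z ∈ Metric.ball (0 : E n) r ∧ ∃ t ∈ Icc (-r) r, ψ (z + t • v) = 0 := by
    have h1 : 0 < a * ψ (0 + r • v) := by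
      have := hmono 0 h0r hm0 hmr hr0
      simpa [h0] using this
    have h2 : a * ψ (0 + (-r) • v) < 0 := by
      have := hmono 0 h0r hmr' hm0 (by linarith)
      simpa [h0] using this
    filter_upwards [Metric.ball_mem_nhds (0 : E n) hr0, (hcr r hmr).eventually (lt_mem_nhds h1),
      (hcr (-r) hmr').eventually (gt_mem_nhds h2)] with z hz h3 h4
    obtain ⟨t, ht, ht0⟩ := intermediate_value_Icc (by linarith) (hcont z hz) ⟨h4.le, h3.le⟩
    exact ⟨hz, t, ht, (mul_eq_zero.1 ht0).resolve_left hi⟩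
  -- Moving along `v'` makes all coordinates except the `i`-th nonzero. The zero of `ψ` on the
  -- parallel to the `i`-th axis then lies on the hyperplane of index `i`, so it is the moved point
  -- itself. Continuity gives the result for the original point.
  set v' : E n := WithLp.toLp 2 fun i' => if i' = i then 0 else 1 with hv'
  have hkey : ∀ᶠ z in 𝓝 (0 : E n), z i = 0 → ψ z = 0 ∧ i ∈ I := by
    obtain ⟨O, hO, hOo, h0O⟩ := eventually_nhds_iff.1 hgood
    filter_upwards [hOo.mem_nhds h0O] with z hz hzi
    have hc : ContinuousAt (fun s : ℝ => z + s • v') 0 := by fun_prop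
    have h1 : ∀ᶠ s in 𝓝[≠] (0 : ℝ), z + s • v' ∈ O := by
      refine (hc.eventually (hOo.mem_nhds ?_)).filter_mono nhdsWithin_le_nhds
      simpa using hz
    have h2 : ∀ᶠ s in 𝓝[≠] (0 : ℝ), ∀ i', i' ≠ i → z i' + s ≠ 0 := by
      refine eventually_all.2 fun i' => ?_
      by_cases hz' : z i' = 0
      · filter_upwards [self_mem_nhdsWithin] with s hs _
        rw [hz', zero_add]
        exact hs
      · have h3 : ContinuousAt (fun s : ℝ => z i' + s) 0 := by fun_prop
        exact ((h3.eventually_ne (by simpa using hz')).filter_mono nhdsWithin_le_nhds).mono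
          fun s hs _ => hs
    have h3 : ∀ᶠ s in 𝓝[≠] (0 : ℝ), ψ (z + s • v') = 0 ∧ i ∈ I := by
      filter_upwards [h1, h2] with s hs hs'
      obtain ⟨hsb, t, ht, ht0⟩ := hO _ hs
      obtain ⟨i', hi', hzi'⟩ := (hρs (hball _ hsb t ht)).2.2 ht0
      have hii : i' = i := by
        by_contra hne
        refine hs' i' hne ?_
        simpa [hv', hv, hne] using hzi'
      rw [hii] at hi' hzi'
      have ht00 : t = 0 := by simpa [hv', hv, hzi] using hzi'
      rw [ht00, zero_smul, add_zero] at ht0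
      exact ⟨ht0, hi'⟩
    refine ⟨?_, (h3.exists).choose_spec.2⟩
    have h4 : ContinuousAt (fun s : ℝ => ψ (z + s • v')) 0 := by
      refine ContinuousAt.comp (f := fun s : ℝ => z + s • v') ?_ hc
      rw [zero_smul, add_zero]
      exact (hρs (Metric.ball_subset_ball (by linarith) (hO z hz).1)).1.continuousAt
    have h5 := tendsto_nhds_unique ((h4.tendsto.mono_left nhdsWithin_le_nhds).congr'
      (h3.mono fun s hs => hs.1)) (tendsto_const_nhds (x := (0 : ℝ)) (f := 𝓝[≠] (0 : ℝ)))
    simpa using h5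
  refine ⟨i, (hkey.self_of_nhds rfl).2, ?_⟩
  have hc : Tendsto (fun z : E n => z - z i • v) (𝓝 0) (𝓝 0) := by
    have : Continuous fun z : E n => z - z i • v :=
      continuous_id.sub ((contDiff_coord (n := 0) i).continuous.smul continuous_const)
    exact this.tendsto' 0 0 (by simp)
  have hzi : ∀ᶠ z in 𝓝 (0 : E n), z i ∈ Icc (-r) r := by
    have h1 : ContinuousAt (fun z : E n => z i) 0 := (contDiff_coord (n := 0) i).continuous.continuousAt
    exact h1.eventually (Icc_mem_nhds (by simpa using hr0) (by simpa using hr0))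
  filter_upwards [hkey, hc.eventually hkey, hc.eventually (Metric.ball_mem_nhds _ hr0), hzi]
    with z h1 h2 h3 h4
  refine ⟨fun hz => ?_, fun hz => (h1 hz).1⟩
  have h5 := (h2 (by simp [hv])).1
  by_contra hne
  refine hne ((hmono _ h3).injOn h4 hm0 ?_)
  simp [hz, h5]

theorem fderiv_comp_symm (he : IsChartAt M p e) {x : E n} (hx : x ∈ e.source) :
    (fderiv ℝ e.symm (e x)).comp (fderiv ℝ e x) = ContinuousLinearMap.id ℝ (E n) ∧
    (fderiv ℝ e x).comp (fderiv ℝ e.symm (e x)) = ContinuousLinearMap.id ℝ (E n) := by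
  have hz := e.map_source hx
  have h1 : HasFDerivAt e (fderiv ℝ e x) x :=
    ((he.2.2.2.1.contDiffAt (e.open_source.mem_nhds hx)).differentiableAt (by simp)).hasFDerivAt
  have h2 : HasFDerivAt e.symm (fderiv ℝ e.symm (e x)) (e x) :=
    ((he.2.2.2.2.contDiffAt (e.open_target.mem_nhds hz)).differentiableAt (by simp)).hasFDerivAt
  refine ⟨(h2.comp x h1).unique ((hasFDerivAt_id x).congr_of_eventuallyEq ?_),
    HasFDerivAt.unique (x := e x) (f := e ∘ e.symm) ?_ ((hasFDerivAt_id _).congr_of_eventuallyEq ?_)⟩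
  · filter_upwards [e.open_source.mem_nhds hx] with y hy using e.left_inv hy
  · refine HasFDerivAt.comp (e x) ?_ h2
    rwa [e.left_inv hx]
  · filter_upwards [e.open_target.mem_nhds hz] with y hy using e.right_inv hy

theorem hasFDerivAt_coord (he : IsChartAt M p e) {x : E n} (hx : x ∈ e.source) (i : Fin n) :
    HasFDerivAt (fun y => e y i) ((EuclideanSpace.proj i : E n →L[ℝ] ℝ).comp (fderiv ℝ e x)) x :=
  (EuclideanSpace.proj i : E n →L[ℝ] ℝ).hasFDerivAt.comp x
    ((he.2.2.2.1.contDiffAt (e.open_source.mem_nhds hx)).differentiableAt (by simp)).hasFDerivAt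

theorem exists_fderiv_coord_eq_one (he : IsChartAt M p e) {x : E n} (hx : x ∈ e.source) (i : Fin n) :
    ∃ h, (EuclideanSpace.proj i : E n →L[ℝ] ℝ).comp (fderiv ℝ e x) h = 1 := by
  refine ⟨fderiv ℝ e.symm (e x) (EuclideanSpace.single i 1), ?_⟩
  have := congrArg (fun L : E n →L[ℝ] E n => L (EuclideanSpace.single i 1) i) (fderiv_comp_symm he hx).2
  simpa using this

/-- In coordinates in which a normal crossings variety is a union of coordinate hyperplanes, a
hypersurface contained in it is a coordinate hyperplane. -/
theorem IsHypersurface.exists_coord {S : Set (E n)} (hS : IsHypersurface M S) (hSS : S ⊆ Sig)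
    (he : IsChartAt M p e) {I : Finset (Fin n)}
    (hI : ∀ x ∈ e.source, x ∈ Sig ↔ ∃ i ∈ I, e x i = 0) (hp : p ∈ S) :
    ∃ i ∈ I, ∀ᶠ x in 𝓝 p, x ∈ S ↔ e x i = 0 := by
  obtain ⟨e', he', l, hl⟩ := hS.2.2 p hp
  have hl' : ∀ x ∈ e'.source, x ∈ S ↔ e' x l = 0 := fun x hx => by
    have h1 := Set.ext_iff.1 hl x
    simpa [hx] using h1
  have hps := he.2.1
  have hp0 : e.symm 0 = p := by rw [← he.2.2.1, e.left_inv hps]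
  have h0t : (0 : E n) ∈ e.target := by rw [← he.2.2.1]; exact e.map_source hps
  have hsc : Tendsto e.symm (𝓝 0) (𝓝 p) := by
    have := e.continuousAt_symm h0t
    rwa [ContinuousAt, hp0] at this
  have hev : ∀ᶠ z in 𝓝 (0 : E n), z ∈ e.target ∧ e.symm z ∈ e'.source :=
    (e.open_target.eventually_mem h0t).and (hsc.eventually (e'.open_source.mem_nhds he'.2.1))
  set ψ : E n → ℝ := fun z => e' (e.symm z) l with hψ
  have hcd : ContDiffAt ℝ ∞ ψ 0 := by
    have h1 : ContDiffAt ℝ ∞ (fun x => e' x l) (e.symm 0) := by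
      rw [hp0]
      exact contDiffAt_euclidean.1 (he'.2.2.2.1.contDiffAt (e'.open_source.mem_nhds he'.2.1)) l
    exact h1.comp (0 : E n) (he.2.2.2.2.contDiffAt (e.open_target.mem_nhds h0t))
  have hd : fderiv ℝ ψ 0 ≠ 0 := by
    intro h0
    have h1 := hasFDerivAt_coord he' he'.2.1 l
    have h2 : HasFDerivAt e.symm (fderiv ℝ e.symm 0) 0 :=
      ((he.2.2.2.2.contDiffAt (e.open_target.mem_nhds h0t)).differentiableAt (by simp)).hasFDerivAt
    rw [← hp0] at h1
    have h3 := (h1.comp (0 : E n) h2).fderiv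
    change fderiv ℝ ψ 0 = _ at h3
    rw [h0, hp0] at h3
    obtain ⟨u, hu⟩ := exists_fderiv_coord_eq_one he' he'.2.1 l
    have h4 := congrArg (fun L : E n →L[ℝ] ℝ => L (fderiv ℝ e p u)) h3
    have h5 := congrArg (fun L : E n →L[ℝ] E n => L u) (fderiv_comp_symm he hps).1
    rw [he.2.2.1] at h5
    simp only [ContinuousLinearMap.comp_apply, ContinuousLinearMap.id_apply, zero_apply] at h4 h5 hu
    rw [h5, hu] at h4
    exact zero_ne_one h4
  obtain ⟨i, hi, hψi⟩ := exists_coord_zero_iff (hcd.of_le (by exact_mod_cast le_top))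
    (by simp [hψ, hp0, he'.2.2.1]) hd (I := I) (by
      filter_upwards [hev] with z hz hz0
      have h1 := (hI _ (e.map_target hz.1)).1 (hSS ((hl' _ hz.2).2 hz0))
      rwa [e.right_inv hz.1] at h1)
  refine ⟨i, hi, ?_⟩
  have hec : Tendsto e (𝓝 p) (𝓝 0) := by
    have := e.continuousAt hps
    rwa [ContinuousAt, he.2.2.1] at this
  filter_upwards [hec.eventually hψi, e.open_source.mem_nhds hps, e'.open_source.mem_nhds he'.2.1]
    with x h1 h2 h3
  rw [hl' x h3, ← h1, hψ]
  simp only [e.left_inv h2]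

/-- The part of the hypersurface of index `j` which is not locally a hypersurface of smaller index. -/
def newPart {c : ℕ} (S : Fin c → Set (E n)) (j : Fin c) : Set (E n) :=
  {x ∈ S j | ∀ j' < j, ¬ ∀ᶠ y in 𝓝 x, y ∈ S j' ↔ y ∈ S j}

/-- Among the indices with the same germ at `x`, the smallest has `x` in its new part. -/
theorem iUnion_newPart {c : ℕ} (S : Fin c → Set (E n)) : ⋃ j, newPart S j = ⋃ j, S j := by
  refine Subset.antisymm (iUnion_mono fun j => sep_subset _ _) ?_
  rintro x hx
  obtain ⟨j, hj⟩ := mem_iUnion.1 hx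
  obtain ⟨k, hk, hmin⟩ := wellFounded_lt.has_min {k | ∀ᶠ y in 𝓝 x, y ∈ S k ↔ y ∈ S j}
    ⟨j, Eventually.of_forall fun _ => Iff.rfl⟩
  refine mem_iUnion.2 ⟨k, hk.self_of_nhds.2 hj, fun j' hj' h => hmin j' ?_ hj'⟩
  filter_upwards [h, hk] with y h1 h2 using h1.trans h2

theorem IsChartAt.restrOpen (he : IsChartAt M p e) {O : Set (E n)} (hO : IsOpen O) (hp : p ∈ O) :
    IsChartAt M p (e.restrOpen O hO) := by
  have h1 : (e.restrOpen O hO).source = e.source ∩ O := e.restrOpen_source O hO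
  refine ⟨h1 ▸ inter_subset_left.trans he.1, h1 ▸ ⟨he.2.1, hp⟩, he.2.2.1,
    he.2.2.2.1.mono (h1 ▸ inter_subset_left), he.2.2.2.2.mono fun z hz => ?_⟩
  have h2 := (e.restrOpen O hO).map_target hz
  rw [h1] at h2
  have h3 := (e.restrOpen O hO).right_inv hz
  have h4 := e.map_source h2.1
  have h5 : e ((e.restrOpen O hO).symm z) = z := h3
  rwa [h5] at h4

theorem IsHypersurface.eventually_notMem {S : Set (E n)} (hS : IsHypersurface M S)
    (hp : p ∈ M) (hpS : p ∉ S) : ∀ᶠ x in 𝓝 p, x ∉ S := by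
  obtain ⟨-, ⟨F, hF, rfl⟩, -⟩ := hS
  filter_upwards [hF.isOpen_compl.mem_nhds fun h => hpS ⟨hp, h⟩] with x hx h
  exact hx h.2

/-- Distinct coordinate hyperplanes have distinct germs. -/
theorem not_eventually_coord_iff {x : E n} (hx : x ∈ e.source) {i i' : Fin n}
    (hii : i ≠ i') (h0 : e x i = 0) : ¬ ∀ᶠ y in 𝓝 x, e y i' = 0 ↔ e y i = 0 := by
  intro h
  have hz := e.map_source hx
  have h1 := e.continuousAt_symm hz
  rw [ContinuousAt, e.left_inv hx] at h1
  have h2 : ∀ᶠ z in 𝓝 (e x), z i' = 0 ↔ z i = 0 := by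
    filter_upwards [h1.eventually h, e.open_target.mem_nhds hz] with z h3 h4
    rwa [e.right_inv h4] at h3
  have h3 : ContinuousAt (fun s : ℝ => e x + s • (EuclideanSpace.single i' 1 : E n)) 0 := by fun_prop
  have h4 : ∀ᶠ s in 𝓝 (0 : ℝ), e x i' + s = 0 := by
    have h5 : Tendsto (fun s : ℝ => e x + s • (EuclideanSpace.single i' 1 : E n)) (𝓝 0) (𝓝 (e x)) := by
      simpa [ContinuousAt] using h3
    filter_upwards [h5.eventually h2] with s hs
    simpa [hii, h0] using hs
  have h5 := h4.self_of_nhds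
  have h6 := ((h4.filter_mono (nhdsWithin_le_nhds (s := {0}ᶜ))).and self_mem_nhdsWithin).exists
  obtain ⟨s, hs, hs0⟩ := h6
  refine hs0 (mem_singleton_iff.2 ?_)
  linarith

/-- The given hypersurfaces may share pieces, and then two indices would have the same coordinate.
Discarding repeated germs makes `κ` injective; in a small neighborhood the equalities between germs
are the same as at `p`. -/
theorem IsNormalCrossings.exists_newPart_coord [Nonempty (Fin n)]
    (hSig : IsNormalCrossings M Sig) {c : ℕ} {S : Fin c → Set (E n)}
    (hS : ∀ j, IsHypersurface M (S j)) (hSS : Sig = ⋃ j, S j) (hp : p ∈ M) :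
    ∃ e, IsChartAt M p e ∧ ∃ κ : Fin c → Fin n, InjOn κ {j | p ∈ newPart S j} ∧
      (∀ j, p ∉ newPart S j → ∀ x ∈ e.source, x ∉ newPart S j) ∧
      ∀ j, p ∈ newPart S j → ∀ x ∈ e.source, x ∈ newPart S j ↔ e x (κ j) = 0 := by
  obtain ⟨e, he, I, hI⟩ := hSig.exists_chart hp
  have hex : ∀ j, ∃ i, p ∈ S j → ∀ᶠ x in 𝓝 p, x ∈ S j ↔ e x i = 0 := by
    intro j
    by_cases hj : p ∈ S j
    · obtain ⟨i, -, hi⟩ := (hS j).exists_coord (hSS ▸ subset_iUnion S j) he hI hj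
      exact ⟨i, fun _ => hi⟩
    · exact ⟨Classical.arbitrary _, fun h => (hj h).elim⟩
  choose κ hκ using hex
  have h1 : ∀ᶠ x in 𝓝 p, ∀ j, (p ∈ S j → (x ∈ S j ↔ e x (κ j) = 0)) ∧ (p ∉ S j → x ∉ S j) := by
    refine eventually_all.2 fun j => ?_
    by_cases hj : p ∈ S j
    · exact (hκ j hj).mono fun x hx => ⟨fun _ => hx, fun h => (h hj).elim⟩
    · exact ((hS j).eventually_notMem hp hj).mono fun x hx => ⟨fun h => (hj h).elim, fun _ => hx⟩
  have h2 : ∀ᶠ x in 𝓝 p, ∀ j' j, (∀ᶠ y in 𝓝 p, y ∈ S j' ↔ y ∈ S j) →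
      ∀ᶠ y in 𝓝 x, y ∈ S j' ↔ y ∈ S j := by
    refine eventually_all.2 fun j' => eventually_all.2 fun j => ?_
    by_cases hj : ∀ᶠ y in 𝓝 p, y ∈ S j' ↔ y ∈ S j
    · exact (eventually_eventually_nhds.2 hj).mono fun x hx _ => hx
    · exact Eventually.of_forall fun x h => (hj h).elim
  obtain ⟨O, hO, hOo, hpO⟩ := eventually_nhds_iff.1 (h1.and h2)
  have hsrc : (e.restrOpen O hOo).source = e.source ∩ O := e.restrOpen_source O hOo
  have hcoe : ∀ x, e.restrOpen O hOo x = e x := fun _ => rfl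
  have hinj : ∀ j' j, p ∈ S j' → p ∈ newPart S j → j' < j → κ j' ≠ κ j := by
    intro j' j hj' hj hlt heq
    refine hj.2 j' hlt ?_
    filter_upwards [hκ j' hj', hκ j hj.1] with x hx hx'
    rw [hx, hx', heq]
  refine ⟨e.restrOpen O hOo, he.restrOpen hOo hpO, κ, ?_, ?_, ?_⟩
  · intro j hj j' hj' heq
    by_contra hne
    rcases lt_or_gt_of_ne hne with h | h
    · exact hinj j j' hj.1 hj' h heq
    · exact hinj j' j hj'.1 hj h heq.symm
  · intro j hj x hx hxj
    rw [hsrc] at hx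
    obtain ⟨h3, h4⟩ := hO x hx.2
    by_cases hpj : p ∈ S j
    · refine hj ⟨hpj, fun j' hlt hcon => hxj.2 j' hlt (h4 j' j hcon)⟩
    · exact (h3 j).2 hpj hxj.1
  · intro j hj x hx
    rw [hsrc] at hx
    obtain ⟨h3, h4⟩ := hO x hx.2
    rw [hcoe, ← (h3 j).1 hj.1]
    refine ⟨fun h => h.1, fun hxj => ⟨hxj, fun j' hlt hcon => ?_⟩⟩
    by_cases hpj' : p ∈ S j'
    · refine not_eventually_coord_iff hx.1 (hinj j' j hpj' hj hlt).symm
        (((h3 j).1 hj.1).1 hxj) ?_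
      filter_upwards [hcon, hOo.mem_nhds hx.2] with y hy hyO
      rw [← ((hO y hyO).1 j').1 hpj', ← ((hO y hyO).1 j).1 hj.1]
      exact hy
    · exact (h3 j').2 hpj' (hcon.self_of_nhds.2 hxj)

end

/-! ### Construction of the branch data, and the theorem. -/

section

variable {n : ℕ} {M Sig : Set (E n)} {p : E n} {e : OpenPartialHomeomorph (E n) (E n)}

open Classical in
/-- The line containing `F x`, for a vector valued equation `F` of a hypersurface. -/
def lineAt {V : Type} [NormedAddCommGroup V] [InnerProductSpace ℝ V] (F : E n → V) (x : E n) :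
    Submodule ℝ V :=
  if F x = 0 then (fderiv ℝ F x).range else Submodule.span ℝ {F x}

variable {V : Type} [NormedAddCommGroup V] [InnerProductSpace ℝ V]

theorem mem_lineAt (F : E n → V) (x : E n) : F x ∈ lineAt F x := by
  by_cases h : F x = 0
  · rw [h]; exact zero_mem _
  · rw [lineAt, if_neg h]; exact Submodule.mem_span_singleton_self _

/-- Off the zero set `F` is a nonzero multiple of `U`. On it the coordinate vanishes, so the
derivative of `F` is the differential of the coordinate, which is onto, times `U`; its range is the
line of `U`, and `U` is nonzero as the derivative is. -/
theorem lineAt_eq_span (he : IsChartAt M p e) {F U : E n → V} {O : Set (E n)} (hO : IsOpen O)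
    (hOe : O ⊆ e.source) (hU : ContDiffOn ℝ ∞ U O) {i : Fin n} (hF : ∀ x ∈ O, F x = e x i • U x)
    (hd : ∀ x ∈ O, F x = 0 → e x i = 0 ∧ fderiv ℝ F x ≠ 0) {x : E n} (hx : x ∈ O) :
    U x ≠ 0 ∧ lineAt F x = Submodule.span ℝ {U x} := by
  by_cases h0 : F x = 0
  · obtain ⟨hi, hne⟩ := hd x hx h0
    have hUx := ((hU.contDiffAt (hO.mem_nhds hx)).differentiableAt (by simp)).hasFDerivAt
    have h1 := (hasFDerivAt_coord he (hOe hx) i).smul hUx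
    have h2 := (h1.congr_of_eventuallyEq (f₁ := F) (by
      filter_upwards [hO.mem_nhds hx] with y hy using hF y hy)).fderiv
    rw [hi, zero_smul, zero_add] at h2
    have h3 : ∀ u, fderiv ℝ F x u =
        ((EuclideanSpace.proj i : E n →L[ℝ] ℝ).comp (fderiv ℝ e x) u) • U x := fun u => by
      rw [h2]; rfl
    refine ⟨fun hU0 => hne (ContinuousLinearMap.ext fun u => by rw [h3, hU0, smul_zero]; rfl), ?_⟩
    rw [lineAt, if_pos h0]
    ext y
    rw [Submodule.mem_span_singleton]
    constructor
    · rintro ⟨u, rfl⟩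
      exact ⟨_, (h3 u).symm⟩
    · rintro ⟨a, rfl⟩
      obtain ⟨u, hu⟩ := exists_fderiv_coord_eq_one he (hOe hx) i
      refine ⟨a • u, ?_⟩
      change fderiv ℝ F x (a • u) = _
      rw [map_smul, h3, hu, one_smul]
  · have h1 := hF x hx
    have h2 : e x i ≠ 0 := fun h => h0 (by rw [h1, h, zero_smul])
    refine ⟨fun h => h0 (by rw [h1, h, smul_zero]), ?_⟩
    rw [lineAt, if_neg h0, h1]
    exact Submodule.span_singleton_smul_eq (IsUnit.mk0 _ h2) _

/-- The neighborhood `O` is independent of `F` and `i`, so one chart serves all branches. -/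
theorem exists_restr_coord_smul [CompleteSpace V] (he : IsChartAt M p e) :
    ∃ O, IsOpen O ∧ p ∈ O ∧ O ⊆ e.source ∧ ∀ (F : E n → V) (i : Fin n), ContDiffOn ℝ ∞ F M →
      (∀ x ∈ e.source, e x i = 0 → F x = 0) →
      ∃ U, ContDiffOn ℝ ∞ U O ∧ ∀ x ∈ O, F x = e x i • U x := by
  obtain ⟨ρ, hρ, hρt⟩ := exists_ball_subset_target he
  refine ⟨e.source ∩ e ⁻¹' Metric.ball 0 (ρ / 4), e.isOpen_inter_preimage Metric.isOpen_ball,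
    ⟨he.2.1, by simpa [he.2.2.1] using hρ⟩, inter_subset_left, fun F i hF h0 => ?_⟩
  obtain ⟨U, hU, hGU⟩ := exists_eq_coord_smul (G := fun z => F (e.symm z)) (ρ := ρ)
    (hF.comp (he.2.2.2.2.mono hρt) fun z hz => he.1 (e.map_target (hρt hz))) i
    fun z hz hz0 => h0 _ (e.map_target (hρt hz)) (by rw [e.right_inv (hρt hz)]; exact hz0)
  refine ⟨fun x => U (e x), hU.comp (he.2.2.2.1.mono inter_subset_left) fun x hx => hx.2,
    fun x hx => ?_⟩
  have := hGU _ hx.2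
  simp only [e.left_inv hx.1] at this
  exact this

theorem exists_orthonormal_family (ι : Type) :
    ∃ (V : Type) (_ : NormedAddCommGroup V) (_ : InnerProductSpace ℝ V) (_ : CompleteSpace V)
      (δ : ι → V), Orthonormal ℝ δ :=
  ⟨lp (fun _ : ι => ℝ) 2, inferInstance, inferInstance, inferInstance, _,
    (HilbertBasis.ofRepr (LinearIsometryEquiv.refl ℝ (lp (fun _ : ι => ℝ) 2))).orthonormal⟩

theorem IsNormalCrossings.exists_branchData (hM : IsOpen M) (hSig : IsNormalCrossings M Sig) :
    ∃ (c : ℕ) (V : Type) (_ : NormedAddCommGroup V) (_ : InnerProductSpace ℝ V),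
      Nonempty (BranchData M Sig c V) := by
  obtain ⟨c, S, hS, hSS⟩ := hSig.1
  rcases isEmpty_or_nonempty (Fin n) with hn | hn
  -- In dimension 0 there is no coordinate which could define a hypersurface.
  · have hempty : Sig = ∅ := by
      rw [hSS]
      refine iUnion_eq_empty.2 fun j => eq_empty_of_forall_notMem fun x hx => ?_
      obtain ⟨-, -, i, -⟩ := (hS j).2.2 x hx
      exact hn.elim i
    refine ⟨0, ℝ, inferInstance, inferInstance, ⟨⟨fun _ _ => 0, fun _ _ => ⊤, fun j => j.elim0, ?_,
      fun j => j.elim0, fun p hp => ?_⟩⟩⟩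
    · simp [hempty]
    · obtain ⟨e, he, -⟩ := hSig.2 p hp
      exact ⟨e, he, fun j => j.elim0, fun j => j.elim0, fun j => j.elim0, fun j => j.elim0⟩
  · obtain ⟨V, _, _, _, δ, hδ⟩ := exists_orthonormal_family (E n)
    have hF : ∀ j, ∃ F : E n → V, ContDiffOn ℝ ∞ F M ∧
        ∀ x ∈ M, (F x = 0 ↔ x ∈ newPart S j) ∧ (x ∈ newPart S j → fderiv ℝ F x ≠ 0) := by
      refine fun j => exists_vector_equation hδ hM fun p hp => ?_
      obtain ⟨e, he, κ, -, h1, h2⟩ := hSig.exists_newPart_coord hS hSS hp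
      refine ⟨e.source, e.open_source, he.2.1, ?_⟩
      by_cases hj : p ∈ newPart S j
      · refine ⟨fun x => e x (κ j), contDiffOn_euclidean.1 he.2.2.2.1 _,
          fun x hx => ⟨(h2 j hj x hx).symm, fun _ h0 => ?_⟩⟩
        obtain ⟨u, hu⟩ := exists_fderiv_coord_eq_one he hx (κ j)
        rw [← (hasFDerivAt_coord he hx (κ j)).fderiv, h0] at hu
        exact zero_ne_one hu
      · exact ⟨fun _ => 1, contDiffOn_const, fun x hx =>
          ⟨⟨fun h => (one_ne_zero h).elim, fun h => (h1 j hj x hx h).elim⟩,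
            fun h => (h1 j hj x hx h).elim⟩⟩
    choose F hFs hF using hF
    refine ⟨c, V, inferInstance, inferInstance, ⟨⟨F, fun j => lineAt (F j), hFs, fun x => ?_,
      fun j x _ => mem_lineAt _ x, fun p hp => ?_⟩⟩⟩
    · rw [hSS, ← iUnion_newPart, mem_iUnion]
      constructor
      · rintro ⟨j, hj⟩
        have hx := (hS j).1 hj.1
        exact ⟨hx, j, (hF j x hx).1.2 hj⟩
      · rintro ⟨hx, j, hj⟩
        exact ⟨j, (hF j x hx).1.1 hj⟩
    · obtain ⟨e, he, κ, hκ, h1, h2⟩ := hSig.exists_newPart_coord hS hSS hp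
      obtain ⟨O, hO, hpO, hOe, hU⟩ := exists_restr_coord_smul (V := V) he
      have hsrc : (e.restrOpen O hO).source = O := by
        rw [e.restrOpen_source O hO, inter_eq_right.2 hOe]
      have hiff : ∀ j, F j p = 0 ↔ p ∈ newPart S j := fun j => (hF j p hp).1
      refine ⟨e.restrOpen O hO, he.restrOpen hO hpO, κ, ?_, fun j hj x hx => ?_, fun j hj => ?_⟩
      · simpa only [hiff] using hκ
      · rw [hsrc] at hx
        rw [Ne, (hF j x (he.1 (hOe hx))).1]
        exact h1 j (fun h => hj ((hiff j).2 h)) x (hOe hx)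
      · have hj' := (hiff j).1 hj
        obtain ⟨U, hUs, hUF⟩ := hU (F j) (κ j) (hFs j) fun x hx h0 =>
          (hF j x (he.1 hx)).1.2 ((h2 j hj' x hx).2 h0)
        rw [hsrc]
        refine ⟨U, hUs, fun x hx => ?_⟩
        obtain ⟨h3, h4⟩ := lineAt_eq_span he hO hOe hUs hUF (fun x hx h0 => by
          have h5 := (hF j x (he.1 (hOe hx))).1.1 h0
          exact ⟨(h2 j hj' x (hOe hx)).1 h5, (hF j x (he.1 (hOe hx))).2 h5⟩) hx
        exact ⟨h3, hUF x hx, h4⟩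

end

end Smoothing

end

open Smoothing in
theorem mainTheorem1 (n : ℕ) (M Sig : Set (EuclideanSpace ℝ (Fin n))) (hM : IsOpen M)
    (hSig : IsNormalCrossings M Sig) :
    ∃ b : BlowupSequence (initialSpace M Sig hM),
      (∀ k ≤ b.r, (b.space k).IsRegularized) ∧
      (∀ k < b.r, b.center k ⊆ (b.space k).Sig) ∧
      (∀ k ≤ b.r, ∀ m, IsMollifier m →
        ∃ T : PiecewiseSmooth M Sig →ₗ[ℝ] (b.space k).PiecewiseSmooth (b.domain m k),
          ∀ (f : PiecewiseSmooth M Sig), ∀ q ∈ b.domain m k,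
            b.comp k q ∉ (initialSpace M Sig hM).Sig →
              (T f).1 q = reg m f.1 (b.proj k q)) ∧
      (b.space b.r).Sig = ∅ ∧
      (∀ m, IsMollifier m → ∀ f ∈ PiecewiseSmooth M Sig,
        ∃ g : (b.space b.r).carrier → ℝ,
          ContMDiffOn (Corner (n + 1)) (modelWithCornersSelf ℝ ℝ) ∞ g (b.domain m b.r) ∧
          ∀ q ∈ b.domain m b.r, b.comp b.r q ∉ (initialSpace M Sig hM).Sig →
            g q = reg m f (b.proj b.r q)) := by
  obtain ⟨c, V, _, _, ⟨D⟩⟩ := hSig.exists_branchData hM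
  obtain ⟨b, hb, hcenter, hempty⟩ := exists_blowupSequence D hM
  have hlin : ∀ k m, IsMollifier m →
      ∃ T : PiecewiseSmooth M Sig →ₗ[ℝ] (b.space k).PiecewiseSmooth (b.domain m k),
        ∀ (f : PiecewiseSmooth M Sig), ∀ q ∈ b.domain m k,
          b.comp k q ∉ (initialSpace M Sig hM).Sig → (T f).1 q = reg m f.1 (b.proj k q) := by
    intro k m hm
    obtain ⟨T, ι, hι, hproj⟩ := hb k
    have hdom : b.domain m k = {q | (ι q).proj ∈ regDomain M m} := by
      ext q
      simp only [BlowupSequence.domain, mem_ofPred_eq, hproj]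
    rw [hdom]
    obtain ⟨L, hL⟩ := hι.exists_linearMap hM hm hSig
    refine ⟨L, fun f q hq hS => ?_⟩
    rw [hproj]
    refine hL f q hq fun h => hS ?_
    rw [← hproj] at h
    exact h
  refine ⟨b, fun k _ => ?_, hcenter, fun k _ m hm => hlin k m hm, hempty, fun m hm f hf => ?_⟩
  · obtain ⟨T, ι, hι, -⟩ := hb k
    exact hι.isRegularized
  · obtain ⟨T, hT⟩ := hlin b.r m hm
    refine ⟨(T ⟨f, hf⟩).1, ?_, hT ⟨f, hf⟩⟩
    -- With an empty discontinuity locus, piecewise smoothness includes smoothness on the whole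
    -- domain.
    have h1 := (T ⟨f, hf⟩).2.1
    rwa [hempty, sdiff_empty] at h1
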